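/- All graphs are finite, simple and undirected. For a vertex $v$ of a graph $G$ let $\mathrm{cl}_G(v)$ be the maximum of $|N_G(v)\cap N_G(w)|$ over all vertices $w\neq v$ not adjacent to $v$ (and $0$ if there is no such $w$). For $\gamma\in\mathbb{N}$, the graph $G$ is weakly $\gamma$-closed if every nonempty induced subgraph $G'$ of $G$ has a vertex $v$ with $\mathrm{cl}_{G'}(v)<\gamma$. An $s$-plex of $G$ is a vertex set $S$ such that every vertex of $G[S]$ has degree at least $|S|-s$ in $G[S]$; it is maximal if no proper superset of $S$ is an $s$-plex. **Theorem.** There is a constant $C$ such that for all integers $s\ge 2$ and $\gamma\ge 0$ every weakly $\gamma$-closed graph on $n\ge 1$ vertices has at most $C\cdot 2^{\gamma}n^{2s-1}$ maximal $s$-plexes. Moreover, there are an algorithm and a constant $C'$ such that for all integers $s\ge 2$ and $\gamma\ge 0$ the algorithm, given $s$ and the adjacency matrix of a weakly $\gamma$-closed graph on $n\ge 1$ vertices (but not $\gamma$), outputs every maximal $s$-plex of the graph exactly once, and nothing else, in at most $C'\cdot 2^{\gamma}n^{2s+1}$ steps. Here an algorithm is a program of a unit-cost word RAM (with addition, truncated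 subtraction, comparison and indirect addressing), run with any word length for which all numbers up to $C'\cdot(s+2^{\gamma}n^{2s+1})$ fit in a word. -/

import Mathlib

/-! ### Graphs: closure number, weakly closed graphs, `s`-plexes -/

namespace WeakClosure

open Classical in
/-- The closure number `cl_G(v)`: the maximum, over all vertices `w ≠ v` not adjacent to `v`,
of the number of common neighbours of `v` and `w` (`0` if there is no such `w`). -/
noncomputable def closureNumber {V : Type*} [Fintype V] (G : SimpleGraph V) (v : V) : ℕ :=
  (Finset.univ.filter fun w => w ≠ v ∧ ¬ G.Adj v w).sup fun w => (G.commonNeighbors v w).ncard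

/-- `G` is weakly `γ`-closed: every (nonempty) induced subgraph has a vertex whose closure number
in that subgraph is less than `γ`. -/
def IsWeaklyClosed {V : Type*} [Fintype V] (G : SimpleGraph V) (γ : ℕ) : Prop :=
  ∀ X : Finset V, X.Nonempty →
    ∃ v : (X : Set V), closureNumber (G.induce (X : Set V)) v < γ

/-- `S` is an `s`-plex: the minimum degree of `G[S]` is at least `|S| - s`. -/
def IsPlex {V : Type*} (G : SimpleGraph V) (s : ℕ) (S : Finset V) : Prop :=
  ∀ v ∈ S, S.card ≤ (G.neighborSet v ∩ (S : Set V)).ncard + s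

/-- `S` is an inclusion-maximal `s`-plex. -/
def IsMaximalPlex {V : Type*} (G : SimpleGraph V) (s : ℕ) (S : Finset V) : Prop :=
  Maximal (IsPlex G s) S

/-! ### The machine model: a word RAM with unit cost

The machine has registers, a random access memory and a write-only output tape, all of which hold
natural numbers.  Programs are structured (`seq`, `ite`, `loop`).  Every instruction and every test
costs one step.  There is a bound `W` on the numbers that fit in a word: an operation whose result
would exceed `W` cannot be executed. -/

/-- Programs.  The arguments `x y z` are register numbers. -/
inductive Program : Type
  /-- `R[x] := c` -/
  | const (x c : ℕ)
  /-- `R[x] := R[y]` -/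
  | copy (x y : ℕ)
  /-- `R[x] := R[y] + R[z]` -/
  | add (x y z : ℕ)
  /-- `R[x] := max (R[y] - R[z]) 0` -/
  | sub (x y z : ℕ)
  /-- `R[x] := M[R[y]]` -/
  | load (x y : ℕ)
  /-- `M[R[x]] := R[y]` -/
  | store (x y : ℕ)
  /-- append `R[x]` to the output -/
  | write (x : ℕ)
  /-- first `p`, then `q` -/
  | seq (p q : Program)
  /-- if `R[x] < R[y]` then `p` else `q` -/
  | ite (x y : ℕ) (p q : Program)
  /-- while `R[x] < R[y]` do `p` -/
  | loop (x y : ℕ) (p : Program)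

/-- A configuration of the machine. -/
structure State : Type where
  /-- the registers -/
  reg : ℕ → ℕ
  /-- the memory -/
  mem : ℕ → ℕ
  /-- what has been written so far, first item first -/
  out : List ℕ

/-- Assign `a` to register `x`. -/
def State.setReg (σ : State) (x a : ℕ) : State :=
  { σ with reg := Function.update σ.reg x a }

/-- `Exec W p σ τ t`: on words that hold the numbers `0, …, W`, the program `p` started in `σ`
halts in `τ` after exactly `t` steps. -/
inductive Exec (W : ℕ) : Program → State → State → ℕ → Prop
  | const (σ : State) (x c : ℕ) (h : c ≤ W) :
      Exec W (.const x c) σ (σ.setReg x c) 1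
  | copy (σ : State) (x y : ℕ) :
      Exec W (.copy x y) σ (σ.setReg x (σ.reg y)) 1
  | add (σ : State) (x y z : ℕ) (h : σ.reg y + σ.reg z ≤ W) :
      Exec W (.add x y z) σ (σ.setReg x (σ.reg y + σ.reg z)) 1
  | sub (σ : State) (x y z : ℕ) :
      Exec W (.sub x y z) σ (σ.setReg x (σ.reg y - σ.reg z)) 1
  | load (σ : State) (x y : ℕ) :
      Exec W (.load x y) σ (σ.setReg x (σ.mem (σ.reg y))) 1
  | store (σ : State) (x y : ℕ) :
      Exec W (.store x y) σ { σ with mem := Function.update σ.mem (σ.reg x) (σ.reg y) } 1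
  | write (σ : State) (x : ℕ) :
      Exec W (.write x) σ { σ with out := σ.out ++ [σ.reg x] } 1
  | seq {p q : Program} {σ τ ρ : State} {t u : ℕ} (hp : Exec W p σ τ t) (hq : Exec W q τ ρ u) :
      Exec W (.seq p q) σ ρ (t + u)
  | iteTrue {x y : ℕ} {p q : Program} {σ τ : State} {t : ℕ} (h : σ.reg x < σ.reg y)
      (hp : Exec W p σ τ t) : Exec W (.ite x y p q) σ τ (t + 1)
  | iteFalse {x y : ℕ} {p q : Program} {σ τ : State} {t : ℕ} (h : ¬ σ.reg x < σ.reg y)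
      (hq : Exec W q σ τ t) : Exec W (.ite x y p q) σ τ (t + 1)
  | loopDone {x y : ℕ} {p : Program} {σ : State} (h : ¬ σ.reg x < σ.reg y) :
      Exec W (.loop x y p) σ σ 1
  | loopStep {x y : ℕ} {p : Program} {σ τ ρ : State} {t u : ℕ} (h : σ.reg x < σ.reg y)
      (hp : Exec W p σ τ t) (hl : Exec W (.loop x y p) τ ρ u) :
      Exec W (.loop x y p) σ ρ (t + 1 + u)

open Classical in
/-- The initial configuration for a graph `G` on `{0, …, n-1}` and a number `s`: register `0` holds
`n`, register `1` holds `s`, memory cell `i * n + j` holds the entry `(i, j)` of the adjacency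
matrix, and everything else is `0`. -/
noncomputable def inputState {n : ℕ} (G : SimpleGraph (Fin n)) (s : ℕ) : State where
  reg := fun x => if x = 0 then n else if x = 1 then s else 0
  mem := fun a => if ∃ i j : Fin n, a = (i : ℕ) * n + (j : ℕ) ∧ G.Adj i j then 1 else 0
  out := []

/-- The encoding of a list of vertex sets as a list of numbers: the characteristic vectors of
length `n` of the sets, one after the other. -/
def encodeSets {n : ℕ} (L : List (Finset (Fin n))) : List ℕ :=
  L.flatMap fun S => List.ofFn fun i : Fin n => if i ∈ S then 1 else 0

/-- `p`, on words that hold `0, …, W`, enumerates the maximal `s`-plexes of `G` in at most `T`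
steps: it halts within `T` steps, having written every maximal `s`-plex exactly once and nothing
else. -/
def EnumeratesMaximalPlexes (W : ℕ) (p : Program) {n : ℕ} (G : SimpleGraph (Fin n))
    (s T : ℕ) : Prop :=
  ∃ (τ : State) (t : ℕ) (L : List (Finset (Fin n))),
    Exec W p (inputState G s) τ t ∧ t ≤ T ∧
      L.Nodup ∧ (∀ S, S ∈ L ↔ IsMaximalPlex G s S) ∧ τ.out = encodeSets L

end WeakClosure

/-! Let `v` have closure number less than γ in `G[X]`, and let `S` be a maximal s-plex of `G[X]`.
Either `S - v` is maximal in `G[X - v]`; then it determines `S`, which is recovered by trying to add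
`v`. Or `v ∈ S`, and some `u ∉ S` enlarges `S - v`. In this second case there is a nonneighbour `p`
of `v` such that all but at most 2s - 3 vertices of `S - v` are common neighbours of `v` and `p`. If
`v` has a nonneighbour in `S`, take it as `p`: both `v` and `p` have at most s nonneighbours in `S`,
among them `v` and `p`, so at most 1 + 2(s - 2) vertices, `p` included, are exceptional. If `v` is
adjacent to the rest of `S`, maximality of `S` forces `u` to be a nonneighbour of `v`; with `p = u`,
at most s - 1 vertices are exceptional. Since `v` and `p` have fewer than γ common neighbours, there
are at most n · n^(2s-3) · 2^γ such candidates (`IsMaximalPlexIn.erase_or_isCandidate`,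
`card_isCandidate_le`), and deleting all n vertices one by one gives the bound
(`card_isMaximalPlexIn_le`).

The algorithm follows this argument. It repeatedly deletes a vertex of least closure number, so γ
need not be known. For every deleted vertex and every pivot it runs through all candidates, encoded
as mixed radix numbers, and completes each greedily: back along the deleted vertices, then along all
vertices. Every result is a maximal plex (`isMaximalPlexIn_greedyPlex`), and every maximal plex is a
result (`IsMaximalPlexIn.exists_isCandidate`, `greedyPlex_eq`). A trie of characteristic vectors
suppresses repetitions. One candidate costs O(n²), which gives the exponent 2s + 1.

The program is written in an array language, verified there with total-correctness triples `Tri`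
that carry time bounds, and transferred to the word RAM by a compiler with constant overhead
(`Run.exec_compile`). -/

namespace WeakClosure

/-! ### A small language with variables and arrays, and its compilation to word RAM programs

Sums occur in it only as addresses, and otherwise numbers grow by increments only. Hence all numbers
of a computation are bounded in terms of the input and of the running time. -/

/-- States of the array language: variables, sixteen arrays, output. -/
structure Store where
  /-- the variables -/
  var : ℕ → ℕ
  /-- the arrays -/
  arr : Fin 16 → ℕ → ℕ
  /-- what has been written so far -/
  out : List ℕ

/-- Assign `k` to the variable `x`. -/
@[simps] def Store.set (σ : Store) (x k : ℕ) : Store :=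
  { σ with var := fun y => if y = x then k else σ.var y }

/-- Assign `k` to the `i`-th entry of the array `a`. -/
@[simps] def Store.put (σ : Store) (a : Fin 16) (i k : ℕ) : Store :=
  { σ with arr := fun b j => if b = a ∧ j = i then k else σ.arr b j }

/-- Expressions of the array language. -/
inductive Tm
  | const (k : ℕ)
  | var (x : ℕ)
  | succ (e : Tm)
  | sub (e f : Tm)
  | lt (e f : Tm)
  | and (e f : Tm)
  | read (a : Fin 16) (e : Tm)
  | readSum (a : Fin 16) (e f : Tm)

/-- The value of an expression. -/
@[simp] def Tm.eval (σ : Store) : Tm → ℕ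
  | .const k => k
  | .var x => σ.var x
  | .succ e => e.eval σ + 1
  | .sub e f => e.eval σ - f.eval σ
  | .lt e f => if e.eval σ < f.eval σ then 1 else 0
  | .and e f => if 0 < e.eval σ then f.eval σ else 0
  | .read a e => σ.arr a (e.eval σ)
  | .readSum a e f => σ.arr a (e.eval σ + f.eval σ)

/-- The size of an expression, where a numeral counts with its value. -/
def Tm.size : Tm → ℕ
  | .const k => k + 1
  | .var _ => 1
  | .succ e => e.size + 1
  | .sub e f => e.size + f.size + 1
  | .lt e f => e.size + f.size + 1
  | .and e f => e.size + f.size + 1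
  | .read _ e => e.size + 1
  | .readSum _ e f => e.size + f.size + 1

/-- Commands of the array language; the tests of `ite` and `loop` ask whether a value is positive. -/
inductive Cmd
  | set (x : ℕ) (e : Tm)
  | put (a : Fin 16) (i e : Tm)
  | write (e : Tm)
  | skip
  | seq (p q : Cmd)
  | ite (e : Tm) (p q : Cmd)
  | loop (e : Tm) (p : Cmd)

/-- An upper bound for the sizes of the expressions of a command. -/
def Cmd.size : Cmd → ℕ
  | .set _ e => e.size
  | .put _ i e => i.size + e.size
  | .write e => e.size
  | .skip => 0
  | .seq p q => p.size + q.size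
  | .ite e p q => e.size + p.size + q.size
  | .loop e p => e.size + p.size

/-- `Run c σ τ t`: the command `c` leads from `σ` to `τ` in `t` steps. -/
inductive Run : Cmd → Store → Store → ℕ → Prop
  | set (σ x e) : Run (.set x e) σ (σ.set x (e.eval σ)) 1
  | put (σ a i e) : Run (.put a i e) σ (σ.put a (i.eval σ) (e.eval σ)) 1
  | write (σ e) : Run (.write e) σ { σ with out := σ.out ++ [e.eval σ] } 1
  | skip (σ) : Run .skip σ σ 1
  | seq {p q σ τ ρ t u} (hp : Run p σ τ t) (hq : Run q τ ρ u) : Run (.seq p q) σ ρ (t + u)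
  | iteTrue {e p q σ τ t} (h : 0 < e.eval σ) (hp : Run p σ τ t) : Run (.ite e p q) σ τ (t + 1)
  | iteFalse {e p q σ τ t} (h : ¬ 0 < e.eval σ) (hq : Run q σ τ t) :
      Run (.ite e p q) σ τ (t + 1)
  | loopDone {e p σ} (h : ¬ 0 < e.eval σ) : Run (.loop e p) σ σ 1
  | loopStep {e p σ τ ρ t u} (h : 0 < e.eval σ) (hp : Run p σ τ t)
      (hl : Run (.loop e p) τ ρ u) : Run (.loop e p) σ ρ (t + 1 + u)

/-- All numbers in a store are at most `m`. -/
def Store.BoundedBy (σ : Store) (m : ℕ) : Prop :=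
  (∀ x, σ.var x ≤ m) ∧ ∀ a i, σ.arr a i ≤ m

theorem Store.BoundedBy.mono {σ : Store} {m k : ℕ} (h : σ.BoundedBy m) (hk : m ≤ k) :
    σ.BoundedBy k :=
  ⟨fun x => (h.1 x).trans hk, fun a i => (h.2 a i).trans hk⟩

/-- A sum is formed only as an address, and what is read there is again at most `m`; only numerals
and successors can exceed `m`, and the size pays for them. -/
theorem Tm.eval_le {σ : Store} {m : ℕ} (h : σ.BoundedBy m) (e : Tm) :
    e.eval σ ≤ m + e.size := by
  induction e with
  | const k => simp only [eval, size]; omega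
  | var x => have := h.1 x; simp only [eval, size]; omega
  | succ e ih => simp only [eval, size]; omega
  | sub e f he hf => simp only [eval, size]; omega
  | lt e f he hf => simp only [eval, size]; split_ifs <;> omega
  | and e f he hf => simp only [eval, size]; split_ifs <;> omega
  | read a e ih => have := h.2 a (e.eval σ); simp only [eval, size]; omega
  | readSum a e f he hf => have := h.2 a (e.eval σ + f.eval σ); simp only [eval, size]; omega

/-- Turn the index in register `x` into the address of the entry of the array `a`. -/
def addressOf (a : Fin 16) (x : ℕ) : Program :=
  -- Four doublings multiply the index by 16, the number of interleaved arrays; then the number of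
  -- the array and the base address in register `1` are added.
  .seq (.add x x x) <| .seq (.add x x x) <| .seq (.add x x x) <| .seq (.add x x x) <|
    .seq (.const (x + 2) a) <| .seq (.add x x (x + 2)) (.add x x 1)

/-- Code that evaluates an expression in register `2 * d + 1`. -/
def Tm.compile : Tm → ℕ → Program
  | .const k, d => .const (2 * d + 1) k
  | .var x, d => .copy (2 * d + 1) (2 * x)
  | .succ e, d => .seq (e.compile d) <| .seq (.const (2 * d + 3) 1) <|
      .add (2 * d + 1) (2 * d + 1) (2 * d + 3)
  | .sub e f, d => .seq (e.compile d) <| .seq (f.compile (d + 1)) <|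
      .sub (2 * d + 1) (2 * d + 1) (2 * d + 3)
  | .lt e f, d => .seq (e.compile d) <| .seq (f.compile (d + 1)) <|
      .ite (2 * d + 1) (2 * d + 3) (.const (2 * d + 1) 1) (.const (2 * d + 1) 0)
  | .and e f, d => .seq (e.compile d) <| .seq (.const (2 * d + 3) 0) <|
      .ite (2 * d + 3) (2 * d + 1) (f.compile d) (.const (2 * d + 1) 0)
  | .read a e, d => .seq (e.compile d) <| .seq (addressOf a (2 * d + 1)) <|
      .load (2 * d + 1) (2 * d + 1)
  | .readSum a e f, d => .seq (e.compile d) <| .seq (f.compile (d + 1)) <|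
      .seq (.add (2 * d + 1) (2 * d + 1) (2 * d + 3)) <| .seq (addressOf a (2 * d + 1)) <|
      .load (2 * d + 1) (2 * d + 1)

/-- Evaluate a test in register `3`, with `0` in register `5` for comparison. -/
def Tm.compileTest (e : Tm) : Program := .seq (e.compile 1) (.const 5 0)

/-- The word RAM program for a command. -/
def Cmd.compile : Cmd → Program
  | .set x e => .seq (e.compile 1) (.copy (2 * x) 3)
  | .put a i e => .seq (e.compile 1) <| .seq (i.compile 2) <| .seq (addressOf a 5) <| .store 5 3
  | .write e => .seq (e.compile 1) (.write 3)
  | .skip => .const 3 0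
  | .seq p q => .seq p.compile q.compile
  | .ite e p q => .seq e.compileTest (.ite 5 3 p.compile q.compile)
  | .loop e p => .seq e.compileTest (.loop 5 3 (.seq p.compile e.compileTest))

/-- The word RAM state `ρ` represents the store `σ`: variables are in the even registers, register
`1` holds the base address `b` of the arrays, which are interleaved. -/
structure Represents (b : ℕ) (σ : Store) (ρ : State) : Prop where
  var : ∀ x, ρ.reg (2 * x) = σ.var x
  base : ρ.reg 1 = b
  arr : ∀ (a : Fin 16) (i : ℕ), ρ.mem (b + 16 * i + a) = σ.arr a i
  out : ρ.out = σ.out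

/-- `ρ'` differs from `ρ` at most in odd registers from `k` on. -/
structure AgreesBelow (k : ℕ) (ρ ρ' : State) : Prop where
  reg : ∀ r, r % 2 = 0 ∨ r < k → ρ'.reg r = ρ.reg r
  mem : ρ'.mem = ρ.mem
  out : ρ'.out = ρ.out

theorem AgreesBelow.trans {k l : ℕ} {ρ ρ' ρ'' : State} (h : AgreesBelow k ρ ρ')
    (h' : AgreesBelow l ρ' ρ'') (hl : k ≤ l) : AgreesBelow k ρ ρ'' :=
  ⟨fun r hr => (h'.reg r (by omega)).trans (h.reg r hr), h'.mem.trans h.mem, h'.out.trans h.out⟩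

theorem AgreesBelow.then_setReg {k x : ℕ} {ρ ρ' : State} (h : AgreesBelow k ρ ρ') (c : ℕ)
    (hx : x % 2 = 1) (hk : k ≤ x) : AgreesBelow k ρ (ρ'.setReg x c) :=
  h.trans (l := k) ⟨fun r hr => Function.update_of_ne (by omega) _ _, rfl, rfl⟩ le_rfl

theorem AgreesBelow.setReg (ρ : State) {k x : ℕ} (c : ℕ) (hx : x % 2 = 1) (hk : k ≤ x) :
    AgreesBelow k ρ (ρ.setReg x c) :=
  ⟨fun r hr => Function.update_of_ne (by omega) _ _, rfl, rfl⟩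

theorem Represents.of_agreesBelow {b k : ℕ} {σ : Store} {ρ ρ' : State} (h : Represents b σ ρ)
    (h' : AgreesBelow k ρ ρ') (hk : 1 < k) : Represents b σ ρ' where
  var x := (h'.reg _ (by omega)).trans (h.var x)
  base := (h'.reg _ (by omega)).trans h.base
  arr a i := by rw [h'.mem, h.arr]
  out := h'.out.trans h.out

@[simp] theorem State.setReg_reg (ρ : State) (x c y : ℕ) :
    (ρ.setReg x c).reg y = if y = x then c else ρ.reg y := by
  simp [State.setReg, Function.update_apply]

theorem exec_addressOf {W b x i : ℕ} {a : Fin 16} {ρ : State} (hx : x % 2 = 1) (hx1 : 1 < x)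
    (hb : ρ.reg 1 = b) (hi : ρ.reg x = i) (hW : b + 16 * i + 16 ≤ W) :
    ∃ ρ', Exec W (addressOf a x) ρ ρ' 7 ∧ ρ'.reg x = b + 16 * i + a ∧ AgreesBelow x ρ ρ' := by
  have ha := a.2
  have h1 : (1 : ℕ) ≠ x := by omega
  have hd : ∀ (ρ : State) (j : ℕ), ρ.reg x = j → j + j ≤ W →
      Exec W (.add x x x) ρ (ρ.setReg x (j + j)) 1 := by
    rintro ρ j rfl h; exact .add _ _ _ _ h
  refine ⟨_, .seq (t := 1) (u := 6) (hd _ i hi (by omega)) <|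
    .seq (t := 1) (u := 5) (hd _ (i + i) (by simp) (by omega)) <|
    .seq (t := 1) (u := 4) (hd _ (i + i + (i + i)) (by simp) (by omega)) <|
    .seq (t := 1) (u := 3) (hd _ (i + i + (i + i) + (i + i + (i + i))) (by simp) (by omega)) <|
    .seq (t := 1) (u := 2) (.const _ (x + 2) a (by omega)) <|
    .seq (t := 1) (u := 1) (.add _ x x (x + 2) ?_) (.add _ x x 1 ?_), ?_, ?_⟩
  · simp; omega
  · simp [h1, hb]; omega
  · simp [h1, hb]; omega
  · refine ⟨fun r hr => ?_, rfl, rfl⟩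
    have : r ≠ x := by omega
    have : r ≠ x + 2 := by omega
    simp [*]

/-- The depth `d` acts as a stack pointer: only odd registers from `2 * d + 1` on are disturbed, so
a first operand survives the evaluation of the second at depth `d + 1`. Depths start at `1` because
register `1` holds the base address. The factor 32 arises since an address multiplies a sum of two
values by 16. -/
theorem Tm.exec_compile {W b m : ℕ} {σ : Store} (hm : σ.BoundedBy m) (e : Tm) :
    ∀ (d : ℕ) (ρ : State), 1 ≤ d → Represents b σ ρ → b + 32 * (m + e.size) + 16 ≤ W →
      ∃ ρ' t, Exec W (e.compile d) ρ ρ' t ∧ t ≤ 12 * e.size ∧ ρ'.reg (2 * d + 1) = e.eval σ ∧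
        AgreesBelow (2 * d + 1) ρ ρ' := by
  induction e with
  | const k =>
    intro d ρ hd hρ hW
    simp only [size] at hW
    exact ⟨_, _, .const _ _ _ (by omega), by simp only [size]; omega, by simp,
      .setReg _ _ (by omega) (by omega)⟩
  | var x =>
    intro d ρ hd hρ hW
    exact ⟨_, _, .copy _ _ _, by simp only [size]; omega, by simp [hρ.var],
      .setReg _ _ (by omega) (by omega)⟩
  | succ e ih =>
    intro d ρ hd hρ hW
    have := e.eval_le hm
    simp only [size] at hW
    obtain ⟨ρ₁, t₁, x₁, b₁, r₁, a₁⟩ := ih d ρ hd hρ (by omega)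
    refine ⟨_, _, .seq x₁ <| .seq (.const _ (2 * d + 3) 1 (by omega)) <| .add _ _ _ _ ?_,
      ?_, ?_, ?_⟩
    · simp [r₁]; omega
    · simp only [size]; omega
    · simp [r₁]
    · exact (a₁.then_setReg _ (by omega) (by omega)).then_setReg _ (by omega) (by omega)
  | sub e f he hf =>
    intro d ρ hd hρ hW
    simp only [size] at hW
    obtain ⟨ρ₁, t₁, x₁, b₁, r₁, a₁⟩ := he d ρ hd hρ (by omega)
    obtain ⟨ρ₂, t₂, x₂, b₂, r₂, a₂⟩ :=
      hf (d + 1) ρ₁ (by omega) (hρ.of_agreesBelow a₁ (by omega)) (by omega)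
    have h₂ : ρ₂.reg (2 * d + 1) = e.eval σ := by rw [a₂.reg _ (by omega), r₁]
    have r₂ : ρ₂.reg (2 * d + 3) = f.eval σ := r₂
    refine ⟨_, _, .seq x₁ <| .seq x₂ <| .sub _ _ _ _, ?_, ?_, ?_⟩
    · simp only [size]; omega
    · simp [h₂, r₂]
    · exact (a₁.trans a₂ (by omega)).then_setReg _ (by omega) (by omega)
  | lt e f he hf =>
    intro d ρ hd hρ hW
    simp only [size] at hW
    obtain ⟨ρ₁, t₁, x₁, b₁, r₁, a₁⟩ := he d ρ hd hρ (by omega)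
    obtain ⟨ρ₂, t₂, x₂, b₂, r₂, a₂⟩ :=
      hf (d + 1) ρ₁ (by omega) (hρ.of_agreesBelow a₁ (by omega)) (by omega)
    have h₂ : ρ₂.reg (2 * d + 1) = e.eval σ := by rw [a₂.reg _ (by omega), r₁]
    have r₂ : ρ₂.reg (2 * d + 3) = f.eval σ := r₂
    have a := a₁.trans a₂ (by omega)
    by_cases h : e.eval σ < f.eval σ
    · refine ⟨_, _, .seq x₁ <| .seq x₂ <| .iteTrue (by rwa [h₂, r₂]) <|
        .const _ _ _ (by omega), ?_, ?_, a.then_setReg _ (by omega) (by omega)⟩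
      · simp only [size]; omega
      · simp [h]
    · refine ⟨_, _, .seq x₁ <| .seq x₂ <| .iteFalse (by rwa [h₂, r₂]) <|
        .const _ _ _ (by omega), ?_, ?_, a.then_setReg _ (by omega) (by omega)⟩
      · simp only [size]; omega
      · simp [h]
  | and e f he hf =>
    intro d ρ hd hρ hW
    simp only [size] at hW
    obtain ⟨ρ₁, t₁, x₁, b₁, r₁, a₁⟩ := he d ρ hd hρ (by omega)
    have a₂ := a₁.then_setReg (x := 2 * d + 3) 0 (by omega) (by omega)
    by_cases h : 0 < e.eval σ
    · obtain ⟨ρ₃, t₃, x₃, b₃, r₃, a₃⟩ :=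
        hf d _ (by omega) (hρ.of_agreesBelow a₂ (by omega)) (by omega)
      refine ⟨_, _, .seq x₁ <| .seq (.const _ _ _ (by omega)) <|
        .iteTrue (by simpa [r₁] using h) x₃, ?_, ?_, a₂.trans a₃ (by omega)⟩
      · simp only [size]; omega
      · simp [h, r₃]
    · refine ⟨_, _, .seq x₁ <| .seq (.const _ _ _ (by omega)) <|
        .iteFalse (by simpa [r₁] using h) <| .const _ _ _ (by omega), ?_, ?_,
        a₂.then_setReg _ (by omega) (by omega)⟩
      · simp only [size]; omega
      · simp [h]
  | read a e ih =>
    intro d ρ hd hρ hW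
    have := e.eval_le hm
    simp only [size] at hW
    obtain ⟨ρ₁, t₁, x₁, b₁, r₁, a₁⟩ := ih d ρ hd hρ (by omega)
    obtain ⟨ρ₂, x₂, r₂, a₂⟩ := exec_addressOf (W := W) (a := a) (by omega) (by omega)
      (hρ.of_agreesBelow a₁ (by omega)).base r₁ (by omega)
    have a := a₁.trans a₂ le_rfl
    refine ⟨_, _, .seq x₁ <| .seq x₂ <| .load _ _ _, ?_, ?_,
      a.then_setReg _ (by omega) (by omega)⟩
    · simp only [size]; omega
    · simp [r₂, (hρ.of_agreesBelow a (by omega)).arr]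
  | readSum a e f he hf =>
    intro d ρ hd hρ hW
    have := e.eval_le hm
    have := f.eval_le hm
    simp only [size] at hW
    obtain ⟨ρ₁, t₁, x₁, b₁, r₁, a₁⟩ := he d ρ hd hρ (by omega)
    obtain ⟨ρ₂, t₂, x₂, b₂, r₂, a₂⟩ :=
      hf (d + 1) ρ₁ (by omega) (hρ.of_agreesBelow a₁ (by omega)) (by omega)
    have h₂ : ρ₂.reg (2 * d + 1) = e.eval σ := by rw [a₂.reg _ (by omega), r₁]
    have r₂ : ρ₂.reg (2 * d + 3) = f.eval σ := r₂
    have a₃ := (a₁.trans a₂ (by omega)).then_setReg (x := 2 * d + 1)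
      (ρ₂.reg (2 * d + 1) + ρ₂.reg (2 * d + 3)) (by omega) le_rfl
    obtain ⟨ρ₄, x₄, r₄, a₄⟩ := exec_addressOf (W := W) (a := a) (x := 2 * d + 1)
      (i := e.eval σ + f.eval σ) (by omega) (by omega)
      (hρ.of_agreesBelow a₃ (by omega)).base (by simp [h₂, r₂]) (by omega)
    have a := a₃.trans a₄ le_rfl
    refine ⟨_, _, .seq x₁ <| .seq x₂ <| .seq (.add _ _ _ _ (by omega)) <| .seq x₄ <| .load _ _ _,
      ?_, ?_, a.then_setReg _ (by omega) (by omega)⟩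
    · simp only [size]; omega
    · simp [r₄, (hρ.of_agreesBelow a (by omega)).arr]

theorem Tm.exec_compileTest {W b m : ℕ} {σ : Store} (hm : σ.BoundedBy m) (e : Tm) {ρ : State}
    (hρ : Represents b σ ρ) (hW : b + 32 * (m + e.size) + 16 ≤ W) :
    ∃ ρ' t, Exec W e.compileTest ρ ρ' t ∧ t ≤ 12 * e.size + 1 ∧ ρ'.reg 3 = e.eval σ ∧
      ρ'.reg 5 = 0 ∧ Represents b σ ρ' := by
  obtain ⟨ρ₁, t₁, x₁, b₁, r₁, a₁⟩ := e.exec_compile hm 1 ρ le_rfl hρ hW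
  exact ⟨_, _, .seq x₁ (.const _ 5 0 (by omega)), by omega, by simpa using r₁, by simp,
    hρ.of_agreesBelow (a₁.then_setReg (x := 5) 0 rfl (by omega)) (by omega)⟩

/-- A run of a command is simulated by its compilation in time that is larger by a constant factor
only, on words that hold all numbers up to a bound linear in the time. -/
theorem Run.exec_compile {W b : ℕ} {c : Cmd} {σ τ : Store} {t : ℕ} (h : Run c σ τ t) :
    ∀ (K m : ℕ) (ρ : State), c.size ≤ K → σ.BoundedBy m → Represents b σ ρ →
      b + 32 * (m + K * (t + 1)) + 16 ≤ W →
      τ.BoundedBy (m + K * t) ∧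
        ∃ ρ' u, Exec W c.compile ρ ρ' u ∧ u ≤ (24 * K + 20) * t ∧ Represents b τ ρ' := by
  induction h with
  | set σ x e =>
    intro K m ρ hK hm hρ hW
    simp only [Cmd.size] at hK
    refine ⟨⟨fun y => ?_, fun a i => ?_⟩, ?_⟩
    · have := hm.1 y
      have := e.eval_le hm
      simp only [Store.set_var]; split_ifs <;> omega
    · exact (hm.2 a i).trans (by simp)
    · obtain ⟨ρ₁, t₁, x₁, b₁, r₁, a₁⟩ := e.exec_compile (W := W) hm 1 ρ le_rfl hρ (by omega)
      have h₁ := hρ.of_agreesBelow a₁ (by omega)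
      refine ⟨_, _, .seq x₁ (.copy _ _ _), ?_, ⟨fun y => ?_, ?_, ?_, ?_⟩⟩
      · rw [Nat.mul_one]; omega
      · simp [h₁.var, ← r₁]
      · rw [State.setReg_reg, if_neg (by omega), h₁.base]
      · exact h₁.arr
      · exact h₁.out
  | put σ a i e =>
    intro K m ρ hK hm hρ hW
    simp only [Cmd.size] at hK
    have hi := i.eval_le hm
    refine ⟨⟨fun y => (hm.1 y).trans (by simp), fun b j => ?_⟩, ?_⟩
    · have := hm.2 b j
      have := e.eval_le hm
      simp only [Store.put_arr]; split_ifs <;> omega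
    · obtain ⟨ρ₁, t₁, x₁, b₁, r₁, a₁⟩ := e.exec_compile (W := W) hm 1 ρ le_rfl hρ (by omega)
      obtain ⟨ρ₂, t₂, x₂, b₂, r₂, a₂⟩ := i.exec_compile (W := W) hm 2 ρ₁ (by omega)
        (hρ.of_agreesBelow a₁ (by omega)) (by omega)
      obtain ⟨ρ₃, x₃, r₃, a₃⟩ := exec_addressOf (W := W) (a := a) (x := 5) rfl (by omega)
        (hρ.of_agreesBelow (a₁.trans a₂ (by omega)) (by omega)).base r₂ (by omega)
      have h₃ := hρ.of_agreesBelow ((a₁.trans a₂ (by omega)).trans a₃ (by omega)) (by omega)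
      have h₄ : ρ₃.reg 3 = e.eval σ := by rw [a₃.reg _ (by omega), a₂.reg _ (by omega), ← r₁]
      refine ⟨_, _, .seq x₁ <| .seq x₂ <| .seq x₃ <| .store _ _ _, ?_,
        ⟨h₃.var, h₃.base, fun c j => ?_, h₃.out⟩⟩
      · rw [Nat.mul_one]; omega
      · have := h₃.arr c j
        have := a.2
        have := c.2
        by_cases hj : c = a ∧ j = i.eval σ
        · obtain ⟨rfl, rfl⟩ := hj
          simp [r₃, h₄]
        -- Array numbers are less than 16, so an address determines both the array and the index.
        · have : ¬ (b + 16 * j + c = b + 16 * i.eval σ + a) := by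
            rw [Fin.ext_iff] at hj; omega
          simpa [Function.update_apply, r₃, hj, this]
  | write σ e =>
    intro K m ρ hK hm hρ hW
    simp only [Cmd.size] at hK
    refine ⟨hm.mono (by omega), ?_⟩
    obtain ⟨ρ₁, t₁, x₁, b₁, r₁, a₁⟩ := e.exec_compile (W := W) hm 1 ρ le_rfl hρ (by omega)
    have h₁ := hρ.of_agreesBelow a₁ (by omega)
    refine ⟨_, _, .seq x₁ (.write _ _), ?_, ⟨h₁.var, h₁.base, h₁.arr, ?_⟩⟩
    · rw [Nat.mul_one]; omega
    simp [h₁.out, ← r₁]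
  | skip σ =>
    intro K m ρ hK hm hρ hW
    exact ⟨hm.mono (by omega), _, _, .const _ _ _ (by omega), by omega, hρ.of_agreesBelow (k := 3)
      ⟨fun r hr => Function.update_of_ne (by omega) _ _, rfl, rfl⟩ (by omega)⟩
  | @seq p q σ τ υ t u hp hq ihp ihq =>
    intro K m ρ hK hm hρ hW
    simp only [Cmd.size] at hK
    simp only [Nat.mul_add, Nat.add_mul] at *
    obtain ⟨hm₁, ρ₁, t₁, x₁, b₁, h₁⟩ := ihp K m ρ (by omega) hm hρ (by omega)
    obtain ⟨hm₂, ρ₂, t₂, x₂, b₂, h₂⟩ := ihq K _ ρ₁ (by omega) hm₁ h₁ (by omega)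
    exact ⟨hm₂.mono (by omega), ρ₂, _, .seq x₁ x₂, by omega, h₂⟩
  | @iteTrue e p q σ τ t h hp ih =>
    intro K m ρ hK hm hρ hW
    simp only [Cmd.size] at hK
    simp only [Nat.mul_add, Nat.add_mul] at *
    obtain ⟨ρ₁, t₁, x₁, b₁, r₁, z₁, h₁⟩ := Tm.exec_compileTest hm e hρ (W := W) (by omega)
    obtain ⟨hm₂, ρ₂, t₂, x₂, b₂, h₂⟩ := ih K m ρ₁ (by omega) hm h₁ (by omega)
    exact ⟨hm₂.mono (by omega), ρ₂, _, .seq x₁ (.iteTrue (by rwa [r₁, z₁]) x₂), by omega, h₂⟩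
  | @iteFalse e p q σ τ t h hp ih =>
    intro K m ρ hK hm hρ hW
    simp only [Cmd.size] at hK
    simp only [Nat.mul_add, Nat.add_mul] at *
    obtain ⟨ρ₁, t₁, x₁, b₁, r₁, z₁, h₁⟩ := Tm.exec_compileTest hm e hρ (W := W) (by omega)
    obtain ⟨hm₂, ρ₂, t₂, x₂, b₂, h₂⟩ := ih K m ρ₁ (by omega) hm h₁ (by omega)
    exact ⟨hm₂.mono (by omega), ρ₂, _, .seq x₁ (.iteFalse (by rwa [r₁, z₁]) x₂), by omega, h₂⟩
  | @loopDone e p σ h =>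
    intro K m ρ hK hm hρ hW
    simp only [Cmd.size] at hK
    simp only [Nat.mul_add, Nat.add_mul] at *
    obtain ⟨ρ₁, t₁, x₁, b₁, r₁, z₁, h₁⟩ := Tm.exec_compileTest hm e hρ (W := W) (by omega)
    exact ⟨hm.mono (by omega), ρ₁, _, .seq x₁ (.loopDone (by rwa [r₁, z₁])), by omega, h₁⟩
  | @loopStep e p σ τ υ t u h hp hl ihp ihl =>
    intro K m ρ hK hm hρ hW
    simp only [Cmd.size] at hK ihl
    simp only [Nat.mul_add, Nat.add_mul] at *
    obtain ⟨ρ₁, t₁, x₁, b₁, r₁, z₁, h₁⟩ := Tm.exec_compileTest hm e hρ (W := W) (by omega)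
    obtain ⟨hm₂, ρ₂, t₂, x₂, b₂, h₂⟩ := ihp K m ρ₁ (by omega) hm h₁ (by omega)
    obtain ⟨hm₃, ρ₃, t₃, x₃, b₃, h₃⟩ := ihl K _ ρ₂ (by omega) hm₂ h₂ (by omega)
    -- The compiled loop evaluates its test before the loop and again at the end of the body. The
    -- simulated remainder is such a test followed by a loop; splitting it moves the test into the
    -- body just executed.
    cases x₃ with
    | seq y z => 
      exact ⟨hm₃.mono (by omega), ρ₃, _, .seq x₁ (.loopStep (by rwa [r₁, z₁]) (.seq x₂ y) z),
        by omega, h₃⟩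

/-! ### Maximal plexes in weakly closed graphs -/

section Plex

open Classical

variable {V : Type*} [DecidableEq V] {G : SimpleGraph V} {s : ℕ}

/-- Being an s-plex bounds the nonneighbours inside `S`, where every vertex counts itself. In this
form heredity is evident, and insertions become a matter of counting. -/
theorem isPlex_iff {S : Finset V} :
    IsPlex G s S ↔ ∀ v ∈ S, (S.filter fun x => ¬ G.Adj v x).card ≤ s := by
  refine forall₂_congr fun v _ => ?_
  have h : G.neighborSet v ∩ (S : Set V) = ((S.filter fun x => G.Adj v x : Finset V) : Set V) := by
    ext x; simp [and_comm]
  have := S.card_filter_add_card_filter_not fun x => G.Adj v x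
  rw [h, Set.ncard_coe_finset]
  omega

theorem IsPlex.mono {S T : Finset V} (hT : IsPlex G s T) (h : S ⊆ T) : IsPlex G s S :=
  isPlex_iff.2 fun v hv => (Finset.card_le_card (Finset.filter_subset_filter _ h)).trans
    (isPlex_iff.1 hT v (h hv))

theorem isPlex_singleton (hs : 1 ≤ s) (v : V) : IsPlex G s {v} :=
  isPlex_iff.2 fun _ _ => (Finset.card_filter_le _ _).trans (by simpa using hs)

/-- `S` is an inclusion-maximal `s`-plex of `G[X]`. -/
structure IsMaximalPlexIn (G : SimpleGraph V) (s : ℕ) (X S : Finset V) : Prop where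
  subset : S ⊆ X
  isPlex : IsPlex G s S
  mem_of_insert : ∀ u ∈ X, IsPlex G s (insert u S) → u ∈ S

/-- By heredity, a set with a larger plex above it can already be enlarged by a single vertex. -/
theorem isMaximalPlexIn_univ [Fintype V] {S : Finset V} :
    IsMaximalPlexIn G s Finset.univ S ↔ IsMaximalPlex G s S := by
  refine ⟨fun h => ⟨h.isPlex, fun T hT hST u hu => ?_⟩,
    fun h => ⟨Finset.subset_univ _, h.1, fun u _ hu => ?_⟩⟩
  · exact h.mem_of_insert u (Finset.mem_univ _) (hT.mono (Finset.insert_subset hu hST))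
  · exact h.2 hu (Finset.subset_insert _ _) (Finset.mem_insert_self _ _)

/-- Add `u` to `S` if this gives an `s`-plex. -/
noncomputable def tryAdd (G : SimpleGraph V) (s : ℕ) (S : Finset V) (u : V) : Finset V :=
  if IsPlex G s (insert u S) then insert u S else S

theorem subset_tryAdd (S : Finset V) (u : V) : S ⊆ tryAdd G s S u := by
  unfold tryAdd; split_ifs
  exacts [Finset.subset_insert _ _, subset_rfl]

theorem subset_foldl_tryAdd (l : List V) (S : Finset V) : S ⊆ l.foldl (tryAdd G s) S := by
  induction l generalizing S with
  | nil => exact subset_rfl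
  | cons u l ih => exact (subset_tryAdd S u).trans (ih _)

/-- The set held when `u` was tried is contained in the final set, so by heredity a vertex that fits
at the end would have been accepted then. -/
theorem mem_foldl_tryAdd (l : List V) (S : Finset V) {u : V} (hu : u ∈ l)
    (h : IsPlex G s (insert u (l.foldl (tryAdd G s) S))) : u ∈ l.foldl (tryAdd G s) S := by
  induction l generalizing S with
  | nil => simp at hu
  | cons w l ih =>
    rcases List.mem_cons.1 hu with rfl | hu
    · rw [List.foldl_cons] at h ⊢
      refine subset_foldl_tryAdd l _ ?_
      rw [tryAdd, if_pos]
      · exact Finset.mem_insert_self _ _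
      · exact h.mono (Finset.insert_subset_insert _
          ((subset_tryAdd S u).trans (subset_foldl_tryAdd l _)))
    · exact ih _ hu h

/-- By heredity all intermediate sets are plexes, so no vertex is rejected. -/
theorem foldl_tryAdd_eq_union (l : List V) (S : Finset V) (h : IsPlex G s (S ∪ l.toFinset)) :
    l.foldl (tryAdd G s) S = S ∪ l.toFinset := by
  induction l generalizing S with
  | nil => simp
  | cons u l ih =>
    rw [List.toFinset_cons, Finset.union_insert, ← Finset.insert_union] at h ⊢
    rw [List.foldl_cons, tryAdd, if_pos (h.mono Finset.subset_union_left), ih _ h]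

theorem IsMaximalPlexIn.foldl_tryAdd_eq {X S : Finset V} (hS : IsMaximalPlexIn G s X S)
    (l : List V) (hl : ∀ u ∈ l, u ∈ X) : l.foldl (tryAdd G s) S = S := by
  induction l with
  | nil => rfl
  | cons u l ih =>
    have : tryAdd G s S u = S := by
      unfold tryAdd; split_ifs with h
      · exact Finset.insert_eq_self.2 (hS.mem_of_insert u (hl u List.mem_cons_self) h)
      · rfl
    rw [List.foldl_cons, this, ih fun x hx => hl x (List.mem_cons_of_mem _ hx)]

/-! ### Candidates, and the bound on the number of maximal plexes -/

/-- The common neighbours of `v` and `p` in `X`, if `p` is a nonneighbour of `v` in `X`. -/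
noncomputable def pivotNbrs (G : SimpleGraph V) (X : Finset V) (v p : V) : Finset V :=
  X.filter fun x => p ∈ X ∧ p ≠ v ∧ ¬ G.Adj v p ∧ G.Adj v x ∧ G.Adj p x

/-- `S` consists of `v`, at most `2 * s - 3` other vertices, and common neighbours of `v` and a
nonneighbour of `v`. -/
def IsCandidate (G : SimpleGraph V) (s : ℕ) (X : Finset V) (v : V) (S : Finset V) : Prop :=
  ∃ p ∈ X, ∃ T B, T ⊆ X ∧ T.card ≤ 2 * s - 3 ∧ B ⊆ pivotNbrs G X v p ∧ S = insert v (T ∪ B)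

/-- This makes `S` a function of `S.erase v`, both for counting and for reconstruction by the
algorithm. -/
theorem IsMaximalPlexIn.tryAdd_erase {X S : Finset V} {v : V} (hv : v ∈ X)
    (hS : IsMaximalPlexIn G s X S) : tryAdd G s (S.erase v) v = S := by
  by_cases hvS : v ∈ S
  · rw [tryAdd, Finset.insert_erase hvS, if_pos hS.isPlex]
  · rw [Finset.erase_eq_of_notMem hvS, tryAdd, if_neg fun h => hvS (hS.mem_of_insert v hv h)]

/-- The core of the theorem. If `v ∈ S` and `S.erase v` is not maximal, some `u` enlarges it. The
pivot is a nonneighbour of `v` inside `S` if there is one, and `u` otherwise. -/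
theorem IsMaximalPlexIn.erase_or_isCandidate {X S : Finset V} {v : V} (hv : v ∈ X)
    (hS : IsMaximalPlexIn G s X S) :
    IsMaximalPlexIn G s (X.erase v) (S.erase v) ∨ IsCandidate G s X v S := by
  by_cases hvS : v ∈ S
  swap
  · left
    rw [Finset.erase_eq_of_notMem hvS]
    exact ⟨fun x hx => Finset.mem_erase.2 ⟨fun h => hvS (h ▸ hx), hS.subset hx⟩, hS.isPlex,
      fun u hu => hS.mem_of_insert u (Finset.mem_of_mem_erase hu)⟩
  refine or_iff_not_imp_left.2 fun hmax => ?_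
  obtain ⟨u, huX, huv, huS, hu⟩ : ∃ u ∈ X, u ≠ v ∧ u ∉ S ∧ IsPlex G s (insert u (S.erase v)) := by
    by_contra! hcon
    refine hmax ⟨Finset.erase_subset_erase _ hS.subset,
      hS.isPlex.mono (Finset.erase_subset _ _), fun u hu h => ?_⟩
    have hu' := Finset.mem_erase.1 hu
    exact Finset.mem_erase.2 ⟨hu'.1, by_contra fun h' => hcon u hu'.2 hu'.1 h' h⟩
  have hplex := isPlex_iff.1 hS.isPlex
  by_cases hw : ∃ w ∈ S, w ≠ v ∧ ¬ G.Adj v w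
  · obtain ⟨w, hwS, hwv, hvw⟩ := hw
    -- Applied to `v` and to `w`: two of the at most `s` nonneighbours are `v` and `w` themselves,
    -- so at most `s - 2` others remain for each, and `w` together with these makes at most `2 * s -
    -- 3`.
    have key : ∀ a ∈ S, ¬ G.Adj a v → ¬ G.Adj a w →
        (((S.erase v).erase w).filter fun x => ¬ G.Adj a x).card + 2 ≤ s := by
      intro a ha hav haw
      refine le_trans (le_of_eq ?_) (hplex a ha)
      rw [Finset.filter_erase, Finset.filter_erase, Finset.card_erase_of_mem (by simp [*]),
        Finset.card_erase_of_mem (by simp [*])]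
      have : ({v, w} : Finset V) ⊆ S.filter fun x => ¬ G.Adj a x := by
        intro x hx
        rcases Finset.mem_insert.1 hx with rfl | hx
        · simp [*]
        · rw [Finset.mem_singleton.1 hx]; simp [*]
      have := Finset.card_le_card this
      rw [Finset.card_pair hwv.symm] at this
      omega
    have h1 := key v hvS (by simp) hvw
    have h2 := key w hwS (fun h => hvw h.symm) (by simp)
    refine ⟨w, hS.subset hwS, insert w ((((S.erase v).erase w).filter fun x => ¬ G.Adj v x) ∪
      (((S.erase v).erase w).filter fun x => ¬ G.Adj w x)),
      S.filter fun x => G.Adj v x ∧ G.Adj w x, ?_, ?_, ?_, ?_⟩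
    · intro x hx
      simp only [Finset.mem_insert, Finset.mem_union, Finset.mem_filter, Finset.mem_erase] at hx
      exact hS.subset (by grind)
    · refine (Finset.card_insert_le _ _).trans ?_
      have := Finset.card_union_le (((S.erase v).erase w).filter fun x => ¬ G.Adj v x)
        (((S.erase v).erase w).filter fun x => ¬ G.Adj w x)
      omega
    · intro x hx
      have hx := Finset.mem_filter.1 hx
      exact Finset.mem_filter.2 ⟨hS.subset hx.1, hS.subset hwS, hwv, hvw, hx.2⟩
    · ext x
      simp only [Finset.mem_insert, Finset.mem_union, Finset.mem_filter, Finset.mem_erase]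
      grind
  · push Not at hw
    -- If `v` were adjacent to `u`, then in `insert u S` it would be adjacent to all other vertices.
    -- Restoring it to `insert u (S.erase v)` would add no nonneighbour to any of them, so `u` would
    -- fit into `S`.
    have hvu : ¬ G.Adj v u := by
      intro hvu
      refine huS (hS.mem_of_insert u huX (isPlex_iff.2 fun x hx => ?_))
      by_cases hxv : x = v
      · subst hxv
        refine le_trans (Finset.card_le_card fun y hy => ?_) (hplex x hvS)
        simp only [Finset.mem_insert, Finset.mem_filter] at hy ⊢
        grind
      · have hxv' : G.Adj x v := by
          rcases Finset.mem_insert.1 hx with rfl | hx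
          exacts [hvu.symm, (hw x hx hxv).symm]
        refine le_trans (Finset.card_le_card fun y hy => ?_) (isPlex_iff.1 hu x (by grind))
        simp only [Finset.mem_insert, Finset.mem_filter, Finset.mem_erase] at hy ⊢
        grind
    have h1 := isPlex_iff.1 hu u (Finset.mem_insert_self _ _)
    -- As `u` counts itself, at most `s - 1` nonneighbours are left in `S.erase v`.
    rw [Finset.filter_insert, if_pos (by simp), Finset.card_insert_of_notMem (by simp [huS])] at h1
    refine ⟨u, huX, (S.erase v).filter fun x => ¬ G.Adj u x,
      (S.erase v).filter fun x => G.Adj u x, ?_, ?_, ?_, ?_⟩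
    · exact (Finset.filter_subset _ _).trans ((Finset.erase_subset _ _).trans hS.subset)
    · omega
    · intro x hx
      simp only [Finset.mem_filter, Finset.mem_erase] at hx
      exact Finset.mem_filter.2 ⟨hS.subset hx.1.2, huX, huv, hvu, hw x hx.1.2 hx.1.1, hx.2⟩
    · ext x
      simp only [Finset.mem_insert, Finset.mem_union, Finset.mem_filter, Finset.mem_erase]
      grind

theorem IsWeaklyClosed.exists_card_pivotNbrs_lt [Fintype V] {γ : ℕ} (h : IsWeaklyClosed G γ)
    {X : Finset V} (hX : X.Nonempty) : ∃ v ∈ X, ∀ p, (pivotNbrs G X v p).card < γ := by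
  obtain ⟨⟨v, hv⟩, hlt⟩ := h X hX
  refine ⟨v, hv, fun p => ?_⟩
  by_cases hp : p ∈ X ∧ p ≠ v ∧ ¬ G.Adj v p
  · refine lt_of_le_of_lt ?_ hlt
    have : (pivotNbrs G X v p : Set V) = Subtype.val ''
        ((G.induce (X : Set V)).commonNeighbors ⟨v, hv⟩ ⟨p, hp.1⟩) := by
      ext x
      simp [pivotNbrs, hp, SimpleGraph.mem_commonNeighbors, and_comm, and_left_comm]
    rw [← Set.ncard_coe_finset, this, Set.ncard_image_of_injective _ Subtype.val_injective]
    unfold closureNumber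
    refine Finset.le_sup (f := fun w => ((G.induce (X : Set V)).commonNeighbors ⟨v, hv⟩ w).ncard) ?_
    simpa using hp.2
  · have : pivotNbrs G X v p = ∅ := Finset.filter_false_of_mem fun x _ hx => hp ⟨hx.1, hx.2.1, hx.2.2.1⟩
    rw [this, Finset.card_empty]
    omega

/-- Sets of at most `m` vertices become tuples of length exactly `m`, padded with `v`; the padding
is harmless because `v` belongs to the set anyway. -/
theorem exists_insert_image_eq (v : V) (T : Finset V) {m : ℕ} (hT : T.card ≤ m) :
    ∃ f : ℕ → V, (∀ i, f i ∈ insert v T) ∧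
      insert v ((Finset.range m).image f) = insert v T := by
  have hf : ∀ i, T.toList.getD i v ∈ insert v T := fun i => by
    rw [List.getD_eq_getElem?_getD]
    by_cases h : i < T.toList.length
    · rw [List.getElem?_eq_getElem h]
      exact Finset.mem_insert_of_mem (Finset.mem_toList.1 (List.getElem_mem h))
    · rw [List.getElem?_eq_none (not_lt.1 h)]
      exact Finset.mem_insert_self _ _
  refine ⟨fun i => T.toList.getD i v, hf, ?_⟩
  apply subset_antisymm
  · refine Finset.insert_subset (Finset.mem_insert_self _ _) fun x hx => ?_
    obtain ⟨i, -, rfl⟩ := Finset.mem_image.1 hx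
    exact hf i
  · refine Finset.insert_subset_insert _ fun x hx => ?_
    obtain ⟨i, hi, rfl⟩ := List.mem_iff_getElem.1 (Finset.mem_toList.2 hx)
    refine Finset.mem_image.2 ⟨i, Finset.mem_range.2 ?_, ?_⟩
    · rw [Finset.length_toList] at hi; omega
    · rw [Finset.length_toList] at hi
      simp [List.getD_eq_getElem?_getD, hi]

/-- The factors count the pivot, the tuple of exceptional vertices, and the subset of the common
neighbours. -/
theorem card_isCandidate_le [Fintype V] {γ : ℕ} {X : Finset V} {v : V}
    (hv : ∀ p, (pivotNbrs G X v p).card ≤ γ) :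
    (Finset.univ.filter fun S => IsCandidate G s X v S).card ≤
      Fintype.card V * (Fintype.card V ^ (2 * s - 3) * 2 ^ γ) := by
  have hsub : (Finset.univ.filter fun S => IsCandidate G s X v S) ⊆
      (Finset.univ : Finset V).biUnion fun p => (Finset.univ : Finset (Fin (2 * s - 3) → V)).biUnion
        fun f => (pivotNbrs G X v p).powerset.image fun B => insert v (Finset.univ.image f ∪ B) := by
    intro S hS
    obtain ⟨p, -, T, B, -, hT, hB, rfl⟩ := (Finset.mem_filter.1 hS).2
    obtain ⟨f, -, hf⟩ := exists_insert_image_eq v T hT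
    simp only [Finset.mem_biUnion, Finset.mem_univ, true_and, Finset.mem_image, Finset.mem_powerset]
    refine ⟨p, fun i => f i, B, hB, ?_⟩
    rw [← Finset.insert_union, ← Finset.insert_union, ← hf]
    congr 2
    ext x
    simp only [Finset.mem_image, Finset.mem_univ, true_and, Finset.mem_range]
    exact ⟨fun ⟨i, hi⟩ => ⟨i, i.2, hi⟩, fun ⟨i, hi, h⟩ => ⟨⟨i, hi⟩, h⟩⟩
  refine (Finset.card_le_card hsub).trans ((Finset.card_biUnion_le_card_mul _ _ _ fun p _ =>
    (Finset.card_biUnion_le_card_mul _ _ _ fun f _ =>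
      (Finset.card_image_le.trans ?_ : _ ≤ 2 ^ γ))).trans (le_of_eq ?_))
  · rw [Finset.card_powerset]
    exact Nat.pow_le_pow_right two_pos (hv p)
  · simp

/-- Each deletion of a vertex of small closure number accounts for one batch of candidates; the
summand `1` is the empty plex of the empty graph. -/
theorem card_isMaximalPlexIn_le [Fintype V] {γ : ℕ} (h : IsWeaklyClosed G γ) (X : Finset V) :
    (Finset.univ.filter fun S => IsMaximalPlexIn G s X S).card ≤
      X.card * (Fintype.card V * (Fintype.card V ^ (2 * s - 3) * 2 ^ γ)) + 1 := by
  induction X using Finset.strongInduction with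
  | H X ih =>
    rcases X.eq_empty_or_nonempty with rfl | hX
    · refine (Finset.card_le_card (t := {∅}) fun S hS => ?_).trans (by simp)
      simpa using (Finset.mem_filter.1 hS).2.subset
    obtain ⟨v, hv, hγ⟩ := h.exists_card_pivotNbrs_lt hX
    have hsub : (Finset.univ.filter fun S => IsMaximalPlexIn G s X S) ⊆
        ((Finset.univ.filter fun S => IsMaximalPlexIn G s (X.erase v) S).image
          fun S => tryAdd G s S v) ∪ Finset.univ.filter fun S => IsCandidate G s X v S := by
      intro S hS
      have hS := (Finset.mem_filter.1 hS).2
      rcases hS.erase_or_isCandidate hv with h | h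
      · exact Finset.mem_union_left _ (Finset.mem_image.2 ⟨S.erase v, by simpa using h,
          hS.tryAdd_erase hv⟩)
      · exact Finset.mem_union_right _ (by simpa using h)
    have h1 := ih _ (Finset.erase_ssubset hv)
    have h2 := card_isCandidate_le (s := s) fun p => (hγ p).le
    have h3 := (Finset.card_le_card hsub).trans (Finset.card_union_le _ _)
    have h4 : ((Finset.univ.filter fun S => IsMaximalPlexIn G s (X.erase v) S).image
      fun S => tryAdd G s S v).card ≤ _ := Finset.card_image_le
    obtain ⟨k, hk⟩ : ∃ k, X.card = k + 1 := ⟨_, (Finset.card_erase_add_one hv).symm⟩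
    rw [Finset.card_erase_of_mem hv, hk, Nat.add_sub_cancel] at h1
    rw [hk, Nat.add_mul]
    omega

theorem ncard_isMaximalPlex_le [Fintype V] [Nonempty V] {γ : ℕ} (hs : 2 ≤ s)
    (h : IsWeaklyClosed G γ) : {S : Finset V | IsMaximalPlex G s S}.ncard ≤
      2 * (2 ^ γ * Fintype.card V ^ (2 * s - 1)) := by
  have h1 := card_isMaximalPlexIn_le (s := s) h Finset.univ
  have h2 : {S : Finset V | IsMaximalPlex G s S} =
      ((Finset.univ.filter fun S => IsMaximalPlexIn G s Finset.univ S : Finset (Finset V)) :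
        Set (Finset V)) := by
    ext S; simp [isMaximalPlexIn_univ]
  have h3 : 0 < 2 ^ γ * Fintype.card V ^ (2 * s - 1) :=
    Nat.mul_pos (by positivity) (pow_pos Fintype.card_pos _)
  have h4 : 2 ^ γ * Fintype.card V ^ (2 * s - 1) =
      Fintype.card V * (Fintype.card V * (Fintype.card V ^ (2 * s - 3) * 2 ^ γ)) := by
    rw [show 2 * s - 1 = (2 * s - 3) + 2 by omega, pow_add]; ring
  rw [h2, Set.ncard_coe_finset]
  rw [Finset.card_univ] at h1
  omega

/-! ### The deletion ordering and reconstruction along it -/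

/-- The vertices of `X` that are not among `ord 0, …, ord (i - 1)`. -/
noncomputable def remaining (X : Finset V) (ord : ℕ → V) (i : ℕ) : Finset V :=
  X \ (Finset.range i).image ord

theorem remaining_zero (X : Finset V) (ord : ℕ → V) : remaining X ord 0 = X := by
  simp [remaining]

theorem remaining_succ (X : Finset V) (ord : ℕ → V) (i : ℕ) :
    remaining X ord (i + 1) = (remaining X ord i).erase (ord i) := by
  ext x
  simp only [remaining, Finset.range_add_one, Finset.mem_sdiff, Finset.image_insert,
    Finset.mem_insert, Finset.mem_erase]
  tauto

theorem card_remaining {X : Finset V} {ord : ℕ → V} {k : ℕ}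
    (hord : ∀ i < k, ord i ∈ remaining X ord i) : (remaining X ord k).card = X.card - k := by
  induction k with
  | zero => simp [remaining]
  | succ k ih =>
    rw [remaining_succ, Finset.card_erase_of_mem (hord k (by omega)), ih fun i hi => hord i (by omega)]
    omega

/-- `ord (i - 1), …, ord 0`. -/
def descending (ord : ℕ → V) (i : ℕ) : List V := (List.range i).map fun j => ord (i - 1 - j)

theorem descending_succ (ord : ℕ → V) (i : ℕ) :
    descending ord (i + 1) = ord i :: descending ord i := by
  unfold descending
  rw [List.range_succ_eq_map, List.map_cons, List.map_map]
  simp only [List.cons.injEq]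
  exact ⟨by simp, List.map_congr_left fun j _ => by simp; congr 1; omega⟩

/-- A maximal plex is a candidate for some vertex of the ordering, extended greedily along the
preceding vertices. -/
theorem IsMaximalPlexIn.exists_isCandidate {X S : Finset V} {ord : ℕ → V} {n : ℕ} (hn : 1 ≤ n)
    (hs : 1 ≤ s) (hX : X.card = n) (hord : ∀ i < n, ord i ∈ remaining X ord i)
    (hS : IsMaximalPlexIn G s X S) :
    ∃ i < n, ∃ S', IsCandidate G s (remaining X ord i) (ord i) S' ∧ IsPlex G s S' ∧
      (descending ord i).foldl (tryAdd G s) S' = S := by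
  have key : ∀ i ≤ n, (∃ S', IsMaximalPlexIn G s (remaining X ord i) S' ∧
      (descending ord i).foldl (tryAdd G s) S' = S) ∨
      ∃ i < n, ∃ S', IsCandidate G s (remaining X ord i) (ord i) S' ∧ IsPlex G s S' ∧
      (descending ord i).foldl (tryAdd G s) S' = S := by
    intro i
    induction i with
    | zero => exact fun _ => .inl ⟨S, by rwa [remaining_zero], rfl⟩
    | succ i ih =>
      intro hi
      rcases ih (by omega) with ⟨S', hS', hf⟩ | h
      · have ho := hord i (by omega)
        rcases hS'.erase_or_isCandidate ho with h | h
        · refine .inl ⟨S'.erase (ord i), by rwa [remaining_succ], ?_⟩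
          rw [descending_succ, List.foldl_cons, hS'.tryAdd_erase ho, hf]
        · exact .inr ⟨i, by omega, S', h, hS'.isPlex, hf⟩
      · exact .inr h
  -- If no candidate occurs, only the empty plex remains after all deletions. The first vertex put
  -- back is then accepted, so its singleton serves as a candidate of the last level, with empty `T`
  -- and `B`.
  rcases key n le_rfl with ⟨S', hS', hf⟩ | h
  · obtain ⟨k, rfl⟩ : ∃ k, n = k + 1 := ⟨n - 1, by omega⟩
    have h0 : remaining X ord (k + 1) = ∅ :=
      Finset.card_eq_zero.1 (by rw [card_remaining hord, hX, Nat.sub_self])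
    have h1 : S' = ∅ := Finset.subset_empty.1 (h0 ▸ hS'.subset)
    subst h1
    refine ⟨k, by omega, {ord k}, ⟨ord k, hord k (by omega), ∅, ∅, by simp, by simp, by simp,
      by simp⟩, isPlex_singleton hs _, ?_⟩
    have h2 : tryAdd G s ∅ (ord k) = {ord k} := if_pos (isPlex_singleton hs _)
    rwa [descending_succ, List.foldl_cons, h2] at hf
  · exact h

end Plex

/-! ### Graphs on the natural numbers -/

section Nat

open Classical

variable {n s : ℕ} {G : SimpleGraph (Fin n)}

/-- A graph on `{0, …, n - 1}` as a graph on the natural numbers. -/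
def natGraph (G : SimpleGraph (Fin n)) : SimpleGraph ℕ := G.map Fin.valEmbedding

theorem natGraph_adj {a b : Fin n} : (natGraph G).Adj a b ↔ G.Adj a b :=
  SimpleGraph.map_adj_apply (f := Fin.valEmbedding)

theorem isPlex_natGraph {S : Finset (Fin n)} :
    IsPlex (natGraph G) s (S.map Fin.valEmbedding) ↔ IsPlex G s S := by
  simp only [isPlex_iff, Finset.forall_mem_map]
  refine forall₂_congr fun v _ => ?_
  rw [Finset.filter_map, Finset.card_map]
  simp only [Function.comp_def, Fin.valEmbedding_apply, natGraph_adj]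

theorem isMaximalPlexIn_natGraph {S : Finset (Fin n)} :
    IsMaximalPlexIn (natGraph G) s (Finset.range n) (S.map Fin.valEmbedding) ↔
      IsMaximalPlex G s S := by
  have hins : ∀ u : Fin n, insert (u : ℕ) (S.map Fin.valEmbedding) =
      (insert u S).map Fin.valEmbedding := fun u => by simp
  rw [← isMaximalPlexIn_univ]
  constructor
  · intro h
    refine ⟨Finset.subset_univ _, isPlex_natGraph.1 h.isPlex, fun u _ hu => ?_⟩
    have := h.mem_of_insert u (by simp) (by rwa [hins, isPlex_natGraph])
    simpa [Fin.val_inj] using this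
  · intro h
    refine ⟨fun x hx => ?_, isPlex_natGraph.2 h.isPlex, fun u hu hp => ?_⟩
    · obtain ⟨u, -, rfl⟩ := Finset.mem_map.1 hx
      simp
    · lift u to Fin n using Finset.mem_range.1 hu
      rw [hins, isPlex_natGraph] at hp
      exact Finset.mem_map.2 ⟨u, h.mem_of_insert u (Finset.mem_univ _) hp, rfl⟩

theorem IsWeaklyClosed.exists_card_pivotNbrs_natGraph_lt {γ : ℕ} (h : IsWeaklyClosed G γ)
    {X : Finset ℕ} (hX : X ⊆ Finset.range n) (hne : X.Nonempty) :
    ∃ v ∈ X, ∀ p, (pivotNbrs (natGraph G) X v p).card < γ := by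
  obtain ⟨Y, rfl⟩ : ∃ Y : Finset (Fin n), X = Y.map Fin.valEmbedding :=
    ⟨Finset.univ.filter fun i : Fin n => (i : ℕ) ∈ X, by
      ext x
      simp only [Finset.mem_map, Finset.mem_filter, Finset.mem_univ, true_and, Fin.valEmbedding_apply]
      exact ⟨fun hx => ⟨⟨x, Finset.mem_range.1 (hX hx)⟩, hx, rfl⟩, fun ⟨a, ha, h⟩ => h ▸ ha⟩⟩
  obtain ⟨v, hv, hlt⟩ := h.exists_card_pivotNbrs_lt (X := Y) (Finset.map_nonempty.1 hne)
  refine ⟨v, by simpa [Fin.val_inj] using hv, fun p => ?_⟩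
  by_cases hp : p ∈ Y.map Fin.valEmbedding
  · obtain ⟨q, hq, rfl⟩ := Finset.mem_map.1 hp
    refine lt_of_eq_of_lt ?_ (hlt q)
    rw [pivotNbrs, pivotNbrs, Finset.filter_map, Finset.card_map]
    simp [natGraph_adj, Fin.val_inj]
  · have : pivotNbrs (natGraph G) (Y.map Fin.valEmbedding) v p = ∅ :=
      Finset.filter_false_of_mem fun x _ hx => hp hx.1
    rw [this, Finset.card_empty]
    exact (Nat.zero_le _).trans_lt (hlt v)

end Nat

/-! ### Total correctness with time bounds -/

/-- Whether a command may assign the variable `x`. -/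
def Cmd.writesVar (x : ℕ) : Cmd → Bool
  | .set y _ => y == x
  | .put _ _ _ => false
  | .write _ => false
  | .skip => false
  | .seq p q => p.writesVar x || q.writesVar x
  | .ite _ p q => p.writesVar x || q.writesVar x
  | .loop _ p => p.writesVar x

/-- Whether a command may assign the array `a`. -/
def Cmd.writesArr (a : Fin 16) : Cmd → Bool
  | .set _ _ => false
  | .put b _ _ => b == a
  | .write _ => false
  | .skip => false
  | .seq p q => p.writesArr a || q.writesArr a
  | .ite _ p q => p.writesArr a || q.writesArr a
  | .loop _ p => p.writesArr a

/-- Whether a command may write to the output. -/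
def Cmd.writesOut : Cmd → Bool
  | .set _ _ => false
  | .put _ _ _ => false
  | .write _ => true
  | .skip => false
  | .seq p q => p.writesOut || q.writesOut
  | .ite _ p q => p.writesOut || q.writesOut
  | .loop _ p => p.writesOut

/-- `σ` and `τ` agree on everything that `c` does not write. -/
structure Same (c : Cmd) (σ τ : Store) : Prop where
  var : ∀ x, c.writesVar x = false → τ.var x = σ.var x
  arr : ∀ a, c.writesArr a = false → τ.arr a = σ.arr a
  out : c.writesOut = false → τ.out = σ.out

theorem Same.refl (c : Cmd) (σ : Store) : Same c σ σ := ⟨fun _ _ => rfl, fun _ _ => rfl, fun _ => rfl⟩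

theorem Same.trans {c : Cmd} {σ τ ρ : Store} (h : Same c σ τ) (h' : Same c τ ρ) : Same c σ ρ :=
  ⟨fun x hx => (h'.var x hx).trans (h.var x hx), fun a ha => (h'.arr a ha).trans (h.arr a ha),
    fun ho => (h'.out ho).trans (h.out ho)⟩

theorem Same.mono {c d : Cmd} {σ τ : Store} (h : Same c σ τ)
    (hv : ∀ x, d.writesVar x = false → c.writesVar x = false)
    (ha : ∀ a, d.writesArr a = false → c.writesArr a = false)
    (ho : d.writesOut = false → c.writesOut = false) : Same d σ τ :=
  ⟨fun x hx => h.var x (hv x hx), fun a hx => h.arr a (ha a hx), fun hx => h.out (ho hx)⟩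

/-- The frame rule. As `Cmd.writesVar`, `Cmd.writesArr` and `Cmd.writesOut` compute, its side
conditions for concrete commands hold by `rfl`. -/
theorem Run.same {c : Cmd} {σ τ : Store} {t : ℕ} (h : Run c σ τ t) : Same c σ τ := by
  induction h with
  | set σ x e =>
    refine ⟨fun y hy => if_neg ?_, fun _ _ => rfl, fun _ => rfl⟩
    rintro rfl; simp [Cmd.writesVar] at hy
  | put σ a i e =>
    refine ⟨fun _ _ => rfl, fun b hb => funext fun j => if_neg ?_, fun _ => rfl⟩
    rintro ⟨rfl, -⟩; simp [Cmd.writesArr] at hb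
  | write σ e => exact ⟨fun _ _ => rfl, fun _ _ => rfl, fun h => by simp [Cmd.writesOut] at h⟩
  | skip σ => exact .refl _ _
  | seq hp hq ihp ihq =>
    exact (ihp.mono (by simp +contextual [Cmd.writesVar]) (by simp +contextual [Cmd.writesArr])
      (by simp +contextual [Cmd.writesOut])).trans (ihq.mono (by simp +contextual [Cmd.writesVar])
      (by simp +contextual [Cmd.writesArr]) (by simp +contextual [Cmd.writesOut]))
  | iteTrue h hp ih =>
    exact ih.mono (by simp +contextual [Cmd.writesVar]) (by simp +contextual [Cmd.writesArr])
      (by simp +contextual [Cmd.writesOut])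
  | iteFalse h hp ih =>
    exact ih.mono (by simp +contextual [Cmd.writesVar]) (by simp +contextual [Cmd.writesArr])
      (by simp +contextual [Cmd.writesOut])
  | loopDone h => exact .refl _ _
  | loopStep h hp hl ihp ihl =>
    exact (ihp.mono (by simp [Cmd.writesVar]) (by simp [Cmd.writesArr])
      (by simp [Cmd.writesOut])).trans ihl

/-- Started in `σ`, the command `c` halts within `k` steps in a store that satisfies `Q`. -/
def Tri (c : Cmd) (σ : Store) (k : ℕ) (Q : Store → Prop) : Prop :=
  ∃ τ t, Run c σ τ t ∧ t ≤ k ∧ Q τ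

theorem Tri.mono {c : Cmd} {σ : Store} {k l : ℕ} {Q R : Store → Prop} (h : Tri c σ k Q)
    (hk : k ≤ l) (hQ : ∀ τ, Same c σ τ → Q τ → R τ) : Tri c σ l R := by
  obtain ⟨τ, t, hr, ht, hq⟩ := h
  exact ⟨τ, t, hr, ht.trans hk, hQ τ hr.same hq⟩

theorem Tri.le {c : Cmd} {σ : Store} {k l : ℕ} {Q : Store → Prop} (h : Tri c σ k Q)
    (hk : k ≤ l) : Tri c σ l Q := h.mono hk fun _ _ => id

theorem Tri.set {x : ℕ} {e : Tm} {σ : Store} {Q : Store → Prop} (h : Q (σ.set x (e.eval σ))) :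
    Tri (.set x e) σ 1 Q := ⟨_, _, .set _ _ _, le_rfl, h⟩

theorem Tri.put {a : Fin 16} {i e : Tm} {σ : Store} {Q : Store → Prop}
    (h : Q (σ.put a (i.eval σ) (e.eval σ))) : Tri (.put a i e) σ 1 Q :=
  ⟨_, _, .put _ _ _ _, le_rfl, h⟩

theorem Tri.write {e : Tm} {σ : Store} {Q : Store → Prop}
    (h : Q { σ with out := σ.out ++ [e.eval σ] }) : Tri (.write e) σ 1 Q :=
  ⟨_, _, .write _ _, le_rfl, h⟩

theorem Tri.skip {σ : Store} {Q : Store → Prop} (h : Q σ) : Tri .skip σ 1 Q :=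
  ⟨_, _, .skip _, le_rfl, h⟩

theorem Tri.seq {p q : Cmd} {σ : Store} {k l : ℕ} {Q R : Store → Prop} (hp : Tri p σ k Q)
    (hq : ∀ τ, Same p σ τ → Q τ → Tri q τ l R) : Tri (.seq p q) σ (k + l) R := by
  obtain ⟨τ, t, hr, ht, hτ⟩ := hp
  obtain ⟨ρ, u, hr', hu, hρ⟩ := hq τ hr.same hτ
  exact ⟨ρ, _, .seq hr hr', by omega, hρ⟩

theorem Tri.ite {e : Tm} {p q : Cmd} {σ : Store} {k : ℕ} {Q : Store → Prop}
    (hp : 0 < e.eval σ → Tri p σ k Q) (hq : ¬ 0 < e.eval σ → Tri q σ k Q) :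
    Tri (.ite e p q) σ (k + 1) Q := by
  by_cases h : 0 < e.eval σ
  · obtain ⟨τ, t, hr, ht, hτ⟩ := hp h
    exact ⟨τ, _, .iteTrue h hr, by omega, hτ⟩
  · obtain ⟨τ, t, hr, ht, hτ⟩ := hq h
    exact ⟨τ, _, .iteFalse h hr, by omega, hτ⟩

/-- The rule for loops that iterate at most `N` times. -/
theorem Tri.loop {e : Tm} {p : Cmd} {k : ℕ} (N : ℕ) (I : ℕ → Store → Prop) {σ : Store}
    (h0 : I 0 σ) (hstep : ∀ i τ, Same (.loop e p) σ τ → I i τ → 0 < e.eval τ →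
      i < N ∧ Tri p τ k (I (i + 1))) :
    Tri (.loop e p) σ (N * (k + 1) + 1) fun τ => ∃ i, I i τ ∧ ¬ 0 < e.eval τ := by
  -- Induction on the number `d` of iterations still allowed; when none is left, `hstep` shows that
  -- the test fails.
  have key : ∀ d i τ, N ≤ i + d → Same (.loop e p) σ τ → I i τ →
      Tri (.loop e p) τ (d * (k + 1) + 1) fun τ => ∃ i, I i τ ∧ ¬ 0 < e.eval τ := by
    intro d
    induction d with
    | zero =>
      intro i τ hd hS hI
      by_cases h : 0 < e.eval τ
      · have := (hstep i τ hS hI h).1; omega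
      · exact ⟨τ, 1, .loopDone h, by omega, i, hI, h⟩
    | succ d ih =>
      intro i τ hd hS hI
      by_cases h : 0 < e.eval τ
      · obtain ⟨-, ρ, t, hr, ht, hρ⟩ := hstep i τ hS hI h
        have hS' : Same (.loop e p) τ ρ := ⟨hr.same.var, hr.same.arr, hr.same.out⟩
        obtain ⟨υ, u, hr', hu, hυ⟩ := ih (i + 1) ρ (by omega) (hS.trans hS') hρ
        exact ⟨υ, _, .loopStep h hr hr', by rw [Nat.add_mul]; omega, hυ⟩
      · exact ⟨τ, 1, .loopDone h, by omega, i, hI, h⟩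
  exact key N 0 σ (by omega) (.refl _ _) h0

/-- `for x < y do p`, for variables `x` and `y`. -/
def Cmd.forTo (x y : ℕ) (p : Cmd) : Cmd :=
  .seq (.set x (.const 0)) (.loop (.lt (.var x) (.var y)) (.seq p (.set x (.succ (.var x)))))

/-- An iteration costs `k` for the body and `2` for test and increment; the final `+ 2` pays for the
initial assignment and the failing test. The invariant refers to the store after the increment,
hence `τ'.set x (i + 1)`. -/
theorem Tri.forTo {x y k N : ℕ} {p : Cmd} {σ : Store} (I : ℕ → Store → Prop)
    (hx : p.writesVar x = false) (hy : p.writesVar y = false) (hxy : (x == y) = false)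
    (hN : σ.var y = N) (h0 : I 0 (σ.set x 0))
    (hstep : ∀ i < N, ∀ τ, τ.var x = i → Same (.forTo x y p) σ τ → I i τ →
      Tri p τ k fun τ' => I (i + 1) (τ'.set x (i + 1))) :
    Tri (.forTo x y p) σ (N * (k + 2) + 2) (I N) := by
  subst hN
  have hxy' : y ≠ x := by rintro rfl; simp at hxy
  have hyw : (Cmd.forTo x y p).writesVar y = false := by
    simp [Cmd.forTo, Cmd.writesVar, hy, hxy'.symm]
  refine (Tri.seq (l := σ.var y * (k + 2) + 1) (R := I (σ.var y)) (Tri.set (Q := fun τ => τ = σ.set x 0) rfl) ?_).le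
    (by omega)
  rintro _ hS₀ rfl
  refine (Tri.loop (k := k + 1) (σ.var y) (fun i τ => I i τ ∧ τ.var x = i ∧ i ≤ σ.var y)
    ⟨h0, by simp, by omega⟩ ?_).mono le_rfl ?_
  · rintro i τ hS ⟨hI, hi, -⟩ hlt
    have hS' : Same (.forTo x y p) σ τ :=
      (hS₀.mono (by simp +contextual [Cmd.writesVar, Cmd.forTo])
        (by simp +contextual [Cmd.writesArr, Cmd.forTo])
        (by simp +contextual [Cmd.writesOut, Cmd.forTo])).trans
      (hS.mono (by simp +contextual [Cmd.writesVar, Cmd.forTo])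
        (by simp +contextual [Cmd.writesArr, Cmd.forTo])
        (by simp +contextual [Cmd.writesOut, Cmd.forTo]))
    have hlt' : i < σ.var y := by
      rw [← hi, ← hS'.var y hyw]
      by_contra h
      simp [h] at hlt
    refine ⟨hlt', (hstep i hlt' τ hi hS' hI).seq fun ρ hρ hQ => .set ?_⟩
    have : ρ.var x = i := (hρ.var x hx).trans hi
    simp only [Tm.eval, this]
    exact ⟨hQ, by simp, hlt'⟩
  · rintro τ hS ⟨i, ⟨hI, hi, hle⟩, hn⟩
    have : τ.var y = σ.var y := (hS.var y (by simp [Cmd.writesVar, hy, hxy'.symm])).trans (by simp [hxy'])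
    have : i = σ.var y := by
      rw [← hi] at hle ⊢
      by_contra h
      apply hn
      have : τ.var x < τ.var y := by omega
      simp [this]
    exact this ▸ hI

/-! ### The enumeration program

Variables: `0` the number `n` of vertices, `1` the number `s`, `2` the length `m = 2 * s - 3` of
tuples, `3` the number `m + n` of digits, `4` the level `i`, `5` the vertex `v` of the level, `6`
the pivot `p`, `7` the least closure number so far, `8` a closure number, `9` a number of common
neighbours, `10` a vertex to be added, `11`–`14` loop variables, `15` a flag, `16` a trie node,
`17` the number of trie nodes, `18` its former value, `19` whether there are further digit vectors,
`20` a digit position.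

Arrays: `0` adjacency matrix, `1` row offsets, `2` removed vertices, `3` the ordering, `4` the
current plex, `5` numbers of nonneighbours in it, `6` digits, `7` their radices, `8` and `9` the
children of the trie nodes. -/

/-- An entry of the adjacency matrix. -/
def Tm.adj (e f : Tm) : Tm := .readSum 0 (.read 1 e) f

/-- Negation of a test. -/
def Tm.not (e : Tm) : Tm := .lt e (.const 1)

open Classical in
/-- The input and the parameters derived from it. -/
structure Input (G : SimpleGraph ℕ) (n s : ℕ) (σ : Store) : Prop where
  var_n : σ.var 0 = n
  var_s : σ.var 1 = s
  var_m : σ.var 2 = 2 * s - 3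
  var_M : σ.var 3 = 2 * s - 3 + n
  row : ∀ i < n, σ.arr 1 i = i * n
  adj : ∀ i < n, ∀ j < n, σ.arr 0 (i * n + j) = if G.Adj i j then 1 else 0

/-- Whether a command leaves the input untouched. -/
def Cmd.keepsInput (c : Cmd) : Bool :=
  !(c.writesVar 0 || c.writesVar 1 || c.writesVar 2 || c.writesVar 3 || c.writesArr 0 ||
    c.writesArr 1)

theorem Input.of_same {G : SimpleGraph ℕ} {n s : ℕ} {σ τ : Store} {c : Cmd}
    (h : Input G n s σ) (hS : Same c σ τ) (hc : c.keepsInput = true) : Input G n s τ := by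
  simp only [Cmd.keepsInput, Bool.not_eq_true', Bool.or_eq_false_iff] at hc
  obtain ⟨⟨⟨⟨⟨h0, h1⟩, h2⟩, h3⟩, h4⟩, h5⟩ := hc
  exact ⟨(hS.var 0 h0).trans h.var_n, (hS.var 1 h1).trans h.var_s, (hS.var 2 h2).trans h.var_m,
    (hS.var 3 h3).trans h.var_M, by rw [hS.arr 1 h5]; exact h.row, by rw [hS.arr 0 h4]; exact h.adj⟩

theorem Input.adj_pos {G : SimpleGraph ℕ} {n s : ℕ} {σ : Store} (h : Input G n s σ) {e f : Tm}
    (he : e.eval σ < n) (hf : f.eval σ < n) :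
    0 < (e.adj f).eval σ ↔ G.Adj (e.eval σ) (f.eval σ) := by
  simp only [Tm.adj, Tm.eval]
  rw [h.row _ he, h.adj _ he _ hf]
  split_ifs <;> simp [*]

theorem Tm.not_pos {σ : Store} {e : Tm} : 0 < e.not.eval σ ↔ ¬ 0 < e.eval σ := by
  simp only [Tm.not, eval]
  by_cases h : 0 < e.eval σ
  · simp [h, Nat.ne_of_gt h]
  · simp [Nat.eq_zero_of_not_pos h]

theorem Tm.and_pos {σ : Store} {e f : Tm} :
    0 < (e.and f).eval σ ↔ 0 < e.eval σ ∧ 0 < f.eval σ := by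
  simp only [eval]
  split_ifs <;> simp [*]

theorem Tm.lt_pos {σ : Store} {e f : Tm} : 0 < (e.lt f).eval σ ↔ e.eval σ < f.eval σ := by
  simp only [eval]
  split_ifs <;> simp [*]

/-! ### Adding a vertex to the current plex -/

open Classical in
/-- The arrays `4` and `5` represent the plex `S`. -/
structure HoldsPlex (G : SimpleGraph ℕ) (n s : ℕ) (S : Finset ℕ) (σ : Store) : Prop where
  subset : S ⊆ Finset.range n
  isPlex : IsPlex G s S
  mem : ∀ x < n, 0 < σ.arr 4 x ↔ x ∈ S
  card : ∀ w < n, σ.arr 5 w = (S.filter fun x => ¬ G.Adj w x).card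

open Classical in
-- Inserting `u` gives one more nonneighbour exactly to `u` and to the members not adjacent to `u`.
-- With stored nonneighbour counts, an insertion can therefore be tested in time O(n).
theorem isPlex_insert_iff {G : SimpleGraph ℕ} {s : ℕ} {S : Finset ℕ} {u : ℕ} (hS : IsPlex G s S)
    (hu : u ∉ S) : IsPlex G s (insert u S) ↔ (S.filter fun x => ¬ G.Adj u x).card < s ∧
      ∀ w ∈ S, ¬ G.Adj u w → (S.filter fun x => ¬ G.Adj w x).card < s := by
  rw [isPlex_iff, Finset.forall_mem_insert, Finset.filter_insert, if_pos (by simp),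
    Finset.card_insert_of_notMem (by simp [hu])]
  refine and_congr Nat.succ_le_iff (forall₂_congr fun w hw => ?_)
  rw [Finset.filter_insert]
  by_cases h : G.Adj u w
  · simpa [h, h.symm] using isPlex_iff.1 hS w hw
  · have h' : ¬ G.Adj w u := fun h' => h h'.symm
    rw [if_pos h', Finset.card_insert_of_notMem (by simp [hu])]
    simp [h]

/-- Can the vertex in variable `10`, if it is new, be added to the current plex? -/
def addTest : Cmd :=
  .seq (.set 15 (.lt (.read 5 (.var 10)) (.var 1))) <|
  .forTo 11 0 <| .ite (.and (.read 4 (.var 11)) (.and (.not (.adj (.var 10) (.var 11)))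
      (.not (.lt (.read 5 (.var 11)) (.var 1))))) (.set 15 (.const 0)) .skip

/-- Add the vertex in variable `10` to the current plex. -/
def addUpdate : Cmd :=
  .seq (.put 4 (.var 10) (.const 1)) <| .forTo 11 0 <|
      .ite (.not (.adj (.var 10) (.var 11))) (.put 5 (.var 11) (.succ (.read 5 (.var 11)))) .skip

/-- Add the vertex in variable `10` to the current plex if possible. -/
def addCmd : Cmd :=
  .seq addTest <| .ite (.and (.var 15) (.not (.read 4 (.var 10)))) addUpdate .skip

section

variable {G : SimpleGraph ℕ} {n s : ℕ} {σ : Store}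

theorem addTest_spec {u : ℕ} {S : Finset ℕ} (hI : Input G n s σ) (hS : HoldsPlex G n s S σ)
    (hu : σ.var 10 = u) (hun : u < n) :
    Tri addTest σ (4 * n + 3) fun τ => u ∉ S → (0 < τ.var 15 ↔ IsPlex G s (insert u S)) := by
  classical
  have h1 : Tri (.set 15 (.lt (.read 5 (.var 10)) (.var 1))) σ 1
      fun τ => 0 < τ.var 15 ↔ (S.filter fun x => ¬ G.Adj u x).card < s := by
    refine .set ?_
    simp only [Store.set_var, if_true, Tm.lt_pos]
    simp only [Tm.eval, hu, hI.var_s, hS.card u hun]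
  refine (h1.seq fun τ hτ hQ => (Tri.forTo (k := 2) (N := n) (fun i τ => 0 < τ.var 15 ↔
    (S.filter fun x => ¬ G.Adj u x).card < s ∧ ∀ w < i, w ∈ S → ¬ G.Adj u w →
      (S.filter fun x => ¬ G.Adj w x).card < s) rfl rfl rfl
    (by rw [hτ.var 0 rfl, hI.var_n]) ?_ ?_)).mono ?_ ?_
  · simpa using hQ
  · intro i hin ρ hi' hρ hP
    have hIρ := (hI.of_same hτ rfl).of_same hρ rfl
    have hu' : ρ.var 10 = u := by rw [hρ.var 10 rfl, hτ.var 10 rfl, hu]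
    have h4 : ρ.arr 4 = σ.arr 4 := by rw [hρ.arr 4 rfl, hτ.arr 4 rfl]
    have h5 : ρ.arr 5 = σ.arr 5 := by rw [hρ.arr 5 rfl, hτ.arr 5 rfl]
    have hc : 0 < (Tm.and (.read 4 (.var 11)) (.and (.not (.adj (.var 10) (.var 11)))
      (.not (.lt (.read 5 (.var 11)) (.var 1))))).eval ρ ↔
        ¬ (i ∈ S → ¬ G.Adj u i → (S.filter fun x => ¬ G.Adj i x).card < s) := by
      rw [Tm.and_pos, Tm.and_pos, Tm.not_pos, Tm.not_pos, Tm.lt_pos,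
        hIρ.adj_pos (by simp [*]) (by simp [*])]
      simp only [Tm.eval, hi', hu', h4, h5, hIρ.var_s, hS.mem i hin, hS.card i hin]
      tauto
    refine .ite (fun h => .set ?_) (fun h => .skip ?_)
    · simp only [Store.set_var, Tm.eval, if_true]
      exact iff_of_false (by simp) fun h' => hc.1 h (h'.2 i (by omega))
    · refine hP.trans <| and_congr_right fun _ => ⟨fun h' w hw => ?_, fun h' w hw => h' w (by omega)⟩
      rcases Nat.lt_succ_iff_lt_or_eq.1 hw with hw | rfl
      exacts [h' w hw, not_not.1 (hc.not.1 h)]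
  · omega
  · intro ρ hρ hP huS
    rw [hP, isPlex_insert_iff hS.isPlex huS]
    exact and_congr_right fun _ => ⟨fun h w hw => h w (Finset.mem_range.1 (hS.subset hw)) hw,
      fun h w _ hw => h w hw⟩

theorem addUpdate_spec {u : ℕ} {S : Finset ℕ} (hI : Input G n s σ) (hS : HoldsPlex G n s S σ)
    (hu : σ.var 10 = u) (hun : u < n) (huS : u ∉ S) (hp : IsPlex G s (insert u S)) :
    Tri addUpdate σ (4 * n + 3) (HoldsPlex G n s (insert u S)) := by
  classical
  have h1 : Tri (.put 4 (.var 10) (.const 1)) σ 1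
      fun τ => ∀ x < n, 0 < τ.arr 4 x ↔ x ∈ insert u S := by
    refine .put fun x hx => ?_
    simp only [Store.put_arr, Tm.eval, hu, Finset.mem_insert, true_and]
    split_ifs with h <;> simp [h, hS.mem x hx]
  refine (h1.seq fun τ hτ hQ => (Tri.forTo (k := 2) (N := n)
    (fun i ρ => (∀ x < n, 0 < ρ.arr 4 x ↔ x ∈ insert u S) ∧ ∀ w < n, ρ.arr 5 w =
    if w < i then ((insert u S).filter fun x => ¬ G.Adj w x).card else
      (S.filter fun x => ¬ G.Adj w x).card) rfl rfl rfl
    (by rw [hτ.var 0 rfl, hI.var_n]) ?_ ?_)).mono ?_ ?_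
  · exact ⟨hQ, by simpa [hτ.arr 5 rfl] using hS.card⟩
  · rintro i hin ρ hi' hρ ⟨hQ', hP⟩
    have hIρ := (hI.of_same hτ rfl).of_same hρ rfl
    have hu' : ρ.var 10 = u := by rw [hρ.var 10 rfl, hτ.var 10 rfl, hu]
    have hc : 0 < (Tm.not (.adj (.var 10) (.var 11))).eval ρ ↔ ¬ G.Adj i u := by
      rw [Tm.not_pos, hIρ.adj_pos (by simp [*]) (by simp [*]), G.adj_comm]
      simp [hi', hu']
    refine .ite (fun h => .put ⟨hQ', fun w hw => ?_⟩) (fun h => .skip ⟨hQ', fun w hw => ?_⟩)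
    · simp only [Store.set_arr, Store.put_arr, Tm.eval, hi', true_and]
      rw [hc] at h
      by_cases hwi : w = i
      · subst hwi
        rw [if_pos rfl, if_pos (by omega), hP w hw, if_neg (by omega), Finset.filter_insert,
          if_pos h, Finset.card_insert_of_notMem (by simp [huS])]
      · rw [if_neg hwi, hP w hw]
        simp only [show w < i + 1 ↔ w < i by omega]
    · simp only [Store.set_arr]
      rw [hc, not_not] at h
      by_cases hwi : w = i
      · subst hwi
        rw [if_pos (by omega), hP w hw, if_neg (by omega), Finset.filter_insert,
          if_neg (not_not.2 h)]
      · rw [hP w hw]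
        simp only [show w < i + 1 ↔ w < i by omega]
  · omega
  · rintro ρ hρ ⟨hQ', hP⟩
    exact ⟨Finset.insert_subset (Finset.mem_range.2 hun) hS.subset, hp, hQ',
      fun w hw => by rw [hP w hw, if_pos hw]⟩

theorem addCmd_spec {u : ℕ} {S : Finset ℕ} (hI : Input G n s σ) (hS : HoldsPlex G n s S σ)
    (hu : σ.var 10 = u) (hun : u < n) :
    Tri addCmd σ (8 * n + 7) (HoldsPlex G n s (tryAdd G s S u)) := by
  refine ((addTest_spec hI hS hu hun).seq fun τ hτ hQ =>
    (Tri.ite (k := 4 * n + 3) ?_ ?_)).le (by omega)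
  all_goals
    have hI' := hI.of_same hτ rfl
    have hu' : τ.var 10 = u := by rw [hτ.var 10 rfl, hu]
    have hS' : HoldsPlex G n s S τ := ⟨hS.subset, hS.isPlex, by rw [hτ.arr 4 rfl]; exact hS.mem,
      by rw [hτ.arr 5 rfl]; exact hS.card⟩
    rw [Tm.and_pos, Tm.not_pos]
    simp only [Tm.eval, hu', hS'.mem u hun]
  · rintro ⟨h, huS⟩
    rw [hQ huS] at h
    rw [tryAdd, if_pos h]
    exact addUpdate_spec hI' hS' hu' hun huS h
  · intro h
    refine (Tri.skip ?_).le (by omega)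
    by_cases huS : u ∈ S
    · rwa [tryAdd, Finset.insert_eq_self.2 huS, ite_self]
    · rwa [tryAdd, if_neg fun hp => h ⟨(hQ huS).2 hp, huS⟩]

end

/-! ### The greedy construction of a maximal plex from a digit vector -/

section

variable {G : SimpleGraph ℕ} {n s : ℕ} {σ : Store}

theorem HoldsPlex.of_arr {S : Finset ℕ} {τ : Store} (h : HoldsPlex G n s S σ)
    (h4 : τ.arr 4 = σ.arr 4) (h5 : τ.arr 5 = σ.arr 5) : HoldsPlex G n s S τ :=
  ⟨h.subset, h.isPlex, by rw [h4]; exact h.mem, by rw [h5]; exact h.card⟩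

/-- Add the value of an expression to the current plex if possible. -/
def addTerm (e : Tm) : Cmd := .seq (.set 10 e) addCmd

theorem addTerm_spec {S : Finset ℕ} {e : Tm} {u : ℕ} (hI : Input G n s σ)
    (hS : HoldsPlex G n s S σ) (he : e.eval σ = u) (hu : u < n) :
    Tri (addTerm e) σ (8 * n + 8) (HoldsPlex G n s (tryAdd G s S u)) := by
  refine ((Tri.set (Q := fun τ => τ.var 10 = u) (by simpa using he)).seq fun τ hτ hQ =>
    addCmd_spec (hI.of_same hτ rfl) (hS.of_arr (hτ.arr 4 rfl) (hτ.arr 5 rfl)) hQ hu).le (by omega)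

/-- Start with the empty plex. -/
def resetCmd : Cmd :=
  .forTo 12 0 <| .seq (.put 4 (.var 12) (.const 0)) (.put 5 (.var 12) (.const 0))

theorem resetCmd_spec (hI : Input G n s σ) :
    Tri resetCmd σ (4 * n + 2) (HoldsPlex G n s ∅) := by
  refine (Tri.forTo (k := 2) (N := n) (fun i τ => ∀ x < i, τ.arr 4 x = 0 ∧ τ.arr 5 x = 0)
    rfl rfl rfl hI.var_n (by simp) fun i hi τ hτ _ hQ => ?_).mono (by omega) fun τ _ h =>
      ⟨by simp, isPlex_iff.2 (by simp), fun x hx => by simp [(h x hx).1],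
        fun x hx => by simp [(h x hx).2]⟩
  refine Tri.seq (k := 1) (l := 1) (Q := fun ρ => ρ = τ.put 4 i 0) (.put (by simp [hτ])) ?_
  rintro _ - rfl
  refine .put fun x hx => ?_
  rcases Nat.lt_succ_iff_lt_or_eq.1 hx with hx | rfl
  · simpa [hτ, hx.ne] using hQ x hx
  · simp [hτ]

/-- The vertices given by the digits `d 0, …, d (q - 1)`: the first `m` digits are vertices, the
following ones form a characteristic vector. -/
def digitList (m : ℕ) (d : ℕ → ℕ) (q : ℕ) : List ℕ :=
  (List.range q).flatMap fun j => if j < m then [d j] else if 0 < d j then [j - m] else []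

theorem digitList_succ (m : ℕ) (d : ℕ → ℕ) (q : ℕ) : digitList m d (q + 1) = digitList m d q ++
    if q < m then [d q] else if 0 < d q then [q - m] else [] := by
  simp [digitList, List.range_succ]

theorem mem_digitList {m q x : ℕ} {d : ℕ → ℕ} : x ∈ digitList m d q ↔
    (∃ j < q, j < m ∧ d j = x) ∨ (m + x < q ∧ 0 < d (m + x)) := by
  simp only [digitList, List.mem_flatMap, List.mem_range]
  constructor
  · rintro ⟨j, hj, hx⟩
    split_ifs at hx with h1 h2
    · exact .inl ⟨j, hj, h1, (List.mem_singleton.1 hx).symm⟩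
    · obtain rfl := List.mem_singleton.1 hx
      rw [show m + (j - m) = j by omega]
      exact .inr ⟨hj, h2⟩
    · simp at hx
  · rintro (⟨j, hj, hm, rfl⟩ | ⟨h1, h2⟩)
    · exact ⟨j, hj, by simp [hm]⟩
    · exact ⟨m + x, h1, by simp [h2]⟩

/-- The maximal plex that arises greedily from the vertex `v`, the digits `d`, and the initial part
of length `i` of the ordering. -/
noncomputable def greedyPlex (G : SimpleGraph ℕ) (n s v : ℕ) (d ord : ℕ → ℕ) (i : ℕ) : Finset ℕ :=
  (v :: digitList (2 * s - 3) d (2 * s - 3 + n) ++ descending ord i ++ List.range n).foldl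
    (tryAdd G s) ∅

/-- Add the vertices given by the digits to the current plex. -/
def addDigits : Cmd :=
  .forTo 13 3 <| .ite (.lt (.var 13) (.var 2)) (addTerm (.read 6 (.var 13))) <|
    .ite (.read 6 (.var 13)) (addTerm (.sub (.var 13) (.var 2))) .skip

theorem addDigits_spec {S : Finset ℕ} (hI : Input G n s σ) (hS : HoldsPlex G n s S σ)
    (hd : ∀ j < 2 * s - 3, σ.arr 6 j < n) :
    Tri addDigits σ ((2 * s - 3 + n) * (8 * n + 12) + 2)
      (HoldsPlex G n s ((digitList (2 * s - 3) (σ.arr 6) (2 * s - 3 + n)).foldl (tryAdd G s) S)) := by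
  refine (Tri.forTo (k := 8 * n + 10) (fun i => HoldsPlex G n s
    ((digitList (2 * s - 3) (σ.arr 6) i).foldl (tryAdd G s) S)) rfl rfl rfl hI.var_M
    (hS.of_arr rfl rfl) fun i hi τ hτ hS' hQ => ?_)
  have hI' := hI.of_same hS' rfl
  have h6 := hS'.arr 6 rfl
  simp only [digitList_succ, List.foldl_append]
  refine .ite (fun h => ?_) fun h => .ite (fun h' => ?_) fun h' => ?_
  · rw [Tm.lt_pos] at h
    simp only [Tm.eval, hτ, hI'.var_m] at h
    rw [if_pos h]
    exact (addTerm_spec hI' hQ (by simp [hτ, h6]) (hd i h)).mono (by omega)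
      fun ρ _ h => h.of_arr rfl rfl
  · rw [Tm.lt_pos] at h
    simp only [Tm.eval, hτ, hI'.var_m, h6] at h h'
    rw [if_neg h, if_pos h']
    exact (addTerm_spec (u := i - (2 * s - 3)) hI' hQ (by simp [hτ, hI'.var_m]) (by omega)).mono (by omega)
      fun ρ _ h => h.of_arr rfl rfl
  · rw [Tm.lt_pos] at h
    simp only [Tm.eval, hτ, hI'.var_m, h6] at h h'
    rw [if_neg h, if_neg h']
    refine (Tri.skip ?_).le (by omega)
    exact hQ.of_arr rfl rfl

/-- Extend the current plex along the ordering, backwards from level `i`. -/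
def addDescending : Cmd :=
  .forTo 14 4 <| addTerm (.read 3 (.sub (.sub (.var 4) (.const 1)) (.var 14)))

theorem addDescending_spec {S : Finset ℕ} {i : ℕ} (hI : Input G n s σ)
    (hS : HoldsPlex G n s S σ) (hi : σ.var 4 = i) (ho : ∀ j < i, σ.arr 3 j < n) :
    Tri addDescending σ (i * (8 * n + 10) + 2)
      (HoldsPlex G n s ((descending (σ.arr 3) i).foldl (tryAdd G s) S)) := by
  refine (Tri.forTo (k := 8 * n + 8) (fun k => HoldsPlex G n s
    (((List.range k).map fun j => σ.arr 3 (i - 1 - j)).foldl (tryAdd G s) S)) rfl rfl rfl hi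
    (hS.of_arr rfl rfl) fun k hk τ hτ hS' hQ => ?_)
  have hI' := hI.of_same hS' rfl
  rw [List.range_succ, List.map_append, List.foldl_append]
  exact (addTerm_spec hI' hQ (by simp [hτ, hS'.arr 3 rfl, hS'.var 4 rfl, hi]) (ho _ (by omega))).mono
    (by omega) fun ρ _ h => h.of_arr rfl rfl

/-- Extend the current plex to a maximal one. -/
def addAll : Cmd := .forTo 14 0 <| addTerm (.var 14)

theorem addAll_spec {S : Finset ℕ} (hI : Input G n s σ) (hS : HoldsPlex G n s S σ) :
    Tri addAll σ (n * (8 * n + 10) + 2)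
      (HoldsPlex G n s ((List.range n).foldl (tryAdd G s) S)) := by
  refine (Tri.forTo (k := 8 * n + 8) (fun k => HoldsPlex G n s
    ((List.range k).foldl (tryAdd G s) S)) rfl rfl rfl hI.var_n
    (hS.of_arr rfl rfl) fun k hk τ hτ hS' hQ => ?_)
  rw [List.range_succ, List.foldl_append]
  exact (addTerm_spec (hI.of_same hS' rfl) hQ (by simp [hτ]) hk).mono
    (by omega) fun ρ _ h => h.of_arr rfl rfl

/-- Compute the maximal plex for the vertex in variable `5` and the current digits. -/
def buildCmd : Cmd :=
  .seq resetCmd <| .seq (addTerm (.var 5)) <| .seq addDigits <| .seq addDescending addAll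

/-- Since `s ≤ n`, there are O(n) digits and hence O(n) attempted insertions, each of cost O(n). -/
theorem buildCmd_spec {v i : ℕ} (hI : Input G n s σ) (hn : 1 ≤ n) (hs : s ≤ n)
    (hv : σ.var 5 = v) (hvn : v < n) (hi : σ.var 4 = i) (hin : i ≤ n)
    (ho : ∀ j < i, σ.arr 3 j < n) (hd : ∀ j < 2 * s - 3, σ.arr 6 j < n) :
    Tri buildCmd σ (130 * n ^ 2)
      (HoldsPlex G n s (greedyPlex G n s v (σ.arr 6) (σ.arr 3) i)) := by
  have key := (resetCmd_spec hI).seq fun σ₁ h₁ hS₁ =>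
    (addTerm_spec (e := .var 5) (hI.of_same h₁ rfl) hS₁ ((h₁.var 5 rfl).trans hv) hvn).seq fun σ₂ h₂ hS₂ =>
    (addDigits_spec ((hI.of_same h₁ rfl).of_same h₂ rfl) hS₂
      (by rw [h₂.arr 6 rfl, h₁.arr 6 rfl]; exact hd)).seq fun σ₃ h₃ hS₃ =>
    (addDescending_spec (i := i) (((hI.of_same h₁ rfl).of_same h₂ rfl).of_same h₃ rfl) hS₃
      (by rw [h₃.var 4 rfl, h₂.var 4 rfl, h₁.var 4 rfl]; exact hi)
      (by rw [h₃.arr 3 rfl, h₂.arr 3 rfl, h₁.arr 3 rfl]; exact ho)).seq fun σ₄ h₄ hS₄ =>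
    (addAll_spec ((((hI.of_same h₁ rfl).of_same h₂ rfl).of_same h₃ rfl).of_same h₄ rfl) hS₄).mono
      (R := HoldsPlex G n s (greedyPlex G n s v (σ.arr 6) (σ.arr 3) i)) le_rfl fun σ₅ h₅ hS₅ => by
      rw [h₃.arr 3 rfl, h₂.arr 3 rfl, h₁.arr 3 rfl, h₂.arr 6 rfl, h₁.arr 6 rfl] at hS₅
      simpa only [greedyPlex, List.cons_append, List.foldl_cons, List.foldl_append] using hS₅
  refine key.le ?_
  have h1 : (2 * s - 3 + n) * (8 * n + 12) ≤ 3 * n * (8 * n + 12) :=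
    Nat.mul_le_mul_right _ (by omega)
  have h2 : i * (8 * n + 10) ≤ n * (8 * n + 10) := Nat.mul_le_mul_right _ hin
  nlinarith

/-! ### The trie of the sets found so far -/

/-- The membership bits of `0, …, x - 1`, last one first. -/
def bits (S : Finset ℕ) : ℕ → List Bool
  | 0 => []
  | x + 1 => decide (x ∈ S) :: bits S x

theorem length_bits (S : Finset ℕ) (x : ℕ) : (bits S x).length = x := by
  induction x with
  | zero => rfl
  | succ x ih => simp [bits, ih]

theorem eq_of_bits_eq {S T : Finset ℕ} {n : ℕ} (hS : S ⊆ Finset.range n)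
    (hT : T ⊆ Finset.range n) (h : bits S n = bits T n) : S = T := by
  have key : ∀ k, bits S k = bits T k → ∀ x < k, x ∈ S ↔ x ∈ T := by
    intro k
    induction k with
    | zero => simp
    | succ k ih =>
      intro h x hx
      simp only [bits, List.cons.injEq, decide_eq_decide] at h
      rcases Nat.lt_succ_iff_lt_or_eq.1 hx with hx | rfl
      exacts [ih h.2 x hx, h.1]
  ext x
  exact ⟨fun hx => (key n h x (Finset.mem_range.1 (hS hx))).1 hx,
    fun hx => (key n h x (Finset.mem_range.1 (hT hx))).2 hx⟩

/-- The nodes `0, …, k - 1` with the children `ch` form a trie, in which `pre a` is the word of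
the node `a`, last letter first. -/
structure IsTrie (ch : Bool → ℕ → ℕ) (k : ℕ) (pre : ℕ → List Bool) : Prop where
  pos : 0 < k
  root : pre 0 = []
  inj : ∀ a < k, ∀ b < k, pre a = pre b → a = b
  parent : ∀ c < k, ∀ b q, pre c = b :: q → ∃ a < k, pre a = q
  child : ∀ a < k, ∀ b, ch b a ≠ 0 → ch b a < k ∧ pre (ch b a) = b :: pre a
  no_child : ∀ a < k, ∀ b, ch b a = 0 → ∀ c < k, pre c ≠ b :: pre a
  fresh : ∀ a, k ≤ a → ∀ b, ch b a = 0

/-- The word of the new leaf is new by `no_child`. The leaf is childless as well: a node spelling a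
one-letter extension of its word would have a parent in the old trie with that word. -/
theorem IsTrie.extend {ch : Bool → ℕ → ℕ} {k : ℕ} {pre : ℕ → List Bool} (h : IsTrie ch k pre)
    {a : ℕ} (ha : a < k) {b : Bool} (hb : ch b a = 0) :
    IsTrie (fun b' a' => if b' = b ∧ a' = a then k else ch b' a') (k + 1)
      (Function.update pre k (b :: pre a)) := by
  have hlt : ∀ c < k, Function.update pre k (b :: pre a) c = pre c := fun c hc =>
    Function.update_of_ne hc.ne _ _
  have hk : Function.update pre k (b :: pre a) k = b :: pre a := Function.update_self _ _ _
  refine ⟨by omega, by rw [hlt 0 h.pos, h.root], ?_, ?_, ?_, ?_, ?_⟩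
  · intro c hc d hd hcd
    rcases Nat.lt_succ_iff_lt_or_eq.1 hc with hc | rfl <;>
      rcases Nat.lt_succ_iff_lt_or_eq.1 hd with hd | rfl
    · exact h.inj c hc d hd (by rwa [hlt c hc, hlt d hd] at hcd)
    · rw [hlt c hc, hk] at hcd
      exact absurd hcd (h.no_child a ha b hb c hc)
    · rw [hlt d hd, hk] at hcd
      exact absurd hcd.symm (h.no_child a ha b hb d hd)
    · rfl
  · intro c hc b' q hq
    rcases Nat.lt_succ_iff_lt_or_eq.1 hc with hc | rfl
    · rw [hlt c hc] at hq
      obtain ⟨d, hd, hdq⟩ := h.parent c hc b' q hq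
      exact ⟨d, by omega, by rw [hlt d hd, hdq]⟩
    · rw [hk] at hq
      exact ⟨a, by omega, by rw [hlt a ha]; exact (List.cons.inj hq).2⟩
  · intro c hc b' hne
    split_ifs with hcb
    · rw [hk, hcb.1, hcb.2, hlt a ha]
      exact ⟨by omega, rfl⟩
    · rw [if_neg hcb] at hne
      rcases Nat.lt_succ_iff_lt_or_eq.1 hc with hc | rfl
      · obtain ⟨h1, h2⟩ := h.child c hc b' hne
        exact ⟨by omega, by rw [hlt _ h1, hlt c hc, h2]⟩
      · exact absurd (h.fresh c le_rfl b') hne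
  · intro c hc b' h0 d hd hdc
    split_ifs at h0 with hcb
    -- The entry `0` can mean that there is no child because node `0` is the root; the new node has
    -- a positive number.
    · have := h.pos; omega
    · rcases Nat.lt_succ_iff_lt_or_eq.1 hc with hc | rfl <;>
        rcases Nat.lt_succ_iff_lt_or_eq.1 hd with hd | rfl
      · exact h.no_child c hc b' h0 d hd (by rwa [hlt c hc, hlt d hd] at hdc)
      · rw [hlt c hc, hk, List.cons.injEq] at hdc
        exact hcb ⟨hdc.1.symm, (h.inj a ha c hc hdc.2).symm⟩
      · rw [hlt d hd, hk] at hdc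
        obtain ⟨e, he, hpe⟩ := h.parent d hd _ _ hdc
        exact h.no_child a ha b hb e he hpe
      · rw [hk] at hdc
        have := congrArg List.length hdc
        simp at this
  · intro c hc b'
    rw [if_neg (by rintro ⟨-, rfl⟩; omega)]
    exact h.fresh c (by omega) b'

/-- The children of the trie nodes are stored in the arrays `8` and `9`. -/
def childArr (b : Bool) : Fin 16 := if b then 9 else 8

/-- The trie stored in `σ`. -/
def StoresTrie (σ : Store) (pre : ℕ → List Bool) : Prop :=
  IsTrie (fun b => σ.arr (childArr b)) (σ.var 17) pre

/-- Move from the current node to its child for the bit `b`. -/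
def descend (b : Bool) : Cmd :=
  .seq (.ite (.read (childArr b) (.var 16)) .skip
    (.seq (.put (childArr b) (.var 16) (.var 17)) (.set 17 (.succ (.var 17))))) <|
  .set 16 (.read (childArr b) (.var 16))

/-- The state after reading `x` bits of `S`, where the trie had `k` nodes, given by `pre`, before. -/
def Walked (k : ℕ) (pre : ℕ → List Bool) (S : Finset ℕ) (x : ℕ) (σ : Store) : Prop :=
  ∃ pre', StoresTrie σ pre' ∧ σ.var 16 < σ.var 17 ∧ pre' (σ.var 16) = bits S x ∧ k ≤ σ.var 17 ∧
    (∀ a < k, pre' a = pre a) ∧ ∀ a, k ≤ a → a < σ.var 17 → ∃ y ≤ x, pre' a = bits S y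

theorem descend_spec {k x : ℕ} {pre : ℕ → List Bool} {S : Finset ℕ} {b : Bool}
    (h : Walked k pre S x σ) (hb : b = decide (x ∈ S)) :
    Tri (descend b) σ 4 (Walked k pre S (x + 1)) := by
  obtain ⟨pre', hT, hlt, hpre, hk, hold, hnew⟩ := h
  have hbits : b :: pre' (σ.var 16) = bits S (x + 1) := by rw [hpre, hb]; rfl
  refine Tri.seq (k := 3) (l := 1) (Q := fun τ => ∃ pre', StoresTrie τ pre' ∧
    τ.arr (childArr b) (τ.var 16) < τ.var 17 ∧
    pre' (τ.arr (childArr b) (τ.var 16)) = bits S (x + 1) ∧ k ≤ τ.var 17 ∧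
    (∀ a < k, pre' a = pre a) ∧ ∀ a, k ≤ a → a < τ.var 17 → ∃ y ≤ x + 1, pre' a = bits S y)
    (.ite (fun hc => (Tri.skip ?_).le (by omega)) fun hc => ?_) ?_
  · obtain ⟨h1, h2⟩ := hT.child _ hlt b (Nat.pos_iff_ne_zero.1 hc)
    exact ⟨pre', hT, h1, h2.trans hbits, hk, hold, fun a ha ha' =>
      (hnew a ha ha').imp fun y hy => ⟨by omega, hy.2⟩⟩
  · have hT' := hT.extend hlt (b := b) (by simpa using hc)
    refine Tri.seq (k := 1) (l := 1) (Q := fun τ => τ = σ.put (childArr b) (σ.var 16) (σ.var 17))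
      (.put rfl) ?_
    rintro _ - rfl
    refine .set ⟨Function.update pre' (σ.var 17) (b :: pre' (σ.var 16)), ?_, ?_, ?_, ?_, ?_, ?_⟩
    · have hinj : ∀ b' : Bool, childArr b' = childArr b ↔ b' = b := by
        cases b <;> decide
      change IsTrie (fun b' a' => if childArr b' = childArr b ∧ a' = σ.var 16 then σ.var 17 else
        σ.arr (childArr b') a') (σ.var 17 + 1) _
      simpa only [hinj] using hT'
    · simp
    · simpa using hbits
    · simp; omega
    · intro a ha
      rw [Function.update_of_ne (by omega)]
      exact hold a ha
    · intro a ha ha'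
      simp only [Store.set_var, if_true, Tm.eval, Store.put_var] at ha'
      rcases Nat.lt_succ_iff_lt_or_eq.1 ha' with ha' | rfl
      · rw [Function.update_of_ne (by omega)]
        exact (hnew a ha ha').imp fun y hy => ⟨by omega, hy.2⟩
      · exact ⟨x + 1, le_rfl, by rw [Function.update_self, hbits]⟩
  · rintro τ - ⟨pre', h1, h2, h3, h4, h5, h6⟩
    exact .set ⟨pre', h1, by simpa using h2, by simpa using h3, h4, h5, h6⟩

/-- Look the current plex up in the trie, extending the trie if necessary. -/
def insertCmd : Cmd :=
  .seq (.set 18 (.var 17)) <| .seq (.set 16 (.const 0)) <| .forTo 12 0 <|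
    .ite (.read 4 (.var 12)) (descend true) (descend false)

/-- Variable `18` keeps the former number of nodes: `S` is new exactly if the walk ends in a node
numbered from there on, which is what `outputCmd` tests. -/
theorem insertCmd_spec {S : Finset ℕ} {pre : ℕ → List Bool} (hI : Input G n s σ)
    (hS : HoldsPlex G n s S σ) (hT : StoresTrie σ pre) :
    Tri insertCmd σ (7 * n + 4) fun τ => τ.var 18 = σ.var 17 ∧ Walked (σ.var 17) pre S n τ := by
  refine (Tri.seq (k := 1) (l := 7 * n + 3) (Q := fun τ => τ = σ.set 18 (σ.var 17)) (.set rfl) ?_).le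
    (by omega)
  rintro _ - rfl
  refine (Tri.seq (k := 1) (l := 7 * n + 2)
    (Q := fun τ => τ = (σ.set 18 (σ.var 17)).set 16 0) (.set rfl) ?_).le (by omega)
  rintro _ - rfl
  refine (Tri.forTo (k := 5) (N := n) (fun i τ => Walked (σ.var 17) pre S i τ) rfl rfl rfl
    (by simpa using hI.var_n) ?_ fun i hi τ hτ hS' hQ => ?_).mono (by omega) fun τ hτ hQ =>
      ⟨hτ.var 18 rfl, hQ⟩
  · exact ⟨pre, hT, hT.pos, hT.root, le_rfl, fun _ _ => rfl, fun a h h' => absurd h' (not_lt.2 h)⟩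
  · have h4 : τ.arr 4 = σ.arr 4 := hS'.arr 4 rfl
    have hset : ∀ ρ, Walked (σ.var 17) pre S (i + 1) ρ →
        Walked (σ.var 17) pre S (i + 1) (ρ.set 12 (i + 1)) := fun ρ h => h
    refine .ite (fun h => (descend_spec hQ ?_).mono (by omega) fun ρ _ => hset ρ)
      fun h => (descend_spec hQ ?_).mono (by omega) fun ρ _ => hset ρ
    all_goals
      simp only [Tm.eval, hτ, h4, hS.mem i hi] at h
      simp [h]

/-- The sets in the list `L` are those in the trie, and they have been written. -/
structure Listed (G : SimpleGraph ℕ) (n s : ℕ) (L : List (Finset ℕ)) (σ : Store) : Prop where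
  nodup : L.Nodup
  isMaximalPlexIn : ∀ S ∈ L, IsMaximalPlexIn G s (Finset.range n) S
  out : σ.out = L.flatMap fun S => (List.range n).map fun x => if x ∈ S then 1 else 0
  trie : ∃ pre, StoresTrie σ pre ∧
    ∀ S ⊆ Finset.range n, S ∈ L ↔ ∃ a < σ.var 17, pre a = bits S n

theorem Listed.of_same {L : List (Finset ℕ)} {τ : Store} {c : Cmd} (h : Listed G n s L σ)
    (hS : Same c σ τ) (ho : c.writesOut = false) (h8 : c.writesArr 8 = false)
    (h9 : c.writesArr 9 = false) (h17 : c.writesVar 17 = false) : Listed G n s L τ := by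
  obtain ⟨pre, h1, h2⟩ := h.trie
  refine ⟨h.nodup, h.isMaximalPlexIn, (hS.out ho).trans h.out, pre, ?_, by rwa [hS.var 17 h17]⟩
  have : (fun b => τ.arr (childArr b)) = fun b => σ.arr (childArr b) := by
    funext b; cases b
    exacts [hS.arr 8 h8, hS.arr 9 h9]
  unfold StoresTrie
  rw [this, hS.var 17 h17]
  exact h1

/-- Write the current plex if it is new. -/
def outputCmd : Cmd :=
  .ite (.lt (.var 16) (.var 18)) .skip <|
    .forTo 12 0 <| .write (.lt (.const 0) (.read 4 (.var 12)))

theorem outputCmd_spec {S : Finset ℕ} (hI : Input G n s σ)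
    (hS : HoldsPlex G n s S σ) : Tri outputCmd σ (3 * n + 3) fun τ =>
      τ.out = σ.out ++ if σ.var 16 < σ.var 18 then [] else
        (List.range n).map fun x => if x ∈ S then 1 else 0 := by
  refine .ite (fun h => (Tri.skip ?_).le (by omega)) fun h => ?_
  · rw [Tm.lt_pos] at h
    simp only [Tm.eval] at h
    simp [h]
  · rw [Tm.lt_pos] at h
    simp only [Tm.eval] at h
    rw [if_neg h]
    refine (Tri.forTo (k := 1) (N := n) (fun i τ => τ.out = σ.out ++ (List.range i).map fun x =>
      if x ∈ S then 1 else 0) rfl rfl rfl hI.var_n (by simp) fun i hi τ hτ hS' hQ =>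
        .write ?_).le (by omega)
    have h4 := hS'.arr 4 rfl
    simp only [Store.set_out, hQ, Tm.eval, hτ, h4, hS.mem i hi, List.range_succ]
    simp

/-- Compute the plex for the current digits, and write it if it is new. -/
def processCmd : Cmd := .seq buildCmd <| .seq insertCmd outputCmd

/-- The final pass over `List.range n` ensures maximality whatever the digits are, so nothing else
is ever written. -/
theorem isMaximalPlexIn_greedyPlex {v i : ℕ} {d ord : ℕ → ℕ} {τ : Store}
    (h : HoldsPlex G n s (greedyPlex G n s v d ord i) τ) :
    IsMaximalPlexIn G s (Finset.range n) (greedyPlex G n s v d ord i) :=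
  ⟨h.subset, h.isPlex, fun _ hu => mem_foldl_tryAdd _ _
    (List.mem_append_right _ (List.mem_range.2 (Finset.mem_range.1 hu)))⟩

theorem processCmd_spec {v i : ℕ} {L : List (Finset ℕ)} (hI : Input G n s σ) (hn : 1 ≤ n)
    (hs : s ≤ n) (hL : Listed G n s L σ) (hv : σ.var 5 = v) (hvn : v < n) (hi : σ.var 4 = i)
    (hin : i ≤ n) (ho : ∀ j < i, σ.arr 3 j < n) (hd : ∀ j < 2 * s - 3, σ.arr 6 j < n) :
    Tri processCmd σ (150 * n ^ 2) fun τ => ∃ L', Listed G n s L' τ ∧ L ⊆ L' ∧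
      greedyPlex G n s v (σ.arr 6) (σ.arr 3) i ∈ L' := by
  refine Tri.le (k := 130 * n ^ 2 + (7 * n + 4 + (3 * n + 3))) ?_ (by nlinarith)
  refine (buildCmd_spec hI hn hs hv hvn hi hin ho hd).seq fun σ₁ h₁ hR => ?_
  have hL₁ := hL.of_same h₁ rfl rfl rfl rfl
  have hI₁ := hI.of_same h₁ rfl
  have hmax := isMaximalPlexIn_greedyPlex hR
  generalize greedyPlex G n s v (σ.arr 6) (σ.arr 3) i = R at hR hmax ⊢
  obtain ⟨pre, hT, hpre⟩ := hL₁.trie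
  refine (insertCmd_spec hI₁ hR hT).seq fun σ₂ h₂ hW => ?_
  obtain ⟨h18, pre', hT', hlt, hnode, hle, hold, hnew⟩ := hW
  refine (outputCmd_spec (hI₁.of_same h₂ rfl) (hR.of_arr (h₂.arr 4 rfl) (h₂.arr 5 rfl))).mono le_rfl
    fun σ₃ h₃ hout => ?_
  have hT₃ : StoresTrie σ₃ pre' := by
    have : (fun b => σ₃.arr (childArr b)) = fun b => σ₂.arr (childArr b) := by
      funext b; cases b
      exacts [h₃.arr 8 rfl, h₃.arr 9 rfl]
    unfold StoresTrie
    rw [this, h₃.var 17 rfl]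
    exact hT'
  have hmem : ∀ S ⊆ Finset.range n, (S ∈ L ∨ S = R) ↔ ∃ a < σ₃.var 17, pre' a = bits S n := by
    intro S hS
    rw [h₃.var 17 rfl]
    constructor
    · rintro (hSL | rfl)
      · obtain ⟨a, ha, hb⟩ := (hpre S hS).1 hSL
        exact ⟨a, by omega, by rw [hold a ha, hb]⟩
      · exact ⟨_, hlt, hnode⟩
    · rintro ⟨a, ha, hb⟩
      by_cases hak : a < σ₁.var 17
      · exact .inl ((hpre S hS).2 ⟨a, hak, by rw [← hold a hak, hb]⟩)
      -- A new node spells a prefix of the bit word of `R`; if its length is `n`, it is the whole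
      -- word.
      · obtain ⟨y, hy, hay⟩ := hnew a (by omega) ha
        rw [hb] at hay
        obtain rfl : n = y := by simpa [length_bits] using congrArg List.length hay
        exact .inr (eq_of_bits_eq hS hmax.subset hay)
  have hout' : σ₂.out = L.flatMap fun S => (List.range n).map fun x => if x ∈ S then 1 else 0 :=
    (h₂.out rfl).trans hL₁.out
  rw [h18, hout'] at hout
  by_cases hc : σ₂.var 16 < σ₁.var 17
  · have hRL : R ∈ L := (hpre R hmax.subset).2 ⟨_, hc, by rw [← hold _ hc, hnode]⟩
    refine ⟨L, ⟨hL.nodup, hL.isMaximalPlexIn, by simpa [hc] using hout, pre', hT₃, fun S hS => ?_⟩,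
      List.Subset.refl _, hRL⟩
    rw [← hmem S hS]
    exact ⟨.inl, fun h => h.elim id fun h => h ▸ hRL⟩
  -- An old node spelling `R` would, by injectivity of the trie, be the node reached, which is new.
  · have hRL : R ∉ L := fun h => by
      obtain ⟨a, ha, hb⟩ := (hpre R hmax.subset).1 h
      have := hT'.inj a (by omega) _ hlt (by rw [hold a ha, hb, hnode])
      omega
    refine ⟨L ++ [R], ⟨?_, ?_, by simpa [hc] using hout, pre', hT₃, fun S hS => ?_⟩,
      List.subset_append_left _ _, by simp⟩
    · rw [List.nodup_append_comm]
      simpa [hRL] using hL.nodup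
    · intro S hS
      rcases List.mem_append.1 hS with hS | hS
      · exact hL.isMaximalPlexIn S hS
      · rwa [List.mem_singleton.1 hS]
    · rw [← hmem S hS]; simp

end

/-! ### Mixed radix numbers -/

/-- The number with the digits `d` in the mixed radix system `r`. -/
def mixedRadix (r d : ℕ → ℕ) (k : ℕ) : ℕ :=
  ∑ j ∈ Finset.range k, d j * ∏ i ∈ Finset.range j, r i

theorem mixedRadix_succ (r d : ℕ → ℕ) (k : ℕ) :
    mixedRadix r d (k + 1) = mixedRadix r d k + d k * ∏ i ∈ Finset.range k, r i :=
  Finset.sum_range_succ _ _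

theorem mixedRadix_zero_digits {r d : ℕ → ℕ} {k : ℕ} (h : ∀ j < k, d j = 0) :
    mixedRadix r d k = 0 :=
  Finset.sum_eq_zero fun j hj => by rw [h j (Finset.mem_range.1 hj), Nat.zero_mul]

theorem mixedRadix_lt {r d : ℕ → ℕ} {k : ℕ} (h : ∀ j < k, d j < r j) :
    mixedRadix r d k < ∏ i ∈ Finset.range k, r i := by
  induction k with
  | zero => simp [mixedRadix]
  | succ k ih =>
    rw [mixedRadix_succ, Finset.prod_range_succ]
    have h1 := ih fun j hj => h j (by omega)
    have h2 := h k (by omega)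
    nlinarith

theorem mixedRadix_add_one {r d : ℕ → ℕ} {k : ℕ} (h : ∀ j < k, d j + 1 = r j) :
    mixedRadix r d k + 1 = ∏ i ∈ Finset.range k, r i := by
  induction k with
  | zero => simp [mixedRadix]
  | succ k ih =>
    rw [mixedRadix_succ, Finset.prod_range_succ, ← ih fun j hj => h j (by omega),
      ← h k (by omega)]
    ring

/-- The maximal digits below `t` are worth one less than the weight of position `t`; clearing them
and raising digit `t` gains exactly one. -/
theorem mixedRadix_carry {r d e : ℕ → ℕ} {k t : ℕ} (ht : t < k) (h : ∀ j < t, d j + 1 = r j)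
    (h0 : ∀ j < t, e j = 0) (h1 : e t = d t + 1) (h2 : ∀ j, t < j → e j = d j) :
    mixedRadix r e k = mixedRadix r d k + 1 := by
  induction k, ht using Nat.le_induction with
  | base =>
    rw [mixedRadix_succ, mixedRadix_succ, mixedRadix_zero_digits h0, h1, ← mixedRadix_add_one h]
    ring
  | succ k hk ih =>
    rw [mixedRadix_succ, mixedRadix_succ, ih, h2 k hk]
    ring

/-- Division by the weight of the top position recovers the top digit. Hence counting through all
values visits every digit vector. -/
theorem mixedRadix_inj {r d e : ℕ → ℕ} {k : ℕ} (hd : ∀ j < k, d j < r j) (he : ∀ j < k, e j < r j)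
    (h : mixedRadix r d k = mixedRadix r e k) : ∀ j < k, d j = e j := by
  induction k with
  | zero => simp
  | succ k ih =>
    rw [mixedRadix_succ, mixedRadix_succ] at h
    have h1 := mixedRadix_lt (k := k) fun j hj => hd j (by omega)
    have h2 := mixedRadix_lt (k := k) fun j hj => he j (by omega)
    have hP : 0 < ∏ i ∈ Finset.range k, r i := by omega
    have hk : d k = e k := by
      have := congrArg (· / ∏ i ∈ Finset.range k, r i) h
      simpa [Nat.add_mul_div_right _ _ hP, Nat.div_eq_of_lt h1, Nat.div_eq_of_lt h2] using this
    intro j hj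
    rcases Nat.lt_succ_iff_lt_or_eq.1 hj with hj | rfl
    · exact ih (fun j hj => hd j (by omega)) (fun j hj => he j (by omega))
        (by rw [hk] at h; omega) j hj
    · exact hk

/-! ### Running through all digit vectors -/

section

variable {G : SimpleGraph ℕ} {n s : ℕ} {σ : Store}

/-- Set the digits that are maximal, from position `0` on, to `0`. -/
def carryCmd : Cmd :=
  .loop (.and (.lt (.var 20) (.var 3)) (.not (.lt (.succ (.read 6 (.var 20))) (.read 7 (.var 20)))))
    (.seq (.put 6 (.var 20) (.const 0)) (.set 20 (.succ (.var 20))))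

/-- Pass to the next digit vector. -/
def incrementCmd : Cmd :=
  .seq (.set 20 (.const 0)) <| .seq carryCmd <|
    .ite (.lt (.var 20) (.var 3)) (.put 6 (.var 20) (.succ (.read 6 (.var 20)))) (.set 19 (.const 0))

/-- A carry may pass through all `M` digits. No amortisation is needed, since processing a vector
costs more anyway. -/
theorem incrementCmd_spec {M : ℕ} (hM : σ.var 3 = M) (hd : ∀ j < M, σ.arr 6 j < σ.arr 7 j) :
    Tri incrementCmd σ (3 * M + 4) fun τ => (∀ j < M, τ.arr 6 j < σ.arr 7 j) ∧
      ((τ.var 19 = 0 ∧ mixedRadix (σ.arr 7) (σ.arr 6) M + 1 = ∏ i ∈ Finset.range M, σ.arr 7 i) ∨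
      (τ.var 19 = σ.var 19 ∧
        mixedRadix (σ.arr 7) (τ.arr 6) M = mixedRadix (σ.arr 7) (σ.arr 6) M + 1)) := by
  refine Tri.le (k := 1 + (M * (2 + 1) + 1 + 2)) ?_ (by omega)
  refine Tri.seq (Q := fun τ => τ = σ.set 20 0) (.set rfl) ?_
  rintro _ - rfl
  refine (Tri.loop (k := 2) M (fun t τ => τ.var 20 = t ∧ t ≤ M ∧ (∀ j < t, σ.arr 6 j + 1 = σ.arr 7 j) ∧
    τ.arr 6 = fun j => if j < t then 0 else σ.arr 6 j)
    ⟨by simp, Nat.zero_le _, by simp, funext fun j => by simp⟩ ?_).seq ?_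
  · rintro t τ hS ⟨ht, htM, hmax, h6⟩ hc
    rw [Tm.and_pos, Tm.not_pos, Tm.lt_pos, Tm.lt_pos] at hc
    have h3 : τ.var 3 = M := (hS.var 3 rfl).trans hM
    have h7 : τ.arr 7 = σ.arr 7 := hS.arr 7 rfl
    simp only [Tm.eval, ht, h6, h7, h3, lt_irrefl, if_false] at hc
    refine ⟨hc.1, Tri.seq (k := 1) (l := 1) (Q := fun ρ => ρ = τ.put 6 t 0) (.put (by simp [ht])) ?_⟩
    rintro _ - rfl
    refine .set ⟨by simp [ht], hc.1, fun j hj => ?_, ?_⟩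
    · rcases Nat.lt_succ_iff_lt_or_eq.1 hj with hj | rfl
      · exact hmax j hj
      · have := hd j hc.1; omega
    · funext j
      simp only [Store.set_arr, Store.put_arr, h6, true_and]
      grind
  · rintro τ hS ⟨t, ⟨ht, htM, hmax, h6⟩, hc⟩
    rw [Tm.and_pos, Tm.not_pos, Tm.lt_pos, Tm.lt_pos] at hc
    have h3 : τ.var 3 = M := (hS.var 3 rfl).trans hM
    have h7 : τ.arr 7 = σ.arr 7 := hS.arr 7 rfl
    have h19 : τ.var 19 = σ.var 19 := hS.var 19 rfl
    simp only [Tm.eval, ht, h6, h7, h3, lt_irrefl, if_false] at hc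
    refine .ite (fun h => .put ?_) fun h => .set ?_
    · rw [Tm.lt_pos] at h
      simp only [Tm.eval, ht, h3] at h
      simp only [Store.put_arr, Store.put_var, true_and, Tm.eval, ht, h6, lt_irrefl, if_false]
      refine ⟨fun j hj => ?_, .inr ⟨h19, mixedRadix_carry h hmax ?_ ?_ ?_⟩⟩
      · have := hd j hj
        split_ifs with h1 h2
        · subst h1; omega
        · omega
        · exact this
      · intro j hj
        simp [h6, hj.ne, hj]
      · simp
      · intro j hj
        simp [h6, hj.ne', not_lt.2 hj.le]
    · rw [Tm.lt_pos] at h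
      simp only [Tm.eval, ht, h3] at h
      obtain rfl : t = M := by omega
      refine ⟨fun j hj => ?_, .inl ⟨by simp, mixedRadix_add_one hmax⟩⟩
      have := hd j hj
      simp only [Store.set_arr, h6, if_pos hj]
      omega

theorem digitList_congr {m k : ℕ} {d e : ℕ → ℕ} (h : ∀ j < k, d j = e j) :
    digitList m d k = digitList m e k := by
  induction k with
  | zero => rfl
  | succ k ih =>
    rw [digitList_succ, digitList_succ, ih fun j hj => h j (by omega), h k (by omega)]

theorem greedyPlex_congr {v i : ℕ} {d e ord : ℕ → ℕ} (h : ∀ j < 2 * s - 3 + n, d j = e j) :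
    greedyPlex G n s v d ord i = greedyPlex G n s v e ord i := by
  rw [greedyPlex, greedyPlex, digitList_congr h]

/-- Process all digit vectors. -/
def enumerateCmd : Cmd :=
  .seq (.set 19 (.const 1)) <| .loop (.var 19) <| .seq processCmd incrementCmd

theorem enumerateCmd_spec {v i : ℕ} {L : List (Finset ℕ)} {r : ℕ → ℕ} {N : ℕ} (hI : Input G n s σ)
    (hn : 1 ≤ n) (hs : s ≤ n) (hL : Listed G n s L σ) (hv : σ.var 5 = v) (hvn : v < n)
    (hi : σ.var 4 = i) (hin : i ≤ n) (ho : ∀ j < i, σ.arr 3 j < n) (hr : σ.arr 7 = r)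
    (hrpos : ∀ j < 2 * s - 3 + n, 0 < r j)
    (hrn : ∀ j < 2 * s - 3, r j = n) (hd : ∀ j < 2 * s - 3 + n, σ.arr 6 j = 0)
    (hN : ∏ j ∈ Finset.range (2 * s - 3 + n), r j ≤ N) :
    Tri enumerateCmd σ (N * (170 * n ^ 2) + 2) fun τ => ∃ L', Listed G n s L' τ ∧ L ⊆ L' ∧
      ∀ d : ℕ → ℕ, (∀ j < 2 * s - 3 + n, d j < r j) → greedyPlex G n s v d (σ.arr 3) i ∈ L' := by
  set M := 2 * s - 3 + n with hM
  refine Tri.le (k := 1 + (N * (150 * n ^ 2 + (3 * M + 4) + 1) + 1)) ?_ ?_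
  swap
  · have : 150 * n ^ 2 + (3 * M + 4) + 1 ≤ 170 * n ^ 2 := by
      have : M ≤ 3 * n := by omega
      nlinarith
    have := Nat.mul_le_mul_left N this
    omega
  refine Tri.seq (Q := fun τ => τ = σ.set 19 1) (.set rfl) ?_
  rintro _ - rfl
  -- While the flag is set, round `t` holds the vector of value `t` and all smaller values are done;
  -- once the flag is cleared, the premise on the value is void and all vectors are done. The value
  -- is below the product of the radices, so there are at most `N` rounds.
  refine (Tri.loop (σ := σ.set 19 1) (k := 150 * n ^ 2 + (3 * M + 4)) N (fun t τ => (∀ j < M, τ.arr 6 j < r j) ∧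
    ∃ L', Listed G n s L' τ ∧ L ⊆ L' ∧
    ((0 < τ.var 19 → mixedRadix r (τ.arr 6) M = t) ∧ ∀ d : ℕ → ℕ, (∀ j < M, d j < r j) →
      (0 < τ.var 19 → mixedRadix r d M < t) → greedyPlex G n s v d (σ.arr 3) i ∈ L'))
    ⟨fun j hj => ?_, L, ?_, List.Subset.refl _, fun _ => mixedRadix_zero_digits hd, ?_⟩ ?_).mono
      le_rfl ?_
  · rw [Store.set_arr, hd j hj]
    exact hrpos j hj
  · exact hL.of_same (c := .set 19 (.const 1)) (Run.same (.set _ _ _)) rfl rfl rfl rfl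
  · intro d _ h
    exact absurd (h (by simp)) (by omega)
  · rintro t τ hS ⟨hdt, L₁, hL₁, hLL₁, hval, hdone⟩ hpos
    have hS' : Same enumerateCmd σ τ := Same.trans
      ((Run.same (.set σ 19 (.const 1))).mono (by simp +contextual [enumerateCmd, Cmd.writesVar])
        (by simp [enumerateCmd, Cmd.writesArr]) (by simp [enumerateCmd, Cmd.writesOut]))
      (hS.mono (by simp +contextual [enumerateCmd, Cmd.writesVar])
        (by simp +contextual [enumerateCmd, Cmd.writesArr])
        (by simp +contextual [enumerateCmd, Cmd.writesOut]))
    have hIτ := hI.of_same hS' rfl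
    have hval := hval hpos
    refine ⟨?_, ?_⟩
    · rw [← hval]
      exact (mixedRadix_lt hdt).trans_le hN
    refine (processCmd_spec hIτ hn hs hL₁ ((hS'.var 5 rfl).trans hv) hvn ((hS'.var 4 rfl).trans hi)
      hin (by rw [hS'.arr 3 rfl]; exact ho) fun j hj => ?_).seq ?_
    · rw [← hrn j hj]
      exact hdt j (by omega)
    rintro ρ hρ ⟨L₂, hL₂, hLL₂, hmem⟩
    have h6 : ρ.arr 6 = τ.arr 6 := hρ.arr 6 rfl
    have h7 : ρ.arr 7 = r := by rw [hρ.arr 7 rfl, hS'.arr 7 rfl, hr]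
    have h19 : ρ.var 19 = τ.var 19 := hρ.var 19 rfl
    rw [hS'.arr 3 rfl] at hmem
    refine (incrementCmd_spec (M := M) ((hIτ.of_same hρ rfl).var_M) (by rwa [h6, h7])).mono le_rfl ?_
    rw [h6, h7, h19, hval]
    rintro υ hυ ⟨hdυ, hcase⟩
    have hall : ∀ d : ℕ → ℕ, (∀ j < M, d j < r j) → mixedRadix r d M < t + 1 →
        greedyPlex G n s v d (σ.arr 3) i ∈ L₂ := by
      intro d hd' hlt
      rcases Nat.lt_succ_iff_lt_or_eq.1 hlt with hlt | heq
      · exact hLL₂ (hdone d hd' fun _ => hlt)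
      · rw [greedyPlex_congr (mixedRadix_inj hd' hdt (by rw [heq, hval]))]
        exact hmem
    refine ⟨hdυ, L₂, hL₂.of_same hυ rfl rfl rfl rfl, fun x hx => hLL₂ (hLL₁ hx), ?_⟩
    rcases hcase with ⟨h0, hprod⟩ | ⟨hgo, hnext⟩
    · refine ⟨fun h => by omega, fun d hd' _ => hall d hd' ?_⟩
      rw [hprod]
      exact mixedRadix_lt hd'
    · refine ⟨fun _ => hnext, fun d hd' h => ?_⟩
      by_cases h0 : 0 < υ.var 19
      · exact hall d hd' (h h0)
      · simp only [Tm.eval] at hpos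
        omega
  · rintro τ hS ⟨t, ⟨-, L₁, hL₁, hLL₁, -, hdone⟩, hc⟩
    exact ⟨L₁, hL₁, hLL₁, fun d hd' => hdone d hd' fun h => absurd h hc⟩

end

/-! ### Digit vectors of candidates, and the test for common neighbours -/

section

variable {G : SimpleGraph ℕ} {n s : ℕ} {σ : Store}

open Classical in
-- The leading digits list `T`, padded with `v`; the others form the characteristic vector of `B`.
-- Radix 1 forces digit 0 outside the common neighbours of `v` and `p`, so only 2 to the number of
-- these common neighbours binary patterns occur.
theorem exists_digits {X S : Finset ℕ} {v p : ℕ} (hX : X ⊆ Finset.range n) (hv : v ∈ X)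
    {T B : Finset ℕ} (hT : T ⊆ X) (hcard : T.card ≤ 2 * s - 3) (hB : B ⊆ pivotNbrs G X v p)
    (hS : S = insert v (T ∪ B)) : ∃ d : ℕ → ℕ,
      (∀ j < 2 * s - 3 + n, d j < if j < 2 * s - 3 then n else
        1 + if j - (2 * s - 3) ∈ pivotNbrs G X v p then 1 else 0) ∧
      (v :: digitList (2 * s - 3) d (2 * s - 3 + n)).toFinset = S := by
  obtain ⟨f, hf, hfT⟩ := exists_insert_image_eq v T hcard
  have hfn : ∀ j, f j < n := fun j =>
    Finset.mem_range.1 (hX (Finset.insert_subset hv hT (hf j)))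
  refine ⟨fun j => if j < 2 * s - 3 then f j else if j - (2 * s - 3) ∈ B then 1 else 0,
    fun j _ => ?_, ?_⟩
  · dsimp only
    split_ifs with h1 h2 h3 h3
    · exact hfn j
    · omega
    · exact absurd (hB h2) h3
    · omega
    · omega
  · rw [hS, ← Finset.insert_union, ← hfT]
    ext x
    have hBn : x ∈ B → x < n := fun h =>
      Finset.mem_range.1 (hX (Finset.filter_subset _ _ (hB h)))
    simp only [List.mem_toFinset, List.mem_cons, mem_digitList, Finset.mem_union, Finset.mem_insert,
      Finset.mem_image, Finset.mem_range]
    rw [or_assoc]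
    refine or_congr_right (or_congr ?_ ?_)
    · constructor
      · rintro ⟨j, _, hj, h⟩
        exact ⟨j, hj, by rwa [if_pos hj] at h⟩
      · rintro ⟨j, hj, h⟩
        exact ⟨j, by omega, hj, by rwa [if_pos hj]⟩
    · rw [if_neg (by omega), Nat.add_sub_cancel_left]
      split_ifs with h
      · simp [h, hBn h]
      · simp [h]

/-- The digits rebuild `S'` without rejection because it is a plex, the ordering extends it to `S`,
and the pass over all vertices changes nothing because `S` is maximal. -/
theorem greedyPlex_eq {S S' : Finset ℕ} {v i : ℕ} {d ord : ℕ → ℕ}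
    (hS : IsMaximalPlexIn G s (Finset.range n) S) (hS' : IsPlex G s S')
    (hd : (v :: digitList (2 * s - 3) d (2 * s - 3 + n)).toFinset = S')
    (hf : (descending ord i).foldl (tryAdd G s) S' = S) : greedyPlex G n s v d ord i = S := by
  have h : (v :: digitList (2 * s - 3) d (2 * s - 3 + n)).foldl (tryAdd G s) ∅ = S' := by
    rw [foldl_tryAdd_eq_union, Finset.empty_union, hd]
    rwa [Finset.empty_union, hd]
  rw [greedyPlex, List.foldl_append, List.foldl_append, h, hf]
  exact hS.foldl_tryAdd_eq _ (by simp)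

open Classical in
theorem prod_radix {X : Finset ℕ} (hX : X ⊆ Finset.range n) (m v p : ℕ) :
    ∏ j ∈ Finset.range (m + n), (if j < m then n else 1 + if j - m ∈ pivotNbrs G X v p then 1 else 0)
      = n ^ m * 2 ^ (pivotNbrs G X v p).card := by
  rw [Finset.prod_range_add]
  congr 1
  · rw [Finset.prod_congr rfl fun j hj => if_pos (Finset.mem_range.1 hj)]
    simp
  · have : ∀ x ∈ Finset.range n, (if m + x < m then n else
        1 + if m + x - m ∈ pivotNbrs G X v p then 1 else 0) =
        if x ∈ pivotNbrs G X v p then 2 else 1 := fun x _ => by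
      rw [if_neg (by omega), Nat.add_sub_cancel_left]
      split_ifs <;> rfl
    rw [Finset.prod_congr rfl this, Finset.prod_ite, Finset.prod_const, Finset.prod_const_one,
      mul_one]
    congr 2
    ext x
    simp only [Finset.mem_filter, and_iff_right_iff_imp]
    exact fun h => hX (Finset.filter_subset _ _ h)

/-- `X` is the set of the vertices that have not been removed. -/
structure Alive (n : ℕ) (X : Finset ℕ) (σ : Store) : Prop where
  subset : X ⊆ Finset.range n
  mem : ∀ x < n, 0 < σ.arr 2 x ↔ x ∉ X

theorem Alive.of_same {X : Finset ℕ} {τ : Store} {c : Cmd} (h : Alive n X σ) (hS : Same c σ τ)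
    (h2 : c.writesArr 2 = false) : Alive n X τ :=
  ⟨h.subset, by rw [hS.arr 2 h2]; exact h.mem⟩

/-- The test whether two numbers are different. -/
def Tm.ne (e f : Tm) : Tm := .not (.and (.not (.lt e f)) (.not (.lt f e)))

theorem Tm.ne_pos {e f : Tm} : 0 < (e.ne f).eval σ ↔ e.eval σ ≠ f.eval σ := by
  rw [Tm.ne, Tm.not_pos, Tm.and_pos, Tm.not_pos, Tm.not_pos, Tm.lt_pos, Tm.lt_pos]
  omega

/-- The test for membership of `g` in `pivotNbrs G X e f`. -/
def Tm.pivotTest (e f g : Tm) : Tm :=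
  .and (.not (.read 2 g)) <| .and (.not (.read 2 f)) <| .and (.ne f e) <|
    .and (.not (.adj e f)) <| .and (.adj e g) (.adj f g)

theorem Tm.pivotTest_pos {X : Finset ℕ} {e f g : Tm} (hI : Input G n s σ) (hX : Alive n X σ)
    (he : e.eval σ < n) (hf : f.eval σ < n) (hg : g.eval σ < n) :
    0 < (Tm.pivotTest e f g).eval σ ↔ g.eval σ ∈ pivotNbrs G X (e.eval σ) (f.eval σ) := by
  rw [pivotTest, Tm.and_pos, Tm.and_pos, Tm.and_pos, Tm.and_pos, Tm.and_pos, Tm.not_pos, Tm.not_pos,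
    Tm.not_pos, Tm.ne_pos, hI.adj_pos he hf, hI.adj_pos he hg, hI.adj_pos hf hg]
  simp only [Tm.eval, hX.mem _ hf, hX.mem _ hg, not_not, pivotNbrs, Finset.mem_filter]

theorem Tm.and_le (e f : Tm) : (e.and f).eval σ ≤ f.eval σ := by
  simp only [eval]; split_ifs <;> simp

open Classical in
-- The exact value is needed, not only its sign, because `initDigits` stores its successor as a
-- radix.
theorem Tm.pivotTest_eval {X : Finset ℕ} {e f g : Tm} (hI : Input G n s σ) (hX : Alive n X σ)
    (he : e.eval σ < n) (hf : f.eval σ < n) (hg : g.eval σ < n) : (Tm.pivotTest e f g).eval σ =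
      if g.eval σ ∈ pivotNbrs G X (e.eval σ) (f.eval σ) then 1 else 0 := by
  have h1 : (Tm.pivotTest e f g).eval σ ≤ 1 :=
    (Tm.and_le _ _).trans <| (Tm.and_le _ _).trans <| (Tm.and_le _ _).trans <|
    (Tm.and_le _ _).trans <| (Tm.and_le _ _).trans <| by
      simp only [Tm.adj, Tm.eval]
      rw [hI.row _ hf, hI.adj _ hf _ hg]
      split_ifs <;> simp
  have h2 := Tm.pivotTest_pos hI hX he hf hg
  split_ifs with h
  · have := h2.2 h; omega
  · have := h2.not.2 h; omega

/-! ### The choice of a vertex of least closure number -/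

/-- Count the common neighbours of variables `14` and `13`. -/
def countCmd : Cmd :=
  .seq (.set 9 (.const 0)) <| .forTo 12 0 <|
    .ite (.pivotTest (.var 14) (.var 13) (.var 12)) (.set 9 (.succ (.var 9))) .skip

theorem countCmd_spec {X : Finset ℕ} {u p : ℕ} (hI : Input G n s σ) (hX : Alive n X σ)
    (hu : σ.var 14 = u) (hun : u < n) (hp : σ.var 13 = p) (hpn : p < n) :
    Tri countCmd σ (4 * n + 3) fun τ => τ.var 9 = (pivotNbrs G X u p).card := by
  classical
  refine Tri.le (k := 1 + (n * (2 + 2) + 2)) ?_ (by omega)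
  refine Tri.seq (Q := fun τ => τ = σ.set 9 0) (.set rfl) ?_
  rintro _ hS₀ rfl
  refine (Tri.forTo (k := 2) (N := n)
    (fun i τ => τ.var 9 = ((Finset.range i).filter fun x => x ∈ pivotNbrs G X u p).card)
    rfl rfl rfl (by simpa using hI.var_n) (by simp) fun i hi τ hτ hS hQ => ?_).mono le_rfl
    fun τ _ hQ => ?_
  · have hu' : τ.var 14 = u := (hS.var 14 rfl).trans hu
    have hp' : τ.var 13 = p := (hS.var 13 rfl).trans hp
    have ht := Tm.pivotTest_pos (e := .var 14) (f := .var 13) (g := .var 12)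
      ((hI.of_same hS₀ rfl).of_same hS rfl) ((hX.of_same hS₀ rfl).of_same hS rfl)
      (by simpa [hu'] using hun) (by simpa [hp'] using hpn) (by simpa [hτ] using hi)
    simp only [Tm.eval, hu', hp', hτ] at ht
    refine .ite (fun h => .set ?_) fun h => .skip ?_
    · rw [ht] at h
      rw [Finset.range_add_one, Finset.filter_insert, if_pos h,
        Finset.card_insert_of_notMem (by simp)]
      simpa using hQ
    · rw [ht] at h
      rw [Finset.range_add_one, Finset.filter_insert, if_neg h]
      simpa using hQ
  · rw [hQ]
    congr 1
    ext x
    simp only [Finset.mem_filter, and_iff_right_iff_imp]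
    exact fun h => hX.subset (Finset.filter_subset _ _ h)

/-- The closure number of the vertex in variable `14`. -/
def closureCmd : Cmd :=
  .seq (.set 8 (.const 0)) <| .forTo 13 0 <|
    .seq countCmd (.ite (.lt (.var 8) (.var 9)) (.set 8 (.var 9)) .skip)

/-- The maximum is described by its upper bounds, the form in which the choice of a minimum uses it.
-/
theorem closureCmd_spec {X : Finset ℕ} {u : ℕ} (hI : Input G n s σ) (hX : Alive n X σ)
    (hu : σ.var 14 = u) (hun : u < n) :
    Tri closureCmd σ (4 * n ^ 2 + 7 * n + 3) fun τ =>
      ∀ g, τ.var 8 ≤ g ↔ ∀ p < n, (pivotNbrs G X u p).card ≤ g := by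
  refine Tri.le (k := 1 + (n * (4 * n + 3 + 2 + 2) + 2)) ?_ (by nlinarith)
  refine Tri.seq (Q := fun τ => τ = σ.set 8 0) (.set rfl) ?_
  rintro _ hS₀ rfl
  refine (Tri.forTo (k := 4 * n + 3 + 2) (N := n)
    (fun i τ => ∀ g, τ.var 8 ≤ g ↔ ∀ p < i, (pivotNbrs G X u p).card ≤ g)
    rfl rfl rfl (by simpa using hI.var_n) (by simp) fun i hi τ hτ hS hQ => ?_)
  refine (countCmd_spec ((hI.of_same hS₀ rfl).of_same hS rfl)
    ((hX.of_same hS₀ rfl).of_same hS rfl) ((hS.var 14 rfl).trans hu) hun hτ hi).seq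
    fun ρ hρ hc => ?_
  have h8 : ρ.var 8 = τ.var 8 := hρ.var 8 rfl
  have hstep : ∀ g, (∀ p < i + 1, (pivotNbrs G X u p).card ≤ g) ↔ τ.var 8 ≤ g ∧ ρ.var 9 ≤ g := by
    intro g
    rw [hQ, hc]
    refine ⟨fun h => ⟨fun p hp => h p (by omega), h i (by omega)⟩, fun h p hp => ?_⟩
    rcases Nat.lt_succ_iff_lt_or_eq.1 hp with hp | rfl
    exacts [h.1 p hp, h.2]
  refine .ite (fun h => .set fun g => ?_) fun h => .skip fun g => ?_
  · rw [Tm.lt_pos] at h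
    rw [hstep]
    simp only [Tm.eval, h8] at h
    simp
    omega
  · rw [Tm.lt_pos] at h
    rw [hstep]
    simp only [Tm.eval, h8] at h
    simp [h8]
    omega

/-- Put a vertex of least closure number into variable `5`. -/
def selectCmd : Cmd :=
  .seq (.set 7 (.succ (.var 0))) <| .forTo 14 0 <| .ite (.read 2 (.var 14)) .skip <|
    .seq closureCmd <| .ite (.lt (.var 8) (.var 7)) (.seq (.set 7 (.var 8)) (.set 5 (.var 14))) .skip

/-- A vertex of least closure number is at least as good as the vertex promised for γ, so γ does not
enter the program. The initial value `n + 1` exceeds every closure number, so some vertex is chosen.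
-/
theorem selectCmd_spec {X : Finset ℕ} {γ : ℕ} (hI : Input G n s σ) (hX : Alive n X σ)
    (hn : 1 ≤ n) (hγ : ∃ u ∈ X, ∀ p < n, (pivotNbrs G X u p).card ≤ γ) :
    Tri selectCmd σ (23 * n ^ 3) fun τ =>
      τ.var 5 ∈ X ∧ ∀ p < n, (pivotNbrs G X (τ.var 5) p).card ≤ γ := by
  classical
  refine Tri.le (k := 1 + (n * (4 * n ^ 2 + 7 * n + 3 + 3 + 1 + 2) + 2)) ?_ ?_
  swap
  · have : n * n ≤ n * n * n := Nat.le_mul_of_pos_right _ hn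
    have : n ≤ n * n := Nat.le_mul_of_pos_right _ hn
    calc 1 + (n * (4 * n ^ 2 + 7 * n + 3 + 3 + 1 + 2) + 2)
        = 4 * (n * n * n) + 7 * (n * n) + 9 * n + 3 := by ring
      _ ≤ 23 * (n * n * n) := by omega
      _ = 23 * n ^ 3 := by ring
  refine Tri.seq (Q := fun τ => τ = σ.set 7 (n + 1)) (.set (by simp [hI.var_n])) ?_
  rintro _ hS₀ rfl
  refine (Tri.forTo (k := 4 * n ^ 2 + 7 * n + 3 + 3 + 1) (N := n) (fun i τ =>
    (∀ u < i, u ∈ X → ∀ g, (∀ p < n, (pivotNbrs G X u p).card ≤ g) → τ.var 7 ≤ g) ∧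
    (τ.var 7 = n + 1 ∨ τ.var 5 ∈ X ∧ ∀ p < n, (pivotNbrs G X (τ.var 5) p).card ≤ τ.var 7))
    rfl rfl rfl (by simpa using hI.var_n) (by simp) fun i hi τ hτ hS hQ => ?_).mono le_rfl
    fun τ _ hQ => ?_
  · have hXτ := (hX.of_same hS₀ rfl).of_same hS rfl
    refine .ite (fun h => ?_) fun h => ?_
    · refine (Tri.skip ⟨fun u hu huX => ?_, hQ.2⟩).le (by omega)
      rcases Nat.lt_succ_iff_lt_or_eq.1 hu with hu | rfl
      · exact hQ.1 u hu huX
      · simp only [Tm.eval, hτ] at h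
        exact absurd huX ((hXτ.mem u hi).1 h)
    simp only [Tm.eval, hτ, hXτ.mem i hi] at h
    refine Tri.le (k := 4 * n ^ 2 + 7 * n + 3 + 3) ?_ (by omega)
    refine (closureCmd_spec ((hI.of_same hS₀ rfl).of_same hS rfl) hXτ hτ hi).seq fun ρ hρ hc => ?_
    have h7 : ρ.var 7 = τ.var 7 := hρ.var 7 rfl
    have h5 : ρ.var 5 = τ.var 5 := hρ.var 5 rfl
    have h14 : ρ.var 14 = i := (hρ.var 14 rfl).trans hτ
    refine .ite (fun h' => ?_) fun h' => (Tri.skip ?_).le (by omega)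
    · rw [Tm.lt_pos] at h'
      simp only [Tm.eval, h7] at h'
      refine Tri.seq (k := 1) (l := 1) (Q := fun υ => υ = ρ.set 7 (ρ.var 8)) (.set rfl) ?_
      rintro _ - rfl
      refine .set ⟨fun u hu huX g hg => ?_, .inr ⟨?_, ?_⟩⟩
      · change ρ.var 8 ≤ g
        rcases Nat.lt_succ_iff_lt_or_eq.1 hu with hu | rfl
        · exact h'.le.trans (hQ.1 u hu huX g hg)
        · exact (hc g).2 hg
      · simpa [h14] using not_not.1 h
      · simpa [h14] using (hc _).1 le_rfl
    · rw [Tm.lt_pos] at h'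
      simp only [Tm.eval, h7] at h'
      refine ⟨fun u hu huX g hg => ?_, ?_⟩
      · change ρ.var 7 ≤ g
        rw [h7]
        rcases Nat.lt_succ_iff_lt_or_eq.1 hu with hu | rfl
        · exact hQ.1 u hu huX g hg
        · exact (not_lt.1 h').trans ((hc g).2 hg)
      · simpa [h7, h5] using hQ.2
  · obtain ⟨u, huX, hu⟩ := hγ
    have hun := Finset.mem_range.1 (hX.subset huX)
    have h1 : τ.var 7 ≤ n := hQ.1 u hun huX n fun p _ =>
      (Finset.card_le_card ((Finset.filter_subset _ _).trans hX.subset)).trans (by simp)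
    have h2 := hQ.1 u hun huX γ hu
    rcases hQ.2 with h | ⟨h3, h4⟩
    · omega
    · exact ⟨h3, fun p hp => (h4 p hp).trans h2⟩

theorem Listed.set {L : List (Finset ℕ)} {x k : ℕ} (h : Listed G n s L σ)
    (hx : (x == 17) = false) : Listed G n s L (σ.set x k) :=
  h.of_same (c := .set x (.const k)) (Run.same (.set _ _ _)) rfl rfl rfl hx

theorem Listed.put {L : List (Finset ℕ)} {a : Fin 16} {i k : ℕ} (h : Listed G n s L σ)
    (h8 : (a == 8) = false) (h9 : (a == 9) = false) : Listed G n s L (σ.put a i k) :=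
  h.of_same (c := .put a (.const i) (.const k)) (Run.same (.put _ _ _ _)) rfl h8 h9 rfl

/-! ### The main loops -/

/-- Initialise the digits and their radices for the vertex in variable `5` and the pivot in
variable `6`. -/
def initDigits : Cmd :=
  .forTo 13 3 <| .seq (.put 6 (.var 13) (.const 0)) <|
    .ite (.lt (.var 13) (.var 2)) (.put 7 (.var 13) (.var 0))
      (.put 7 (.var 13) (.succ (.pivotTest (.var 5) (.var 6) (.sub (.var 13) (.var 2)))))

open Classical in
theorem initDigits_spec {X : Finset ℕ} {v p : ℕ} (hI : Input G n s σ) (hX : Alive n X σ)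
    (hv : σ.var 5 = v) (hvn : v < n) (hp : σ.var 6 = p) (hpn : p < n) :
    Tri initDigits σ (5 * (2 * s - 3 + n) + 2) fun τ => ∀ j < 2 * s - 3 + n,
      τ.arr 6 j = 0 ∧ τ.arr 7 j = if j < 2 * s - 3 then n else
        1 + if j - (2 * s - 3) ∈ pivotNbrs G X v p then 1 else 0 := by
  refine (Tri.forTo (k := 3) (N := 2 * s - 3 + n) (fun i τ => ∀ j < i,
      τ.arr 6 j = 0 ∧ τ.arr 7 j = if j < 2 * s - 3 then n else
        1 + if j - (2 * s - 3) ∈ pivotNbrs G X v p then 1 else 0) rfl rfl rfl hI.var_M (by simp)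
      fun i hi τ hτ hS hQ => ?_).le (by omega)
  have hI' := hI.of_same hS rfl
  refine Tri.seq (k := 1) (l := 2) (Q := fun ρ => ρ = τ.put 6 i 0) (.put (by simp [hτ])) ?_
  rintro _ hS' rfl
  have hI'' := hI'.of_same hS' rfl
  have hX'' := (hX.of_same hS rfl).of_same hS' rfl
  have h2 : τ.var 2 = 2 * s - 3 := hI'.var_m
  have h5 : τ.var 5 = v := (hS.var 5 rfl).trans hv
  have h6 : τ.var 6 = p := (hS.var 6 rfl).trans hp
  have key : ∀ c, (c = if i < 2 * s - 3 then n else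
        1 + if i - (2 * s - 3) ∈ pivotNbrs G X v p then 1 else 0) → ∀ j < i + 1,
      (((τ.put 6 i 0).put 7 i c).set 13 (i + 1)).arr 6 j = 0 ∧
      (((τ.put 6 i 0).put 7 i c).set 13 (i + 1)).arr 7 j = if j < 2 * s - 3 then n else
        1 + if j - (2 * s - 3) ∈ pivotNbrs G X v p then 1 else 0 := by
    rintro c hc j hj
    rcases Nat.lt_succ_iff_lt_or_eq.1 hj with hj | rfl
    · simpa [hj.ne] using hQ j hj
    · simpa using hc
  refine .ite (fun h => .put ?_) fun h => .put ?_
  · rw [Tm.lt_pos] at h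
    simp only [Tm.eval, Store.put_var, hτ, h2] at h
    simp only [Tm.eval, Store.put_var, hτ, hI'.var_n]
    exact key n (by rw [if_pos h])
  · rw [Tm.lt_pos] at h
    simp only [Tm.eval, Store.put_var, hτ, h2] at h
    have := Tm.pivotTest_eval (e := .var 5) (f := .var 6) (g := .sub (.var 13) (.var 2)) hI'' hX''
      (by simpa [h5] using hvn) (by simpa [h6] using hpn) (by simp [hτ, h2]; omega)
    simp only [Tm.eval, Store.put_var, hτ, h2, h5, h6] at this
    have hsucc : Tm.eval (τ.put 6 i 0) (.succ (.pivotTest (.var 5) (.var 6)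
      (.sub (.var 13) (.var 2)))) = _ := congrArg (· + 1) this
    rw [hsucc]
    simp only [Tm.eval, Store.put_var, hτ]
    exact key _ (by rw [if_neg h, add_comm])

/-- Process all digit vectors for the vertex in variable `5` and the pivot in variable `6`. -/
def pivotCmd : Cmd := .seq initDigits enumerateCmd

theorem pivotCmd_spec {X : Finset ℕ} {v p i γ : ℕ} {L : List (Finset ℕ)} (hI : Input G n s σ)
    (hn : 1 ≤ n) (hs : s ≤ n) (hX : Alive n X σ) (hL : Listed G n s L σ) (hv : σ.var 5 = v)
    (hvX : v ∈ X) (hp : σ.var 6 = p) (hpn : p < n) (hi : σ.var 4 = i) (hin : i ≤ n)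
    (ho : ∀ j < i, σ.arr 3 j < n) (hγ : (pivotNbrs G X v p).card ≤ γ) :
    Tri pivotCmd σ (n ^ (2 * s - 3) * 2 ^ γ * (190 * n ^ 2)) fun τ => ∃ L', Listed G n s L' τ ∧
      L ⊆ L' ∧ ∀ T B S' S, T ⊆ X → T.card ≤ 2 * s - 3 → B ⊆ pivotNbrs G X v p →
        S' = insert v (T ∪ B) → IsPlex G s S' →
        (descending (σ.arr 3) i).foldl (tryAdd G s) S' = S →
        IsMaximalPlexIn G s (Finset.range n) S → S ∈ L' := by
  classical
  have hvn := Finset.mem_range.1 (hX.subset hvX)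
  set r : ℕ → ℕ := fun j => if j < 2 * s - 3 then n else
    1 + if j - (2 * s - 3) ∈ pivotNbrs G X v p then 1 else 0 with hr
  set N := n ^ (2 * s - 3) * 2 ^ γ with hN
  -- There is at least one vector in the bound, so the set-up costs can be absorbed into the term
  -- for the vectors.
  have hN1 : 1 ≤ N := Nat.mul_pos (pow_pos hn _) (by positivity)
  refine Tri.le (k := 5 * (2 * s - 3 + n) + 2 + (N * (170 * n ^ 2) + 2)) ?_ ?_
  swap
  · have h1 : 5 * (2 * s - 3 + n) + 4 ≤ 20 * n ^ 2 := by
      have : n ≤ n ^ 2 := by nlinarith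
      omega
    have h2 : 20 * n ^ 2 ≤ N * (20 * n ^ 2) := Nat.le_mul_of_pos_left _ hN1
    have h3 : N * (190 * n ^ 2) = N * (170 * n ^ 2) + N * (20 * n ^ 2) := by ring
    omega
  refine (initDigits_spec hI hX hv hvn hp hpn).seq fun τ hτ hd => ?_
  have hprod : ∏ j ∈ Finset.range (2 * s - 3 + n), τ.arr 7 j ≤ N := by
    rw [Finset.prod_congr rfl fun j hj => (hd j (Finset.mem_range.1 hj)).2, prod_radix hX.subset]
    exact Nat.mul_le_mul_left _ (Nat.pow_le_pow_right two_pos hγ)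
  refine (enumerateCmd_spec (hI.of_same hτ rfl) hn hs (hL.of_same hτ rfl rfl rfl rfl)
    ((hτ.var 5 rfl).trans hv) hvn ((hτ.var 4 rfl).trans hi) hin (by rw [hτ.arr 3 rfl]; exact ho) rfl
    (fun j hj => ?_) (fun j hj => ?_) (fun j hj => (hd j hj).1) hprod).mono le_rfl ?_
  · rw [(hd j hj).2]
    split_ifs <;> omega
  · rw [(hd j (by omega)).2, if_pos hj]
  · rintro ρ hρ ⟨L', hL', hLL', hall⟩
    refine ⟨L', hL', hLL', fun T B S' S hT hcard hB hS' hplex hf hS => ?_⟩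
    obtain ⟨d, hdr, hdS⟩ := exists_digits hX.subset hvX hT hcard hB hS'
    have := hall d fun j hj => by rw [(hd j hj).2]; exact hdr j hj
    rwa [hτ.arr 3 rfl, greedyPlex_eq hS hplex hdS hf] at this

/-- Process the next vertex of the ordering. -/
def levelCmd : Cmd :=
  .seq selectCmd <| .seq (.put 3 (.var 4) (.var 5)) <| .seq (.forTo 6 0 pivotCmd) <|
    .put 2 (.var 5) (.const 1)

theorem levelCmd_spec {X : Finset ℕ} {i γ : ℕ} {L : List (Finset ℕ)} (hI : Input G n s σ)
    (hn : 1 ≤ n) (hs : s ≤ n) (hX : Alive n X σ) (hL : Listed G n s L σ) (hi : σ.var 4 = i)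
    (hin : i ≤ n) (ho : ∀ j < i, σ.arr 3 j < n)
    (hγ : ∃ u ∈ X, ∀ p < n, (pivotNbrs G X u p).card ≤ γ) :
    Tri levelCmd σ (n ^ (2 * s - 3) * 2 ^ γ * (220 * n ^ 3)) fun τ => ∃ L' v, Listed G n s L' τ ∧
      L ⊆ L' ∧ v ∈ X ∧ Alive n (X.erase v) τ ∧ τ.arr 3 i = v ∧ (∀ j ≠ i, τ.arr 3 j = σ.arr 3 j) ∧
      ∀ S' S, IsCandidate G s X v S' → IsPlex G s S' →
        (descending (τ.arr 3) i).foldl (tryAdd G s) S' = S →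
        IsMaximalPlexIn G s (Finset.range n) S → S ∈ L' := by
  set N := n ^ (2 * s - 3) * 2 ^ γ with hN
  have hN1 : 1 ≤ N := Nat.mul_pos (pow_pos hn _) (by positivity)
  refine Tri.le (k := 23 * n ^ 3 + (1 + ((n * (N * (190 * n ^ 2) + 2) + 2) + 1))) ?_ ?_
  swap
  · have h1 : 1 ≤ n ^ 3 := Nat.one_le_pow _ _ hn
    have h2 : n ≤ n ^ 3 := Nat.le_self_pow (by norm_num) n
    have h3 : n * (N * (190 * n ^ 2) + 2) = N * (190 * n ^ 3) + 2 * n := by ring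
    have h4 : 30 * n ^ 3 ≤ N * (30 * n ^ 3) := Nat.le_mul_of_pos_left _ hN1
    have h5 : N * (220 * n ^ 3) = N * (190 * n ^ 3) + N * (30 * n ^ 3) := by ring
    omega
  refine (selectCmd_spec hI hX hn hγ).seq fun σ₁ h₁ ⟨hvX, hv⟩ => ?_
  obtain ⟨v, hv₁⟩ : ∃ v, σ₁.var 5 = v := ⟨_, rfl⟩
  rw [hv₁] at hvX hv
  have hi₁ : σ₁.var 4 = i := (h₁.var 4 rfl).trans hi
  refine Tri.seq (Q := fun τ => τ = σ₁.put 3 i v) (.put (by simp [hi₁, hv₁])) ?_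
  rintro _ h₂ rfl
  have h3 : ∀ j ≠ i, (σ₁.put 3 i v).arr 3 j = σ.arr 3 j := fun j hj => by
    simp [hj, h₁.arr 3 rfl]
  have hI₂ := (hI.of_same h₁ rfl).of_same h₂ rfl
  have hX₂ := (hX.of_same h₁ rfl).of_same h₂ rfl
  have hL₂ := (hL.of_same h₁ rfl rfl rfl rfl).of_same h₂ rfl rfl rfl rfl
  refine (Tri.forTo (k := N * (190 * n ^ 2)) (N := n) (fun p τ => ∃ L', Listed G n s L' τ ∧ L ⊆ L' ∧
    ∀ q < p, ∀ T B S' S, T ⊆ X → T.card ≤ 2 * s - 3 → B ⊆ pivotNbrs G X v q →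
      S' = insert v (T ∪ B) → IsPlex G s S' →
      (descending ((σ₁.put 3 i v).arr 3) i).foldl (tryAdd G s) S' = S →
      IsMaximalPlexIn G s (Finset.range n) S → S ∈ L') rfl rfl rfl hI₂.var_n
    ⟨L, hL₂.set rfl, List.Subset.refl _, by simp⟩
    fun p hp τ hτ hS ⟨L₁, hL₁, hLL₁, hdone⟩ => ?_).seq fun τ hS ⟨L', hL', hLL', hdone⟩ => .put ?_
  · refine (pivotCmd_spec (hI₂.of_same hS rfl) hn hs (hX₂.of_same hS rfl) hL₁
      ((hS.var 5 rfl).trans hv₁) hvX hτ hp ((hS.var 4 rfl).trans hi₁) hin (fun j hj => ?_)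
      (hv p hp)).mono le_rfl ?_
    · rw [hS.arr 3 rfl, h3 j hj.ne]
      exact ho j hj
    · rintro ρ hρ ⟨L₂, hL₂, hLL₂, hall⟩
      refine ⟨L₂, hL₂.set rfl, fun x hx => hLL₂ (hLL₁ hx),
        fun q hq T B S' S hT hc hB hS' hpl hf hmax => ?_⟩
      rcases Nat.lt_succ_iff_lt_or_eq.1 hq with hq | rfl
      · exact hLL₂ (hdone q hq T B S' S hT hc hB hS' hpl hf hmax)
      · exact hall T B S' S hT hc hB hS' hpl (by rwa [hS.arr 3 rfl]) hmax
  · have h5 : τ.var 5 = v := (hS.var 5 rfl).trans hv₁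
    have h3' : τ.arr 3 = (σ₁.put 3 i v).arr 3 := hS.arr 3 rfl
    have h3'' : (τ.put 2 v 1).arr 3 = τ.arr 3 := by
      funext j
      simp
    simp only [Tm.eval, h5]
    rw [h3'', h3']
    refine ⟨L', v, hL'.put rfl rfl, hLL', hvX,
      ⟨(Finset.erase_subset _ _).trans hX.subset, fun x hx => ?_⟩, by simp, h3, ?_⟩
    · have := (hX₂.of_same hS rfl).mem x hx
      simp only [Store.put_arr, Finset.mem_erase, true_and]
      split_ifs with hxv
      · simp [hxv]
      · simp [hxv, this]
    · rintro S' S ⟨p, hp, T, B, hT, hc, hB, hS'⟩ hpl hf hmax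
      exact hdone p (Finset.mem_range.1 (hX.subset hp)) T B S' S hT hc hB hS' hpl hf hmax

theorem remaining_congr {V : Type*} [DecidableEq V] {X : Finset V} {ord ord' : ℕ → V} {i : ℕ}
    (h : ∀ j < i, ord j = ord' j) : remaining X ord i = remaining X ord' i := by
  rw [remaining, remaining, Finset.image_congr fun j hj => h j (by simpa using hj)]

theorem descending_congr {V : Type*} {ord ord' : ℕ → V} {i : ℕ} (h : ∀ j < i, ord j = ord' j) :
    descending ord i = descending ord' i :=
  List.map_congr_left fun j hj => h _ (by have := List.mem_range.1 hj; omega)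

/-- Process all vertices. -/
def levelsCmd : Cmd := .forTo 4 0 levelCmd

/-- After `i` levels, every maximal plex that arises from a candidate of an earlier level is listed;
after `n` levels `IsMaximalPlexIn.exists_isCandidate` covers them all. -/
theorem levelsCmd_spec {γ : ℕ} (hI : Input G n s σ) (hn : 1 ≤ n) (hs1 : 1 ≤ s) (hs : s ≤ n)
    (hX : Alive n (Finset.range n) σ) (hL : Listed G n s [] σ)
    (hγ : ∀ X ⊆ Finset.range n, X.Nonempty → ∃ u ∈ X, ∀ p, (pivotNbrs G X u p).card < γ) :
    Tri levelsCmd σ (n ^ (2 * s - 3) * 2 ^ γ * (224 * n ^ 4)) fun τ => ∃ L, Listed G n s L τ ∧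
      ∀ S, IsMaximalPlexIn G s (Finset.range n) S → S ∈ L := by
  set N := n ^ (2 * s - 3) * 2 ^ γ with hN
  have hN1 : 1 ≤ N := Nat.mul_pos (pow_pos hn _) (by positivity)
  refine (Tri.forTo (k := N * (220 * n ^ 3)) (N := n) (fun i τ => ∃ L, Listed G n s L τ ∧
    Alive n (remaining (Finset.range n) (τ.arr 3) i) τ ∧
    ∀ j < i, τ.arr 3 j ∈ remaining (Finset.range n) (τ.arr 3) j ∧
      ∀ S' S, IsCandidate G s (remaining (Finset.range n) (τ.arr 3) j) (τ.arr 3 j) S' →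
        IsPlex G s S' → (descending (τ.arr 3) j).foldl (tryAdd G s) S' = S →
        IsMaximalPlexIn G s (Finset.range n) S → S ∈ L) rfl rfl rfl hI.var_n
    ⟨[], hL.set rfl, ?_, by simp⟩
    fun i hi τ hτ hS ⟨L, hL, hX, hdone⟩ => ?_).mono ?_ fun τ hS ⟨L, hL, hX, hdone⟩ =>
      ⟨L, hL, fun S hmax => ?_⟩
  · rw [remaining_zero]
    exact ⟨hX.subset, hX.mem⟩
  · have hne : (remaining (Finset.range n) (τ.arr 3) i).Nonempty := by
      rw [← Finset.card_pos, card_remaining fun j hj => (hdone j hj).1, Finset.card_range]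
      omega
    obtain ⟨u, hu, huγ⟩ := hγ _ hX.subset hne
    refine (levelCmd_spec (hI.of_same hS rfl) hn hs hX hL hτ hi.le (fun j hj => ?_)
      ⟨u, hu, fun p _ => (huγ p).le⟩).mono le_rfl ?_
    · exact Finset.mem_range.1 (Finset.sdiff_subset (hdone j hj).1)
    · rintro ρ hρ ⟨L', v, hL', hLL', hv, hX', h3, h3', hcand⟩
      -- A level changes only entry `i` of the ordering, so what was proved about earlier levels
      -- stays valid.
      have hrem : ∀ j ≤ i, remaining (Finset.range n) (ρ.arr 3) j =
          remaining (Finset.range n) (τ.arr 3) j := fun j hj =>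
        remaining_congr fun k hk => h3' k (by omega)
      refine ⟨L', hL'.set rfl, ?_, fun j hj => ?_⟩
      · change Alive n (remaining (Finset.range n) (ρ.arr 3) (i + 1)) _
        rw [remaining_succ, hrem i le_rfl, h3]
        exact ⟨hX'.subset, hX'.mem⟩
      · change ρ.arr 3 j ∈ remaining (Finset.range n) (ρ.arr 3) j ∧
          ∀ S' S, IsCandidate G s (remaining (Finset.range n) (ρ.arr 3) j) (ρ.arr 3 j) S' →
            IsPlex G s S' → (descending (ρ.arr 3) j).foldl (tryAdd G s) S' = S →
            IsMaximalPlexIn G s (Finset.range n) S → S ∈ L'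
        rw [hrem j (by omega)]
        rcases Nat.lt_succ_iff_lt_or_eq.1 hj with hj | rfl
        · rw [h3' j hj.ne, descending_congr fun k hk => h3' k (by omega)]
          exact ⟨(hdone j hj).1, fun S' S h1 h2 h3 h4 => hLL' ((hdone j hj).2 S' S h1 h2 h3 h4)⟩
        · rw [h3]
          exact ⟨hv, hcand⟩
  · have h2 : n ≤ n ^ 4 := Nat.le_self_pow (by norm_num) n
    have h3 : n * (N * (220 * n ^ 3) + 2) = N * (220 * n ^ 4) + 2 * n := by ring
    have h4 : 4 * n ^ 4 ≤ N * (4 * n ^ 4) := Nat.le_mul_of_pos_left _ hN1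
    have h5 : N * (224 * n ^ 4) = N * (220 * n ^ 4) + N * (4 * n ^ 4) := by ring
    omega
  · obtain ⟨i, hi, S', hc, hp, hf⟩ := hmax.exists_isCandidate hn hs1 (Finset.card_range n)
      fun i hi => (hdone i hi).1
    exact (hdone i hi).2 S' S hc hp hf hmax

end

/-! ### Initialisation -/

/-- The store that represents the input. -/
def startStore (n s : ℕ) (A : ℕ → ℕ) : Store where
  var x := if x = 0 then n else if x = 1 then s else 0
  arr a i := if a = 0 then A i else 0
  out := []

/-- Compute the row offsets. -/
def rowsCmd : Cmd :=
  .seq (.set 8 (.const 0)) <| .forTo 4 0 <| .seq (.put 1 (.var 4) (.var 8)) <|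
    .forTo 5 0 <| .set 8 (.succ (.var 8))

/-- The array language has no multiplication, so the products are obtained by counting. -/
theorem rowsCmd_spec {n : ℕ} {σ : Store} (hn : σ.var 0 = n) :
    Tri rowsCmd σ (3 * n ^ 2 + 5 * n + 3) fun τ => ∀ i < n, τ.arr 1 i = i * n := by
  refine Tri.le (k := 1 + (n * (1 + (n * (1 + 2) + 2) + 2) + 2)) ?_ (by nlinarith)
  refine Tri.seq (Q := fun τ => τ = σ.set 8 0) (.set rfl) ?_
  rintro _ - rfl
  refine (Tri.forTo (k := 1 + (n * (1 + 2) + 2)) (N := n)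
    (fun i τ => τ.var 8 = i * n ∧ ∀ j < i, τ.arr 1 j = j * n) rfl rfl rfl (by simpa using hn)
    (by simp) fun i hi τ hτ hS hQ => ?_).mono le_rfl fun τ _ hQ => hQ.2
  refine Tri.seq (Q := fun ρ => ρ = τ.put 1 i (i * n)) (.put (by simp [hτ, hQ.1])) ?_
  rintro _ - rfl
  refine (Tri.forTo (σ := τ.put 1 i (i * n)) (x := 5) (y := 0) (p := .set 8 (.succ (.var 8)))
    (k := 1) (N := n) (fun k ρ => ρ.var 8 = i * n + k) rfl rfl rfl
    ((hS.var 0 rfl).trans hn) (by simpa using hQ.1) fun k hk ρ _ hρ hP => .set ?_).mono le_rfl ?_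
  · simp [hP, add_assoc]
  · intro ρ hρ hP
    refine ⟨by simp [hP, Nat.add_mul], fun j hj => ?_⟩
    have h1 : ρ.arr 1 = (τ.put 1 i (i * n)).arr 1 := hρ.arr 1 rfl
    rw [Store.set_arr, h1]
    rcases Nat.lt_succ_iff_lt_or_eq.1 hj with hj | rfl
    · simpa [hj.ne] using hQ.2 j hj
    · simp

/-- Bound `s` by `n` and compute the numbers of digits. -/
def lengthsCmd : Cmd :=
  .seq (.ite (.lt (.var 0) (.var 1)) (.set 1 (.var 0)) .skip) <|
  .seq (.set 2 (.const 0)) <| .seq (.forTo 4 1 (.set 2 (.succ (.succ (.var 2))))) <|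
  .seq (.set 2 (.sub (.var 2) (.const 3))) <| .seq (.set 3 (.var 2)) <|
  .forTo 4 0 (.set 3 (.succ (.var 3)))

theorem lengthsCmd_spec {n s : ℕ} {σ : Store} (hn : σ.var 0 = n) (hs : σ.var 1 = s) :
    Tri lengthsCmd σ (6 * n + 9) fun τ => τ.var 1 = min s n ∧ τ.var 2 = 2 * min s n - 3 ∧
      τ.var 3 = 2 * min s n - 3 + n := by
  have h1 : Tri (.ite (.lt (.var 0) (.var 1)) (.set 1 (.var 0)) .skip) σ (1 + 1)
      fun τ => τ.var 1 = min s n := by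
    refine .ite (fun h => .set ?_) fun h => .skip ?_
    all_goals
      rw [Tm.lt_pos] at h
      simp only [Tm.eval, hn, hs] at h
    · simp [hn, h.le]
    · simp [hs, not_lt.1 h]
  set k := min s n with hk
  refine Tri.le (k := 1 + 1 + (1 + (k * (1 + 2) + 2 + (1 + (1 + (n * (1 + 2) + 2)))))) ?_ (by omega)
  refine h1.seq fun σ₁ hS₁ hk₁ => ?_
  refine Tri.seq (Q := fun τ => τ = σ₁.set 2 0) (.set rfl) ?_
  rintro _ - rfl
  refine (Tri.forTo (k := 1) (N := k) (fun i τ => τ.var 2 = 2 * i) rfl rfl rfl (by simpa using hk₁)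
    (by simp) fun i hi τ hτ hS hQ => .set (by simp [hQ]; omega)).seq fun σ₂ hS₂ h2 => ?_
  have hn₂ : σ₂.var 0 = n := (hS₂.var 0 rfl).trans ((hS₁.var 0 rfl).trans hn)
  have hk₂ : σ₂.var 1 = k := (hS₂.var 1 rfl).trans hk₁
  refine Tri.seq (Q := fun τ => τ = σ₂.set 2 (2 * k - 3)) (.set (by simp [h2])) ?_
  rintro _ - rfl
  refine Tri.seq (Q := fun τ => τ = (σ₂.set 2 (2 * k - 3)).set 3 (2 * k - 3)) (.set (by simp)) ?_
  rintro _ - rfl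
  refine (Tri.forTo (k := 1) (N := n) (fun i τ => τ.var 3 = 2 * k - 3 + i) rfl rfl rfl
    (by simpa using hn₂) (by simp) fun i hi τ hτ hS hQ => .set (by simp [hQ, add_assoc])).mono le_rfl
    fun τ hS hQ => ⟨(hS.var 1 rfl).trans hk₂, (hS.var 2 rfl).trans rfl, hQ⟩

/-- The enumeration program in the array language. -/
def mainCmd : Cmd := .seq rowsCmd <| .seq lengthsCmd <| .seq (.set 17 (.const 1)) levelsCmd

/-- A vertex has at most `n` nonneighbours in `S`, so a larger `s` imposes nothing. Capping `s` at
`n` keeps the number of digits O(n). -/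
theorem isPlex_min {V : Type*} [DecidableEq V] {G : SimpleGraph V} {s n : ℕ} {S : Finset V}
    (h : S.card ≤ n) : IsPlex G (min s n) S ↔ IsPlex G s S := by
  classical
  rw [isPlex_iff, isPlex_iff]
  refine forall₂_congr fun v _ => ?_
  have := (Finset.card_filter_le S fun x => ¬ G.Adj v x).trans h
  omega

theorem isMaximalPlexIn_min {V : Type*} [DecidableEq V] {G : SimpleGraph V} {s n : ℕ}
    {X S : Finset V} (h : X.card ≤ n) :
    IsMaximalPlexIn G (min s n) X S ↔ IsMaximalPlexIn G s X S := by
  have key : ∀ T ⊆ X, (IsPlex G (min s n) T ↔ IsPlex G s T) := fun T hT =>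
    isPlex_min ((Finset.card_le_card hT).trans h)
  constructor
  · exact fun hS => ⟨hS.subset, (key S hS.subset).1 hS.isPlex, fun u hu hp =>
      hS.mem_of_insert u hu ((key _ (Finset.insert_subset hu hS.subset)).2 hp)⟩
  · exact fun hS => ⟨hS.subset, (key S hS.subset).2 hS.isPlex, fun u hu hp =>
      hS.mem_of_insert u hu ((key _ (Finset.insert_subset hu hS.subset)).1 hp)⟩

open Classical in
theorem mainCmd_spec {G : SimpleGraph ℕ} {n s γ : ℕ} {A : ℕ → ℕ} (hn : 1 ≤ n) (hs : 2 ≤ s)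
    (hA : ∀ i < n, ∀ j < n, A (i * n + j) = if G.Adj i j then 1 else 0)
    (hγ : ∀ X ⊆ Finset.range n, X.Nonempty → ∃ u ∈ X, ∀ p, (pivotNbrs G X u p).card < γ) :
    Tri mainCmd (startStore n s A) (254 * (2 ^ γ * n ^ (2 * s + 1))) fun τ => ∃ L : List (Finset ℕ),
      L.Nodup ∧ (∀ S, S ∈ L ↔ IsMaximalPlexIn G s (Finset.range n) S) ∧
      τ.out = L.flatMap fun S => (List.range n).map fun x => if x ∈ S then 1 else 0 := by
  set k := min s n with hk
  refine Tri.le (k := 3 * n ^ 2 + 5 * n + 3 + (6 * n + 9 +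
    (1 + n ^ (2 * k - 3) * 2 ^ γ * (224 * n ^ 4)))) ?_ ?_
  swap
  -- For `k = 1` the truncated exponent `2 * k - 3` is `0`; the comparison still holds because `2 ≤
  -- s`.
  · have h1 : n ^ (2 * k - 3) * n ^ 4 ≤ n ^ (2 * s + 1) := by
      rw [← pow_add]
      exact Nat.pow_le_pow_right hn (by omega)
    have h2 : n ^ 2 ≤ n ^ (2 * s + 1) := Nat.pow_le_pow_right hn (by omega)
    have h3 : n ≤ n ^ (2 * s + 1) := Nat.le_self_pow (by omega) n
    have h4 : 1 ≤ n ^ (2 * s + 1) := Nat.one_le_pow _ _ hn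
    have h5 : n ^ (2 * s + 1) ≤ 2 ^ γ * n ^ (2 * s + 1) :=
      Nat.le_mul_of_pos_left _ (by positivity)
    have h6 : n ^ (2 * k - 3) * 2 ^ γ * (224 * n ^ 4) ≤ 224 * (2 ^ γ * n ^ (2 * s + 1)) := by
      calc _ = 224 * (2 ^ γ * (n ^ (2 * k - 3) * n ^ 4)) := by ring
        _ ≤ _ := Nat.mul_le_mul_left _ (Nat.mul_le_mul_left _ h1)
    omega
  refine (rowsCmd_spec (n := n) (by simp [startStore])).seq fun σ₁ h₁ hrow => ?_
  refine (lengthsCmd_spec (n := n) (s := s) (h₁.var 0 rfl) (h₁.var 1 rfl)).seq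
    fun σ₂ h₂ ⟨hs₂, hm₂, hM₂⟩ => ?_
  -- The initial trie is the root alone. It lists no set, since its word is empty whereas listed
  -- words have length `n ≥ 1`.
  refine Tri.seq (Q := fun τ => τ = σ₂.set 17 1) (.set rfl) ?_
  rintro _ - rfl
  have harr : ∀ a : Fin 16, a ≠ 1 → (σ₂.set 17 1).arr a = fun i => if a = 0 then A i else 0 := by
    intro a ha
    have : rowsCmd.writesArr a = false := by revert a; decide
    exact (h₂.arr a rfl).trans (h₁.arr a this)
  have hI : Input G n k (σ₂.set 17 1) := by
    refine ⟨(h₂.var 0 rfl).trans (h₁.var 0 rfl), hs₂, hm₂, hM₂, ?_, fun i hi j hj => ?_⟩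
    · change ∀ i < n, σ₂.arr 1 i = i * n
      rw [h₂.arr 1 rfl]
      exact hrow
    · rw [harr 0 (by decide)]
      simpa using hA i hi j hj
  have hX : Alive n (Finset.range n) (σ₂.set 17 1) :=
    ⟨subset_rfl, fun x hx => by rw [harr 2 (by decide)]; simpa using hx⟩
  have hL : Listed G n k [] (σ₂.set 17 1) := by
    have hch : (fun b => (σ₂.set 17 1).arr (childArr b)) = fun _ _ => 0 := by
      funext b i
      cases b
      · exact congrFun (harr 8 (by decide)) i
      · exact congrFun (harr 9 (by decide)) i
    refine ⟨List.nodup_nil, by simp, (h₂.out rfl).trans (h₁.out rfl), fun _ => [], ?_, ?_⟩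
    · unfold StoresTrie
      rw [hch]
      refine ⟨by simp, rfl, fun a ha b hb _ => ?_, by simp, by simp, by simp, by simp⟩
      simp at ha hb
      omega
    · intro S _
      simp only [List.not_mem_nil, false_iff, not_exists, not_and]
      intro a _ h
      have := congrArg List.length h
      rw [length_bits] at this
      simp at this
      omega
  refine (levelsCmd_spec hI hn (by omega) (by omega) hX hL hγ).mono le_rfl
    fun τ _ ⟨L, hL, hall⟩ => ⟨L, hL.nodup, fun S => ?_, hL.out⟩
  rw [← isMaximalPlexIn_min (n := n) (by simp)]
  exact ⟨hL.isMaximalPlexIn S, hall S⟩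

/-! ### Laying out the input on the machine, and the final program -/

/-- `for (reg 3 < reg y)` loops of the machine whose bodies take `k` steps. -/
theorem Exec.loop_of_invariant {W x y k N : ℕ} {p : Program} (I : ℕ → State → Prop)
    (hlt : ∀ i ρ, I i ρ → (ρ.reg x < ρ.reg y ↔ i < N))
    (hstep : ∀ i < N, ∀ ρ, I i ρ → ∃ ρ', Exec W p ρ ρ' k ∧ I (i + 1) ρ') {ρ : State} (h : I 0 ρ) :
    ∃ ρ', Exec W (.loop x y p) ρ ρ' (N * (k + 1) + 1) ∧ I N ρ' := by
  have key : ∀ d i ρ, i + d = N → I i ρ →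
      ∃ ρ', Exec W (.loop x y p) ρ ρ' (d * (k + 1) + 1) ∧ I N ρ' := by
    intro d
    induction d with
    | zero =>
      rintro i ρ rfl hI
      exact ⟨ρ, by simpa using .loopDone ((hlt i ρ hI).not.2 (by omega)), hI⟩
    | succ d ih =>
      intro i ρ hd hI
      obtain ⟨ρ₁, h₁, hI₁⟩ := hstep i (by omega) ρ hI
      obtain ⟨ρ₂, h₂, hI₂⟩ := ih (i + 1) ρ₁ (by omega) hI₁
      refine ⟨ρ₂, ?_, hI₂⟩
      rw [show (d + 1) * (k + 1) + 1 = k + 1 + (d * (k + 1) + 1) by ring]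
      exact .loopStep ((hlt i ρ hI).2 (by omega)) h₁ h₂
  exact key N 0 ρ (by omega) h

/-- Compute the base address `n ^ 2` in register `1`. -/
def baseProgram : Program :=
  .seq (.copy 2 1) <| .seq (.const 1 0) <| .seq (.const 3 0) <| .seq (.const 5 1) <|
    .loop 3 0 (.seq (.add 1 1 0) (.add 3 3 5))

/-- Copy the adjacency matrix to the array `0`. -/
def copyProgram : Program :=
  .seq (.const 3 0) <| .loop 3 1 <| .seq (.load 7 3) <| .seq (.copy 9 3) <|
    .seq (addressOf 0 9) <| .seq (.store 9 7) (.add 3 3 5)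

/-- Variable `1` lives in register `2`, so `s` moves there and register `1` becomes free for the
base address. -/
theorem exec_baseProgram {n s W : ℕ} (hn : 1 ≤ n) (hW : n * n ≤ W) {ρ : State}
    (h0 : ρ.reg 0 = n) (h1 : ρ.reg 1 = s) : ∃ ρ', Exec W baseProgram ρ ρ' (3 * n + 5) ∧
      ρ'.reg 1 = n * n ∧ ρ'.reg 2 = s ∧ ρ'.reg 5 = 1 ∧
      (∀ r, r % 2 = 0 → r ≠ 2 → ρ'.reg r = ρ.reg r) ∧ ρ'.mem = ρ.mem ∧ ρ'.out = ρ.out := by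
  have hnW : n ≤ W := le_trans (Nat.le_mul_of_pos_left _ hn) hW
  refine (Exec.loop_of_invariant (W := W) (x := 3) (y := 0) (k := 2) (N := n)
    (p := .seq (.add 1 1 0) (.add 3 3 5)) (ρ := (((ρ.setReg 2 s).setReg 1 0).setReg 3 0).setReg 5 1)
    (fun i ρ' => ρ'.reg 0 = n ∧ ρ'.reg 1 = i * n ∧ ρ'.reg 2 = s ∧ ρ'.reg 3 = i ∧ ρ'.reg 5 = 1 ∧
      (∀ r, r % 2 = 0 → r ≠ 2 → ρ'.reg r = ρ.reg r) ∧ ρ'.mem = ρ.mem ∧ ρ'.out = ρ.out)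
    (fun i ρ' h => by rw [h.1, h.2.2.2.1]) ?_ ?_).imp
      fun ρ' ⟨hx, h⟩ => ?_
  · rintro i hi ρ₁ ⟨h0, h1, h2, h3, h5, hr, hm, ho⟩
    have hle : i * n + n ≤ n * n := by
      rw [← Nat.succ_mul]; exact Nat.mul_le_mul_right _ hi
    refine ⟨_, .seq (t := 1) (u := 1) (.add _ 1 1 0 (by rw [h0, h1]; omega))
      (.add _ 3 3 5 (by simp [h3, h5]; omega)), ?_⟩
    refine ⟨by simpa using h0, by simp [h0, h1, Nat.add_mul], by simpa using h2, by simp [h3, h5],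
      by simpa using h5, fun r hr' hr2 => ?_, hm, ho⟩
    rw [State.setReg_reg, if_neg (by omega), State.setReg_reg, if_neg (by omega), hr r hr' hr2]
  · refine ⟨by simpa using h0, by simp, by simp, by simp, by simp, fun r hr hr2 => ?_, rfl, rfl⟩
    simp only [State.setReg_reg]
    rw [if_neg (by omega), if_neg (by omega), if_neg (by omega), if_neg (by omega)]
  · refine ⟨?_, h.2.1, h.2.2.1, h.2.2.2.2.1, h.2.2.2.2.2⟩
    rw [show 3 * n + 5 = 1 + (1 + (1 + (1 + (n * (2 + 1) + 1)))) by ring]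
    exact .seq (h1 ▸ .copy _ _ _) <| .seq (.const _ _ _ (Nat.zero_le _)) <|
      .seq (.const _ _ _ (Nat.zero_le _)) <| .seq (.const _ _ _ (by omega)) hx

/-- The matrix lies below the base address `b` and the arrays from `b` on, so copying never
overwrites its source; cells that are not written remain 0. -/
theorem exec_copyProgram {b W : ℕ} (hW : 17 * b + 16 ≤ W) {ρ : State} (h1 : ρ.reg 1 = b)
    (h5 : ρ.reg 5 = 1) (hmem : ∀ a, b ≤ a → ρ.mem a = 0) :
    ∃ ρ', Exec W copyProgram ρ ρ' (12 * b + 2) ∧ ρ'.reg 1 = b ∧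
      (∀ r, r % 2 = 0 → ρ'.reg r = ρ.reg r) ∧
      (∀ (a : Fin 16) i, ρ'.mem (b + 16 * i + a) = if a = 0 then ρ.mem i else 0) ∧
      ρ'.out = ρ.out := by
  refine (Exec.loop_of_invariant (W := W) (x := 3) (y := 1) (k := 11) (N := b)
    (p := .seq (.load 7 3) <| .seq (.copy 9 3) <| .seq (addressOf 0 9) <|
      .seq (.store 9 7) (.add 3 3 5)) (ρ := ρ.setReg 3 0)
    (fun k ρ' => ρ'.reg 1 = b ∧ ρ'.reg 3 = k ∧ ρ'.reg 5 = 1 ∧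
      (∀ r, r % 2 = 0 → ρ'.reg r = ρ.reg r) ∧
      (∀ a < b, ρ'.mem a = ρ.mem a) ∧
      (∀ (a : Fin 16) i, ρ'.mem (b + 16 * i + a) = if a = 0 ∧ i < k then ρ.mem i else 0) ∧
      ρ'.out = ρ.out) (fun i ρ' h => by rw [h.1, h.2.1]) ?_ ?_).imp
      fun ρ' ⟨hx, h⟩ => ?_
  · rintro k hk ρ₁ ⟨g1, g3, g5, gr, gb, gm, go⟩
    obtain ⟨ρ₂, x₂, r₂, a₂⟩ := exec_addressOf (W := W) (b := b) (x := 9) (i := k) (a := 0)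
      (ρ := (ρ₁.setReg 7 (ρ₁.mem k)).setReg 9 k) rfl (by norm_num) (by simpa using g1) (by simp)
      (by omega)
    have e3 : ρ₂.reg 3 = k := (a₂.reg 3 (by norm_num)).trans (by simpa using g3)
    have e5 : ρ₂.reg 5 = 1 := (a₂.reg 5 (by norm_num)).trans (by simpa using g5)
    have e7 : ρ₂.reg 7 = ρ.mem k := (a₂.reg 7 (by norm_num)).trans (by simpa using gb k hk)
    have em : ρ₂.mem = ρ₁.mem := a₂.mem
    refine ⟨_, .seq (t := 1) (u := 10) (by simpa [g3] using Exec.load (W := W) ρ₁ 7 3) <|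
      .seq (t := 1) (u := 9) (by simpa [g3] using Exec.copy (ρ₁.setReg 7 (ρ₁.mem k)) 9 3) <|
      .seq (t := 7) (u := 2) x₂ <| .seq (t := 1) (u := 1) (.store _ _ _) <| .add _ 3 3 5 ?_, ?_⟩
    · simp [e3, e5]; omega
    refine ⟨?_, ?_, ?_, fun r hr => ?_, fun a ha => ?_, fun a i => ?_, a₂.out.trans go⟩
    · simpa using (a₂.reg 1 (by norm_num)).trans (by simpa using g1)
    · simp [e3, e5]
    · simpa using e5
    · rw [State.setReg_reg, if_neg (by omega)]
      refine (a₂.reg r (.inl hr)).trans ?_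
      rw [State.setReg_reg, State.setReg_reg, if_neg (by omega), if_neg (by omega), gr r hr]
    · have : a ≠ b + 16 * k := by omega
      simpa [State.setReg, r₂, this, em] using gb a ha
    · have ha := a.2
      have hval := gm a i
      by_cases hc : a = 0 ∧ i = k
      · obtain ⟨rfl, rfl⟩ := hc
        simp [State.setReg, r₂, e7]
      · have hne : b + 16 * i + a ≠ b + 16 * k := by
          intro h
          exact hc ⟨Fin.ext (by simp; omega), by omega⟩
        have hiff : (a = 0 ∧ i < k + 1) ↔ (a = 0 ∧ i < k) := by
          constructor
          · rintro ⟨h1, h2⟩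
            exact ⟨h1, by have : i ≠ k := fun h => hc ⟨h1, h⟩
                          omega⟩
          · rintro ⟨h1, h2⟩
            exact ⟨h1, by omega⟩
        simp only [hiff]
        simpa [State.setReg, r₂, hne, em] using hval
  · refine ⟨by simpa using h1, by simp, by simpa using h5, fun r hr => ?_, fun _ _ => rfl,
      fun a i => ?_, rfl⟩
    · rw [State.setReg_reg, if_neg (by omega)]
    · simpa [State.setReg] using hmem _ (by omega)
  · refine ⟨?_, h.1, h.2.2.2.1, fun a i => ?_, h.2.2.2.2.2.2⟩
    · rw [show 12 * b + 2 = 1 + (b * (11 + 1) + 1) by ring]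
      exact .seq (.const _ _ _ (Nat.zero_le _)) hx
    · rw [h.2.2.2.2.2.1]
      by_cases hi : i < b
      · simp [hi]
      · simp [hi, hmem i (not_lt.1 hi)]

/-- The enumeration program. -/
def enumerationProgram : Program := .seq baseProgram <| .seq copyProgram mainCmd.compile

theorem inputState_mem {n s : ℕ} {G : SimpleGraph (Fin n)} {i j : ℕ} [Decidable ((natGraph G).Adj i j)]
    (hi : i < n) (hj : j < n) :
    (inputState G s).mem (i * n + j) = if (natGraph G).Adj i j then 1 else 0 := by
  have : (∃ i' j' : Fin n, i * n + j = (i' : ℕ) * n + (j' : ℕ) ∧ G.Adj i' j') ↔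
      (natGraph G).Adj i j := by
    constructor
    · rintro ⟨i', j', h, hadj⟩
      have hi' : i = i' := by
        have := congrArg (· / n) h
        simpa [Nat.mul_comm _ n, Nat.mul_add_div (show 0 < n by omega), Nat.div_eq_of_lt hj,
          Nat.div_eq_of_lt j'.2] using this
      subst hi'
      obtain rfl : j = j' := by omega
      exact natGraph_adj.2 hadj
    · intro h
      exact ⟨⟨i, hi⟩, ⟨j, hj⟩, rfl, natGraph_adj.1 h⟩
  simp only [inputState, this]

theorem inputState_mem_eq_zero {n s : ℕ} {G : SimpleGraph (Fin n)} {a : ℕ} (ha : n * n ≤ a) :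
    (inputState G s).mem a = 0 := by
  refine if_neg ?_
  rintro ⟨i, j, rfl, -⟩
  have := i.2
  have := j.2
  have : ((i : ℕ) + 1) * n ≤ n * n := Nat.mul_le_mul_right _ (by omega)
  rw [Nat.succ_mul] at this
  omega

theorem enumeratesMaximalPlexes_enumerationProgram {n s γ W : ℕ} {G : SimpleGraph (Fin n)}
    (hs : 2 ≤ s) (hn : 1 ≤ n) (hG : IsWeaklyClosed G γ)
    (hW : (10000 * (mainCmd.size + 1)) * (s + 2 ^ γ * n ^ (2 * s + 1)) ≤ W) :
    EnumeratesMaximalPlexes W enumerationProgram G s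
      ((10000 * (mainCmd.size + 1)) * (2 ^ γ * n ^ (2 * s + 1))) := by
  classical
  set P := 2 ^ γ * n ^ (2 * s + 1) with hP
  set K := mainCmd.size with hK
  have hPn : n ^ (2 * s + 1) ≤ P := Nat.le_mul_of_pos_left _ (by positivity)
  have hn2 : n * n ≤ P := by
    rw [← sq]
    exact (Nat.pow_le_pow_right hn (by omega)).trans hPn
  have hn1 : n ≤ P := (Nat.le_self_pow (by omega) n).trans hPn
  obtain ⟨τ, t, hrun, ht, L, hnodup, hL, hout⟩ := mainCmd_spec (G := natGraph G) (n := n) (s := s)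
    (γ := γ) (A := (inputState G s).mem) hn hs (fun i hi j hj => inputState_mem hi hj)
    fun X hX hne => hG.exists_card_pivotNbrs_natGraph_lt hX hne
  -- The constant 10000 leaves room for both uses: the coefficient of `K * P` is 32 · 255 = 8160 in
  -- the word bound and 24 · 254 = 6096 in the running time.
  have hKt : K * (t + 1) ≤ 255 * (K * P) := by
    calc K * (t + 1) ≤ K * (255 * P) := Nat.mul_le_mul_left _ (by omega)
      _ = 255 * (K * P) := by ring
  have hexp : (10000 * (K + 1)) * (s + P) = 10000 * (K * P) + 10000 * P + 10000 * (K * s) +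
    10000 * s := by ring
  rw [hexp] at hW
  obtain ⟨ρ₁, x₁, b₁, s₁, f₁, r₁, m₁, o₁⟩ := exec_baseProgram (n := n) (s := s) (W := W) hn (by omega)
    (ρ := inputState G s) (by simp [inputState]) (by simp [inputState])
  obtain ⟨ρ₂, x₂, b₂, r₂, m₂, o₂⟩ := exec_copyProgram (b := n * n) (W := W) (by omega) b₁ f₁
    (by rw [m₁]; exact fun a => inputState_mem_eq_zero)
  have hrep : Represents (n * n) (startStore n s (inputState G s).mem) ρ₂ := by
    refine ⟨fun x => ?_, b₂, fun a i => by rw [m₂, m₁]; rfl, o₂.trans o₁⟩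
    rw [r₂ _ (by omega)]
    by_cases hx : x = 1
    · subst hx; simpa [startStore] using s₁
    · rw [r₁ _ (by omega) (by omega)]
      simp only [inputState, startStore]
      split_ifs <;> omega
  have hbdd : (startStore n s (inputState G s).mem).BoundedBy (n + s) := by
    constructor
    · intro x
      simp only [startStore]
      split_ifs <;> omega
    · intro a i
      simp only [startStore, inputState]
      split_ifs <;> omega
  obtain ⟨-, ρ₃, u, x₃, hu, hrep₃⟩ := hrun.exec_compile K (n + s) ρ₂ le_rfl hbdd hrep (W := W) (by omega)
  refine ⟨ρ₃, _, L.map fun S => Finset.univ.filter fun i : Fin n => (i : ℕ) ∈ S,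
    .seq x₁ (.seq x₂ x₃), ?_, ?_, fun S => ?_, ?_⟩
  · have : (24 * K + 20) * t ≤ (24 * K + 20) * (254 * P) := Nat.mul_le_mul_left _ ht
    have h2 : (24 * K + 20) * (254 * P) = 6096 * (K * P) + 5080 * P := by ring
    have h3 : 10000 * (K + 1) * P = 10000 * (K * P) + 10000 * P := by ring
    omega
  · refine List.Nodup.map_on (fun S hS T hT h => ?_) hnodup
    have hS' := ((hL S).1 hS).subset
    have hT' := ((hL T).1 hT).subset
    ext x
    constructor
    · intro hx
      have := Finset.ext_iff.1 h ⟨x, Finset.mem_range.1 (hS' hx)⟩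
      simpa [hx] using this
    · intro hx
      have := Finset.ext_iff.1 h ⟨x, Finset.mem_range.1 (hT' hx)⟩
      simpa [hx] using this
  · rw [List.mem_map, ← isMaximalPlexIn_natGraph]
    constructor
    · rintro ⟨T, hT, rfl⟩
      have hT' := (hL T).1 hT
      convert hT'
      ext x
      simp only [Finset.mem_map, Finset.mem_filter, Finset.mem_univ, true_and,
        Fin.valEmbedding_apply]
      exact ⟨fun ⟨a, ha, h⟩ => h ▸ ha,
        fun hx => ⟨⟨x, Finset.mem_range.1 (hT'.subset hx)⟩, hx, rfl⟩⟩
    · intro hS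
      refine ⟨_, (hL _).2 hS, ?_⟩
      ext i
      simp [Fin.val_inj]
  · rw [hrep₃.out, hout, encodeSets, List.flatMap_map]
    congr 1
    funext S
    rw [List.ofFn_eq_map, ← List.map_coe_finRange_eq_range, List.map_map]
    refine List.map_congr_left fun i _ => ?_
    simp

end WeakClosure

theorem mainTheorem2 :
    (∃ C : ℕ, ∀ (s γ : ℕ) (V : Type*) [Fintype V] [Nonempty V] (G : SimpleGraph V),
      2 ≤ s → WeakClosure.IsWeaklyClosed G γ →
        {S : Finset V | WeakClosure.IsMaximalPlex G s S}.ncard ≤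
          C * (2 ^ γ * Fintype.card V ^ (2 * s - 1))) ∧
    (∃ (p : WeakClosure.Program) (C : ℕ), ∀ (s γ n : ℕ) (G : SimpleGraph (Fin n)),
      2 ≤ s → 1 ≤ n → WeakClosure.IsWeaklyClosed G γ →
        ∀ W : ℕ, C * (s + 2 ^ γ * n ^ (2 * s + 1)) ≤ W →
          WeakClosure.EnumeratesMaximalPlexes W p G s (C * (2 ^ γ * n ^ (2 * s + 1)))) := by
  classical
  refine ⟨⟨2, fun s γ V _ _ G hs hG => WeakClosure.ncard_isMaximalPlex_le hs hG⟩,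
    WeakClosure.enumerationProgram, 10000 * (WeakClosure.mainCmd.size + 1), ?_⟩
  intro s γ n G hs hn hG W hW
  exact WeakClosure.enumeratesMaximalPlexes_enumerationProgram hs hn hG hW
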